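/- Let $M=(M,J,g)$ be a connected Kähler surface, that is, a connected smooth manifold of real dimension $4$ with a Riemannian metric $g$ and a $g$-orthogonal almost complex structure $J$ that is parallel for the Levi-Civita connection of $g$. With $R(X,Y)Z=[\nabla_X,\nabla_Y]Z-\nabla_{[X,Y]}Z$ and $R(X,Y,Z,W)=g(R(X,Y)Z,W)$, let $\rho(X,Y)=\mathrm{tr}(Z\mapsto R(Z,X)Y)$ and $\rho^*(X,Y)=\mathrm{tr}(Z\mapsto R(X,JZ)JY)$ be the Ricci tensor and the Ricci $*$-tensor, and let $\tau$, $\tau^*$ be their traces with respect to $g$. Suppose that $M$ is Bochner flat, i.e. that the (Tricerri–Vanhecke) Bochner curvature tensor $$B(R)=R+\tfrac12\,g\wedge\rho+\tfrac1{12}\{g\triangle\rho^*-g\wedge\rho^*-g\triangle(\rho^*J)+g\wedge(\rho^*J)\}+\tfrac{3\tau^*-\tau}{96}\,g\triangle g-\tfrac{\tau+\tau^*}{16}\,g\wedge g$$ vanishes on $M$. Here $\wedge$ is the Kulkarni–Nomizu product, $(a\wedge b)(x,y,z,w)=a(x,z)b(y,w)-a(x,w)b(y,z)+b(x,z)a(y,w)-b(x,w)a(y,z)$,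 and $\bar a(x,y)=a(x,Jy)$, $(aJ)(x,y)=a(Jx,Jy)$, $a\triangle b=a\wedge b+\bar a\wedge\bar b+2\,\bar a\otimes\bar b+2\,\bar b\otimes\bar a$. Suppose also that the scalar curvature $\tau$ is constant on $M$. Then at least one of the following holds. (i) $M$ is locally a complex space form of complex dimension $2$: there is a constant $c\in\mathbb R$ such that the holomorphic sectional curvature $R(v,Jv,Jv,v)/g(v,v)^2$ equals $c$ for every nonzero tangent vector $v$ of $M$. (ii) There is a constant $K\neq0$ such that $M$ is locally a product of two oriented surfaces of constant Gaussian curvatures $K$ and $-K$: every point of $M$ has an open neighbourhood that is isometric, by a diffeomorphism which also identifies the almost complex structures, to a product $(M_1\times M_2,\,J_1\times J_2,\,g_1\times g_2)$, where $(M_1,g_1)$ and $(M_2,g_2)$ are oriented Riemannian surfaces of constant Gaussian curvatures $K$ and $-K$ and $J_i$ is the complex structure of $M_i$ given by its metric and its orientation. -/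

import Mathlib

open scoped Manifold ContDiff Bundle

noncomputable section

namespace KahlerSurface

/-! ### Riemannian and almost Hermitian geometry in coordinates

A `(0,2)`-tensor field on an open subset of `ℝⁿ` is given by its matrix of components
`a x i j = a(∂ᵢ, ∂ⱼ)` at `x`, and a field of endomorphisms by `J x k j`, where `J ∂ⱼ = ∑ₖ Jᵏⱼ ∂ₖ`. -/

/-- `ℝⁿ`, the space of coordinates. -/
abbrev Coord (n : ℕ) := EuclideanSpace ℝ (Fin n)

/-- A field of `n × n` matrices on `ℝⁿ`. -/
abbrev MatField (n : ℕ) := Coord n → Matrix (Fin n) (Fin n) ℝ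

/-- The partial derivative `∂ᵢ f` at `x`. -/
def pd {n : ℕ} (i : Fin n) (f : Coord n → ℝ) (x : Coord n) : ℝ :=
  fderiv ℝ f x (EuclideanSpace.single i 1)

/-- On the open set `V`, the matrix fields `G` and `J` are the components of a smooth Riemannian
metric and of a smooth almost complex structure that is orthogonal for this metric. For `n = 2`
this is the same as a Riemannian metric together with an orientation (`J` is the rotation by
`+90` degrees), that is, `V` is an oriented Riemannian surface. -/
structure IsAlmostHermitianOn {n : ℕ} (V : Set (Coord n)) (G J : MatField n) : Prop where
  isOpen : IsOpen V
  contDiffOn_metric : ∀ i j, ContDiffOn ℝ ∞ (fun x ↦ G x i j) V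
  contDiffOn_complex : ∀ i j, ContDiffOn ℝ ∞ (fun x ↦ J x i j) V
  posDef : ∀ x ∈ V, (G x).PosDef
  sq_eq : ∀ x ∈ V, J x * J x = -1
  orthogonal : ∀ x ∈ V, (J x).transpose * G x * J x = G x

/-- The Christoffel symbol `Γᵏᵢⱼ` of the Levi-Civita connection: `∇_{∂ᵢ} ∂ⱼ = ∑ₖ Γᵏᵢⱼ ∂ₖ`. -/
def christoffel {n : ℕ} (G : MatField n) (x : Coord n) (k i j : Fin n) : ℝ :=
  (1 / 2) * ∑ l, (G x)⁻¹ k l *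
    (pd i (fun y ↦ G y j l) x + pd j (fun y ↦ G y i l) x - pd l (fun y ↦ G y i j) x)

/-- The components `Rᵢⱼₖˡ` of the curvature tensor
`R(X,Y)Z = [∇_X, ∇_Y]Z - ∇_{[X,Y]}Z`: `R(∂ᵢ,∂ⱼ)∂ₖ = ∑ₗ Rᵢⱼₖˡ ∂ₗ`. -/
def curvUp {n : ℕ} (G : MatField n) (x : Coord n) (i j k l : Fin n) : ℝ :=
  pd i (fun y ↦ christoffel G y l j k) x - pd j (fun y ↦ christoffel G y l i k) x
    + ∑ m, (christoffel G x m j k * christoffel G x l i m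
      - christoffel G x m i k * christoffel G x l j m)

/-- `R(∂ᵢ,∂ⱼ,∂ₖ,∂ₗ) = g(R(∂ᵢ,∂ⱼ)∂ₖ, ∂ₗ)`. -/
def curv {n : ℕ} (G : MatField n) (x : Coord n) (i j k l : Fin n) : ℝ :=
  ∑ m, curvUp G x i j k m * G x m l

/-- The Ricci tensor `ρ(X,Y) = tr (Z ↦ R(Z,X)Y)`. -/
def ricci {n : ℕ} (G : MatField n) (x : Coord n) : Matrix (Fin n) (Fin n) ℝ :=
  fun i j ↦ ∑ a, curvUp G x a i j a

/-- The Ricci `*`-tensor `ρ*(X,Y) = tr (Z ↦ R(X,JZ)JY)`. -/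
def ricciStar {n : ℕ} (G J : MatField n) (x : Coord n) : Matrix (Fin n) (Fin n) ℝ :=
  fun i j ↦ ∑ a, ∑ b, ∑ c, J x b a * J x c j * curvUp G x i b c a

/-- The trace with respect to the metric `g` of a `(0,2)`-tensor `a`. -/
def metricTrace {n : ℕ} (g a : Matrix (Fin n) (Fin n) ℝ) : ℝ :=
  ∑ i, ∑ j, g⁻¹ i j * a i j

/-- The scalar curvature `τ`. -/
def scal {n : ℕ} (G : MatField n) (x : Coord n) : ℝ :=
  metricTrace (G x) (ricci G x)

/-- The `*`-scalar curvature `τ*`. -/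
def scalStar {n : ℕ} (G J : MatField n) (x : Coord n) : ℝ :=
  metricTrace (G x) (ricciStar G J x)

/-- The component `(∇_{∂ᵢ} J)ᵏⱼ` of the covariant derivative of `J`:
`(∇_{∂ᵢ} J) ∂ⱼ = ∑ₖ (∇ᵢJ)ᵏⱼ ∂ₖ`. -/
def nablaJ {n : ℕ} (G J : MatField n) (x : Coord n) (i k j : Fin n) : ℝ :=
  pd i (fun y ↦ J y k j) x + ∑ l, christoffel G x k i l * J x l j
    - ∑ l, christoffel G x l i j * J x k l

section TensorAlgebra

variable {n : ℕ}

/-- `ā(x,y) = a(x,Jy)`. -/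
def bar (J a : Matrix (Fin n) (Fin n) ℝ) : Matrix (Fin n) (Fin n) ℝ :=
  fun i j ↦ ∑ k, J k j * a i k

/-- `(aJ)(x,y) = a(Jx,Jy)`. -/
def twist (J a : Matrix (Fin n) (Fin n) ℝ) : Matrix (Fin n) (Fin n) ℝ :=
  fun i j ↦ ∑ k, ∑ l, J k i * J l j * a k l

/-- The Kulkarni-Nomizu product. -/
def kn (a b : Matrix (Fin n) (Fin n) ℝ) (i j k l : Fin n) : ℝ :=
  a i k * b j l - a i l * b j k + b i k * a j l - b i l * a j k

/-- `a △ b = a ∧ b + ā ∧ b̄ + 2 ā ⊗ b̄ + 2 b̄ ⊗ ā` (`∧` the Kulkarni-Nomizu product). -/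
def tri (J a b : Matrix (Fin n) (Fin n) ℝ) (i j k l : Fin n) : ℝ :=
  kn a b i j k l + kn (bar J a) (bar J b) i j k l
    + 2 * (bar J a i j * bar J b k l) + 2 * (bar J b i j * bar J a k l)

end TensorAlgebra

/-- The components of the Bochner curvature tensor `B(R)` (of Tricerri and Vanhecke) of an almost
Hermitian structure in real dimension `4`. -/
def bochner (G J : MatField 4) (x : Coord 4) (i j k l : Fin 4) : ℝ :=
  curv G x i j k l
    + (1 / 2) * kn (G x) (ricci G x) i j k l
    + (1 / 12) * (tri (J x) (G x) (ricciStar G J x) i j k l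
        - kn (G x) (ricciStar G J x) i j k l
        - tri (J x) (G x) (twist (J x) (ricciStar G J x)) i j k l
        + kn (G x) (twist (J x) (ricciStar G J x)) i j k l)
    + (3 * scalStar G J x - scal G x) / 96 * tri (J x) (G x) (G x) i j k l
    - (scal G x + scalStar G J x) / 16 * kn (G x) (G x) i j k l

/-- The holomorphic sectional curvature `R(v,Jv,Jv,v) / g(v,v)²` of the plane spanned by
`v ≠ 0` and `Jv`. -/
def holSectCurv {n : ℕ} (G J : MatField n) (x : Coord n) (v : Fin n → ℝ) : ℝ :=
  (∑ i, ∑ j, ∑ k, ∑ l,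
      curv G x i j k l * v i * ((J x).mulVec v) j * ((J x).mulVec v) k * v l)
    / (∑ i, ∑ j, G x i j * v i * v j) ^ 2

/-- The Gaussian curvature `R(∂₁,∂₂,∂₂,∂₁) / det g` of a surface. -/
def gaussCurv (G : MatField 2) (x : Coord 2) : ℝ :=
  curv G x 0 1 1 0 / (G x).det

/-! ### Manifolds -/

section Manifold

variable {M : Type*} [TopologicalSpace M] [ChartedSpace (Coord 4) M] [IsManifold (𝓡 4) ∞ M]

/-- Smooth Riemannian metrics on the 4-manifold `M`. -/
abbrev Metric (M : Type*) [TopologicalSpace M] [ChartedSpace (Coord 4) M]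
    [IsManifold (𝓡 4) ∞ M] :=
  Bundle.ContMDiffRiemannianMetric (𝓡 4) ∞ (Coord 4) (fun p : M ↦ TangentSpace (𝓡 4) p)

/-- (Not necessarily continuous) fields of endomorphisms of the tangent spaces of `M`. -/
abbrev EndField (M : Type*) [TopologicalSpace M] [ChartedSpace (Coord 4) M] :=
  (p : M) → (TangentSpace (𝓡 4) p →L[ℝ] TangentSpace (𝓡 4) p)

/-- The coordinate vector field `∂ᵢ` of the chart `φ`, at the point with coordinates `y`. -/
def coordVec (φ : OpenPartialHomeomorph M (Coord 4)) (y : Coord 4) (i : Fin 4) :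
    TangentSpace (𝓡 4) (φ.symm y) :=
  mfderiv (𝓡 4) (𝓡 4) φ.symm y (EuclideanSpace.single i (1 : ℝ) : Coord 4)

/-- The components `g(∂ᵢ,∂ⱼ)` of `g` in the chart `φ`. -/
def Metric.inChart (g : Metric M) (φ : OpenPartialHomeomorph M (Coord 4)) : MatField 4 :=
  fun y i j ↦ g.inner (φ.symm y) (coordVec φ y i) (coordVec φ y j)

/-- The components of `J` in the chart `φ`. -/
def EndField.inChart (J : EndField M) (φ : OpenPartialHomeomorph M (Coord 4)) : MatField 4 :=
  fun y k j ↦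
    let w : Coord 4 := mfderiv (𝓡 4) (𝓡 4) φ (φ.symm y) (J (φ.symm y) (coordVec φ y j))
    w k

/-- `(M, J, g)` is a Kähler manifold: `J` is a smooth almost complex structure, orthogonal
with respect to `g` and parallel for the Levi-Civita connection of `g`. -/
structure IsKahler (g : Metric M) (J : EndField M) : Prop where
  smooth : ContMDiff (𝓡 4) ((𝓡 4).prod 𝓘(ℝ, Coord 4 →L[ℝ] Coord 4)) ∞
    (fun p : M ↦ Bundle.TotalSpace.mk' (Coord 4 →L[ℝ] Coord 4)
      (E := fun q : M ↦ (TangentSpace (𝓡 4) q →L[ℝ] TangentSpace (𝓡 4) q)) p (J p))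
  sq_eq : ∀ (p : M) (v : TangentSpace (𝓡 4) p), J p (J p v) = -v
  orthogonal : ∀ (p : M) (v w : TangentSpace (𝓡 4) p),
    g.inner p (J p v) (J p w) = g.inner p v w
  parallel : ∀ φ ∈ IsManifold.maximalAtlas (𝓡 4) ∞ M, ∀ y ∈ φ.target, ∀ i k j,
    nablaJ (g.inChart φ) (J.inChart φ) y i k j = 0

/-- The Bochner curvature tensor vanishes identically on `M`. -/
def IsBochnerFlat (g : Metric M) (J : EndField M) : Prop :=
  ∀ φ ∈ IsManifold.maximalAtlas (𝓡 4) ∞ M, ∀ y ∈ φ.target, ∀ i j k l,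
    bochner (g.inChart φ) (J.inChart φ) y i j k l = 0

/-- The scalar curvature of `g` is constant on `M`. -/
def HasConstantScalarCurvature (g : Metric M) : Prop :=
  ∃ τ : ℝ, ∀ φ ∈ IsManifold.maximalAtlas (𝓡 4) ∞ M, ∀ y ∈ φ.target,
    scal (g.inChart φ) y = τ

/-- The holomorphic sectional curvature of `(M, J, g)` is constant, equal to `c`. -/
def HasConstantHolSectCurv (g : Metric M) (J : EndField M) (c : ℝ) : Prop :=
  ∀ φ ∈ IsManifold.maximalAtlas (𝓡 4) ∞ M, ∀ y ∈ φ.target, ∀ v : Fin 4 → ℝ, v ≠ 0 →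
    holSectCurv (g.inChart φ) (J.inChart φ) y v = c

/-- The first two of four coordinates. -/
def fstPair (y : Coord 4) : Coord 2 := !₂[y 0, y 1]

/-- The last two of four coordinates. -/
def sndPair (y : Coord 4) : Coord 2 := !₂[y 2, y 3]

/-- The block diagonal matrix with blocks `A` and `D`. -/
def blockDiag (A D : Matrix (Fin 2) (Fin 2) ℝ) : Matrix (Fin 4) (Fin 4) ℝ :=
  !![A 0 0, A 0 1, 0, 0;
     A 1 0, A 1 1, 0, 0;
     0, 0, D 0 0, D 0 1;
     0, 0, D 1 0, D 1 1]

/-- Near `p`, `(M, J, g)` is a product `(V₁ × V₂, J₁ × J₂, g₁ × g₂)` of two oriented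
Riemannian surfaces of constant Gaussian curvatures `K₁` and `K₂`: some open neighbourhood of `p`
is identified, by a diffeomorphism `φ`, with a product `V₁ × V₂` of open subsets of `ℝ²`, and under
this identification `g` becomes the product metric and `J` the product complex structure. -/
def IsProductOfSurfacesNear (g : Metric M) (J : EndField M) (K₁ K₂ : ℝ) (p : M) : Prop :=
  ∃ φ ∈ IsManifold.maximalAtlas (𝓡 4) ∞ M, p ∈ φ.source ∧
    ∃ (V₁ V₂ : Set (Coord 2)) (G₁ J₁ G₂ J₂ : MatField 2),
      IsAlmostHermitianOn V₁ G₁ J₁ ∧ IsAlmostHermitianOn V₂ G₂ J₂ ∧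
      φ.target = {y | fstPair y ∈ V₁ ∧ sndPair y ∈ V₂} ∧
      (∀ y ∈ φ.target, g.inChart φ y = blockDiag (G₁ (fstPair y)) (G₂ (sndPair y))) ∧
      (∀ y ∈ φ.target, J.inChart φ y = blockDiag (J₁ (fstPair y)) (J₂ (sndPair y))) ∧
      (∀ x ∈ V₁, gaussCurv G₁ x = K₁) ∧ (∀ x ∈ V₂, gaussCurv G₂ x = K₂)

end Manifold

end KahlerSurface

end

/-!
On a Kähler manifold the Ricci `*`-tensor equals the Ricci tensor `ρ`, which is symmetric and
`J`-invariant. Bochner flatness therefore expresses the curvature tensor `R` through `g`, `J`, `ρ`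
and the constant `τ` (`IsBochnerFlatOn.curv_eq`), namely `R = -(1/2) g ∧ ρ - (τ/48) g △ g + (τ/8) g
∧ g`.

*The Ricci tensor is parallel.* The covariant derivative of this formula is `∇R = -(1/2) g ∧ ∇ρ`.
The contracted second Bianchi identity makes `ρ` a Codazzi tensor (`codazzi_of_bianchi`), and a
`J`-invariant symmetric Codazzi tensor is parallel (`eq_zero_of_codazzi`). These identities are
verified at the centre of a chart in which `g` and `J` are standard at one point and the
Christoffel symbols vanish there (`exists_normal_chart`).

*The Ricci operator.* Let `S` be the endomorphism field with `ρ(X, Y) = g(SX, Y)`. Being parallel,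
it commutes with all `R(X, Y)`. By linear algebra in a unitary frame (`sq_traceFree_of_commute`),
the trace-free part `S - τ/4` satisfies `(S - τ/4)² = c` with `c ≥ 0`, and `τ (S - τ/4) = 0`. The
number `c` is a quarter of the trace of a parallel endomorphism field, hence constant on the
connected manifold (`exists_sq_traceFree_ricciEnd`).

*The case `c = 0`.* Then `ρ = (τ/4) g` and `R = -(τ/48) g △ g`, and the holomorphic sectional
curvature is `τ/6` (`IsBochnerFlatOn.holSectCurv_eq`).

*The case `c = K² > 0`.* Then `τ = 0`, and the eigenspaces of `S` for `K` and `-K` are parallel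
orthogonal complex line bundles. The curvature tensor is the sum of curvature tensors of constant
curvature `K` and `-K` on them (`isSplittingOn_eigenProj`). Product coordinates are constructed
without the de Rham decomposition theorem. Let `T` be the projection to one of the line bundles and
`κ` its curvature. The linear system `grad f = u`, `∇_X u = -κ f TX` for a function `f` and a
section `u` of the line bundle is flat (`IsSplittingOn.flat_splitSystem`), so it has local
solutions with prescribed `u(p)` and `f(p) = 0`. For two solutions, `g(u, u') + κ f f'` is
constant. Hence the two functions `x` obtained from an orthonormal basis at `p` have gradients with
Gram matrix `1 - κ x xᵀ`, and in the four functions obtained from both line bundles the metric is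
the product of the two metrics `modelMetric κ`, the inverse of `1 - κ x xᵀ`, which has Gaussian
curvature `κ` (`gaussCurv_modelMetric`). Since `J` preserves both factors, it acts on each as one
of the two rotations by a right angle, and the choice of the basis at `p` and continuity fix the
sign (`IsSplittingOn.exists_product_map`, `eq_neg_sqrt_modelDisc`).

The solutions of flat linear systems come from an integral equation along the rays that start at
`p`: the solution operator is the inverse of a Volterra perturbation of the identity, which depends
differentiably on the end point of the ray, and flatness identifies the derivative
(`eq_volterra_of_flat`, `exists_flat_solution`).

All computations take place in the charts of the maximal atlas, with matrix fields: `Γᵢ` is the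
matrix of `∂ⱼ ↦ ∇_{∂ᵢ} ∂ⱼ` (`gam`), `Fᵢⱼ` is the matrix of `R(∂ᵢ, ∂ⱼ)` (`crv`), and the changes of
charts are isometric immersions in the sense of `IsIsometricOn`.
-/

noncomputable section

namespace KahlerSurface

/-! ### Partial derivatives of functions and of matrix fields -/

section Calculus

variable {n m : ℕ} {U : Set (Coord n)} {x : Coord n}

lemma ContDiffOn.differentiableAt_of_isOpen {E F : Type*} [NormedAddCommGroup E] [NormedSpace ℝ E]
    [NormedAddCommGroup F] [NormedSpace ℝ F] {f : E → F} {U : Set E} {x : E}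
    (hf : ContDiffOn ℝ ∞ f U) (hU : IsOpen U) (hx : x ∈ U) : DifferentiableAt ℝ f x :=
  (hf.contDiffAt (hU.mem_nhds hx)).differentiableAt (by simp)

lemma pd_congr {f g : Coord n → ℝ} (hU : IsOpen U) (hx : x ∈ U) (h : ∀ y ∈ U, f y = g y)
    (i : Fin n) : pd i f x = pd i g x := by
  have : f =ᶠ[nhds x] g := Filter.eventually_of_mem (hU.mem_nhds hx) h
  simp only [pd, this.fderiv_eq]

lemma fderiv_apply_eq_sum_pd (f : Coord n → ℝ) (x v : Coord n) :
    fderiv ℝ f x v = ∑ i, v i * pd i f x := by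
  have hv : v = ∑ i, v i • EuclideanSpace.single i (1 : ℝ) := by
    ext j
    simp [Pi.single_apply]
  conv_lhs => rw [hv]
  simp [pd]

lemma pd_const (i : Fin n) (c : ℝ) : pd i (fun _ : Coord n ↦ c) x = 0 := by
  simp [pd]

lemma pd_coord (i j : Fin n) : pd i (fun y : Coord n ↦ y j) x = if i = j then 1 else 0 := by
  have : (fun y : Coord n ↦ y j) = fun y ↦ EuclideanSpace.proj (𝕜 := ℝ) j y := rfl
  rw [pd, this, ContinuousLinearMap.fderiv]
  simp [eq_comm]

lemma pd_add {f g : Coord n → ℝ} (hf : DifferentiableAt ℝ f x) (hg : DifferentiableAt ℝ g x)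
    (i : Fin n) : pd i (fun y ↦ f y + g y) x = pd i f x + pd i g x := by
  simp [pd, fderiv_fun_add hf hg]

lemma pd_sub {f g : Coord n → ℝ} (hf : DifferentiableAt ℝ f x) (hg : DifferentiableAt ℝ g x)
    (i : Fin n) : pd i (fun y ↦ f y - g y) x = pd i f x - pd i g x := by
  simp [pd, fderiv_fun_sub hf hg]

lemma pd_neg (f : Coord n → ℝ) (i : Fin n) : pd i (fun y ↦ -f y) x = -pd i f x := by
  simp [pd]

lemma pd_mul {f g : Coord n → ℝ} (hf : DifferentiableAt ℝ f x) (hg : DifferentiableAt ℝ g x)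
    (i : Fin n) : pd i (fun y ↦ f y * g y) x = pd i f x * g x + f x * pd i g x := by
  simp [pd, fderiv_fun_mul hf hg]
  ring

lemma pd_const_mul {f : Coord n → ℝ} (hf : DifferentiableAt ℝ f x) (c : ℝ) (i : Fin n) :
    pd i (fun y ↦ c * f y) x = c * pd i f x := by
  rw [pd_mul (by fun_prop) hf, pd_const]; ring

lemma pd_sum {ι : Type*} (s : Finset ι) {f : ι → Coord n → ℝ}
    (hf : ∀ a ∈ s, DifferentiableAt ℝ (f a) x) (i : Fin n) :
    pd i (fun y ↦ ∑ a ∈ s, f a y) x = ∑ a ∈ s, pd i (f a) x := by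
  simp [pd, fderiv_fun_sum hf]

lemma ContDiffOn.pd {f : Coord n → ℝ} (hU : IsOpen U) (hf : ContDiffOn ℝ ∞ f U) (i : Fin n) :
    ContDiffOn ℝ ∞ (fun y ↦ pd i f y) U :=
  (hf.fderiv_of_isOpen hU (by simp)).clm_apply contDiffOn_const

lemma pd_comm {f : Coord n → ℝ} (hU : IsOpen U) (hf : ContDiffOn ℝ ∞ f U) (hx : x ∈ U)
    (i j : Fin n) : pd i (fun y ↦ pd j f y) x = pd j (fun y ↦ pd i f y) x := by
  have hd : DifferentiableAt ℝ (fderiv ℝ f) x :=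
    ContDiffOn.differentiableAt_of_isOpen (hf.fderiv_of_isOpen hU (by simp)) hU hx
  have hs : IsSymmSndFDerivAt ℝ f x :=
    (hf.contDiffAt (hU.mem_nhds hx)).isSymmSndFDerivAt
      (by simp only [minSmoothness_of_isRCLikeNormedField]; exact ENat.LEInfty.out)
  have key : ∀ a b : Fin n, KahlerSurface.pd a (fun y ↦ KahlerSurface.pd b f y) x
      = fderiv ℝ (fderiv ℝ f) x (EuclideanSpace.single a 1) (EuclideanSpace.single b 1) := by
    intro a b
    simp only [KahlerSurface.pd]
    rw [fderiv_clm_apply hd (by fun_prop)]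
    simp
  rw [key, key]
  exact hs _ _

/-- The Jacobian matrix of a map between coordinate spaces. -/
def jac (h : Coord n → Coord m) (x : Coord n) : Matrix (Fin m) (Fin n) ℝ :=
  Matrix.of fun k i ↦ pd i (fun y ↦ h y k) x

lemma pd_comp {h : Coord n → Coord m} {f : Coord m → ℝ} (hf : DifferentiableAt ℝ f (h x))
    (hh : DifferentiableAt ℝ h x) (i : Fin n) :
    pd i (fun y ↦ f (h y)) x = ∑ k, jac h x k i * pd k f (h x) := by
  have : (fun y ↦ f (h y)) = f ∘ h := rfl
  rw [pd, this, fderiv_comp x hf hh, ContinuousLinearMap.comp_apply, fderiv_apply_eq_sum_pd]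
  refine Finset.sum_congr rfl fun k _ ↦ ?_
  congr 1
  have h2 : (fun y ↦ h y k) = fun y ↦ EuclideanSpace.proj (𝕜 := ℝ) k (h y) := rfl
  rw [jac, Matrix.of_apply, pd, h2]
  have h3 := (EuclideanSpace.proj (𝕜 := ℝ) k : Coord m →L[ℝ] ℝ).hasFDerivAt.comp x hh.hasFDerivAt
  have h4 := h3.fderiv
  simp only [Function.comp_def] at h4
  rw [h4]
  rfl

/-- The partial derivative of a matrix field, taken entry by entry. -/
def pdM (i : Fin n) (A : MatField n) (x : Coord n) : Matrix (Fin n) (Fin n) ℝ :=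
  Matrix.of fun k l ↦ pd i (fun y ↦ A y k l) x

/-- A matrix field with smooth entries. -/
def SmoothOn (U : Set (Coord n)) (A : MatField n) : Prop :=
  ∀ k l, ContDiffOn ℝ ∞ (fun y ↦ A y k l) U

variable {A B : MatField n}

lemma SmoothOn.mono {V : Set (Coord n)} (hA : SmoothOn U A) (h : V ⊆ U) : SmoothOn V A :=
  fun k l ↦ (hA k l).mono h

lemma SmoothOn.diffAt (hA : SmoothOn U A) (hU : IsOpen U) (hx : x ∈ U) (k l : Fin n) :
    DifferentiableAt ℝ (fun y ↦ A y k l) x :=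
  ContDiffOn.differentiableAt_of_isOpen (hA k l) hU hx

lemma SmoothOn.congr (hA : SmoothOn U A) (h : ∀ y ∈ U, B y = A y) : SmoothOn U B :=
  fun k l ↦ (hA k l).congr fun y hy ↦ by rw [h y hy]

lemma SmoothOn.const (M : Matrix (Fin n) (Fin n) ℝ) : SmoothOn U (fun _ ↦ M) :=
  fun _ _ ↦ contDiffOn_const

lemma SmoothOn.add (hA : SmoothOn U A) (hB : SmoothOn U B) : SmoothOn U (fun y ↦ A y + B y) :=
  fun k l ↦ (hA k l).add (hB k l)

lemma SmoothOn.sub (hA : SmoothOn U A) (hB : SmoothOn U B) : SmoothOn U (fun y ↦ A y - B y) :=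
  fun k l ↦ (hA k l).sub (hB k l)

lemma SmoothOn.smul {f : Coord n → ℝ} (hf : ContDiffOn ℝ ∞ f U) (hA : SmoothOn U A) :
    SmoothOn U (fun y ↦ f y • A y) :=
  fun k l ↦ hf.mul (hA k l)

lemma SmoothOn.transpose (hA : SmoothOn U A) : SmoothOn U (fun y ↦ (A y).transpose) :=
  fun k l ↦ hA l k

lemma SmoothOn.mul (hA : SmoothOn U A) (hB : SmoothOn U B) : SmoothOn U (fun y ↦ A y * B y) := by
  intro k l
  simp only [Matrix.mul_apply]
  exact ContDiffOn.sum fun j _ ↦ (hA k j).mul (hB j l)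

lemma SmoothOn.det (hA : SmoothOn U A) : ContDiffOn ℝ ∞ (fun y ↦ (A y).det) U := by
  simp only [Matrix.det_apply]
  refine ContDiffOn.sum fun σ _ ↦ ?_
  simp only [Units.smul_def, zsmul_eq_mul]
  exact contDiffOn_const.mul (contDiffOn_prod fun j _ ↦ hA _ _)

lemma SmoothOn.adjugate (hA : SmoothOn U A) : SmoothOn U (fun y ↦ (A y).adjugate) := by
  intro k l
  simp only [Matrix.adjugate_apply]
  refine SmoothOn.det (A := fun y ↦ (A y).updateRow l (Pi.single k 1)) fun a b ↦ ?_
  by_cases h : a = l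
  · subst h; simp only [Matrix.updateRow_self]; exact contDiffOn_const
  · simp only [Matrix.updateRow_ne h]; exact hA a b

lemma SmoothOn.inv (hA : SmoothOn U A) (h : ∀ y ∈ U, (A y).det ≠ 0) :
    SmoothOn U (fun y ↦ (A y)⁻¹) := by
  simp only [Matrix.inv_def, Ring.inverse_eq_inv']
  exact SmoothOn.smul (hA.det.inv h) hA.adjugate

lemma SmoothOn.pdM (hU : IsOpen U) (hA : SmoothOn U A) (i : Fin n) :
    SmoothOn U (fun y ↦ KahlerSurface.pdM i A y) :=
  fun k l ↦ ContDiffOn.pd hU (hA k l) i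

lemma SmoothOn.comp {V : Set (Coord n)} {h : Coord n → Coord n} (hA : SmoothOn V A)
    (hh : ContDiffOn ℝ ∞ h U) (hUV : ∀ y ∈ U, h y ∈ V) : SmoothOn U (fun y ↦ A (h y)) :=
  fun k l ↦ (hA k l).comp hh hUV

lemma SmoothOn.trace (hA : SmoothOn U A) : ContDiffOn ℝ ∞ (fun y ↦ (A y).trace) U := by
  simp only [Matrix.trace, Matrix.diag]
  exact ContDiffOn.sum fun j _ ↦ hA j j

lemma contDiffOn_coord {h : Coord n → Coord m} (hh : ContDiffOn ℝ ∞ h U) (k : Fin m) :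
    ContDiffOn ℝ ∞ (fun y ↦ h y k) U :=
  contDiffOn_euclidean.1 hh k

lemma SmoothOn.jac {h : Coord n → Coord n} (hU : IsOpen U) (hh : ContDiffOn ℝ ∞ h U) :
    SmoothOn U (fun y ↦ KahlerSurface.jac h y) :=
  fun k l ↦ ContDiffOn.pd hU (contDiffOn_coord hh k) l

lemma pdM_congr (hU : IsOpen U) (hx : x ∈ U) (h : ∀ y ∈ U, A y = B y) (i : Fin n) :
    pdM i A x = pdM i B x := by
  ext k l
  exact pd_congr hU hx (fun y hy ↦ by rw [h y hy]) i

lemma pdM_const (i : Fin n) (M : Matrix (Fin n) (Fin n) ℝ) : pdM i (fun _ ↦ M) x = 0 := by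
  ext k l
  exact pd_const i _

lemma pdM_add (hU : IsOpen U) (hx : x ∈ U) (hA : SmoothOn U A) (hB : SmoothOn U B) (i : Fin n) :
    pdM i (fun y ↦ A y + B y) x = pdM i A x + pdM i B x := by
  ext k l
  exact pd_add (hA.diffAt hU hx k l) (hB.diffAt hU hx k l) i

lemma pdM_sub (hU : IsOpen U) (hx : x ∈ U) (hA : SmoothOn U A) (hB : SmoothOn U B) (i : Fin n) :
    pdM i (fun y ↦ A y - B y) x = pdM i A x - pdM i B x := by
  ext k l
  exact pd_sub (hA.diffAt hU hx k l) (hB.diffAt hU hx k l) i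

lemma pdM_mul (hU : IsOpen U) (hx : x ∈ U) (hA : SmoothOn U A) (hB : SmoothOn U B) (i : Fin n) :
    pdM i (fun y ↦ A y * B y) x = pdM i A x * B x + A x * pdM i B x := by
  ext k l
  simp only [pdM, Matrix.of_apply, Matrix.add_apply, Matrix.mul_apply]
  rw [pd_sum (f := fun j y ↦ A y k j * B y j l) _
      fun j _ ↦ (hA.diffAt hU hx k j).mul (hB.diffAt hU hx j l),
    ← Finset.sum_add_distrib]
  exact Finset.sum_congr rfl fun j _ ↦ pd_mul (hA.diffAt hU hx k j) (hB.diffAt hU hx j l) i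

lemma pdM_smul {f : Coord n → ℝ} (hU : IsOpen U) (hx : x ∈ U) (hf : ContDiffOn ℝ ∞ f U)
    (hA : SmoothOn U A) (i : Fin n) :
    pdM i (fun y ↦ f y • A y) x = pd i f x • A x + f x • pdM i A x := by
  ext k l
  exact pd_mul (ContDiffOn.differentiableAt_of_isOpen hf hU hx) (hA.diffAt hU hx k l) i

lemma pdM_transpose (i : Fin n) : pdM i (fun y ↦ (A y).transpose) x = (pdM i A x).transpose :=
  rfl

lemma pdM_comm (hU : IsOpen U) (hx : x ∈ U) (hA : SmoothOn U A) (i j : Fin n) :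
    pdM i (fun y ↦ pdM j A y) x = pdM j (fun y ↦ pdM i A y) x := by
  ext k l
  exact pd_comm hU (hA k l) hx i j

lemma pdM_comp {V : Set (Coord n)} {h : Coord n → Coord n} (hV : IsOpen V) (hhx : h x ∈ V)
    (hA : SmoothOn V A) (hh : DifferentiableAt ℝ h x) (i : Fin n) :
    pdM i (fun y ↦ A (h y)) x = ∑ k, jac h x k i • pdM k A (h x) := by
  ext a b
  rw [Matrix.sum_apply]
  exact pd_comp (hA.diffAt hV hhx a b) hh i

lemma pd_trace (hU : IsOpen U) (hx : x ∈ U) (hA : SmoothOn U A) (i : Fin n) :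
    pd i (fun y ↦ (A y).trace) x = (pdM i A x).trace := by
  simp only [Matrix.trace, Matrix.diag]
  exact pd_sum _ (fun j _ ↦ hA.diffAt hU hx j j) i

/-- The derivative of the inverse matrix, from `A⁻¹ A = 1`. -/
lemma pdM_inv (hU : IsOpen U) (hx : x ∈ U) (hA : SmoothOn U A) (h : ∀ y ∈ U, (A y).det ≠ 0)
    (i : Fin n) : pdM i (fun y ↦ (A y)⁻¹) x = -((A x)⁻¹ * pdM i A x * (A x)⁻¹) := by
  have h1 := pdM_mul hU hx (hA.inv h) hA i
  have h2 : pdM i (fun y ↦ (A y)⁻¹ * A y) x = 0 := by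
    rw [pdM_congr hU hx (B := fun _ ↦ 1)
      (fun y hy ↦ Matrix.nonsing_inv_mul _ (isUnit_iff_ne_zero.2 (h y hy))), pdM_const]
  have hu : IsUnit (A x).det := isUnit_iff_ne_zero.2 (h x hx)
  rw [h2] at h1
  have h3 : (0 : Matrix (Fin n) (Fin n) ℝ) * (A x)⁻¹
      = (pdM i (fun y ↦ (A y)⁻¹) x * A x + (A x)⁻¹ * pdM i A x) * (A x)⁻¹ := by rw [← h1]
  rw [zero_mul, add_mul, Matrix.mul_nonsing_inv_cancel_right _ _ hu] at h3
  exact eq_neg_of_add_eq_zero_left h3.symm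

end Calculus

/-! ### The Levi-Civita connection and its curvature in matrix form -/

section LeviCivita

variable {n : ℕ} {U : Set (Coord n)} {x : Coord n} {G J : MatField n}

/-- On the open set `U`, the matrix field `G` consists of the components of a smooth Riemannian
metric. -/
structure IsMetricOn (U : Set (Coord n)) (G : MatField n) : Prop where
  isOpen : IsOpen U
  smooth : SmoothOn U G
  posDef : ∀ x ∈ U, (G x).PosDef

lemma IsAlmostHermitianOn.isMetricOn (h : IsAlmostHermitianOn U G J) : IsMetricOn U G :=
  ⟨h.isOpen, h.contDiffOn_metric, h.posDef⟩

lemma IsMetricOn.isUnit_det (h : IsMetricOn U G) (hx : x ∈ U) : IsUnit (G x).det :=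
  isUnit_iff_ne_zero.2 (h.posDef x hx).det_pos.ne'

lemma IsMetricOn.transpose (h : IsMetricOn U G) (hx : x ∈ U) : (G x).transpose = G x := by
  have := (h.posDef x hx).isHermitian
  rwa [Matrix.IsHermitian, Matrix.conjTranspose_eq_transpose_of_trivial] at this

lemma IsMetricOn.symm (h : IsMetricOn U G) (hx : x ∈ U) (i j : Fin n) : G x i j = G x j i :=
  congrFun (congrFun (h.transpose hx) j) i

lemma IsMetricOn.inv_mul (h : IsMetricOn U G) (hx : x ∈ U) : (G x)⁻¹ * G x = 1 :=
  Matrix.nonsing_inv_mul _ (h.isUnit_det hx)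

lemma IsMetricOn.mul_inv (h : IsMetricOn U G) (hx : x ∈ U) : G x * (G x)⁻¹ = 1 :=
  Matrix.mul_nonsing_inv _ (h.isUnit_det hx)

lemma IsMetricOn.inv_transpose (h : IsMetricOn U G) (hx : x ∈ U) :
    ((G x)⁻¹).transpose = (G x)⁻¹ := by
  rw [Matrix.transpose_nonsing_inv, h.transpose hx]

lemma IsMetricOn.smooth_inv (h : IsMetricOn U G) : SmoothOn U (fun y ↦ (G y)⁻¹) :=
  h.smooth.inv fun y hy ↦ (h.posDef y hy).det_pos.ne'

/-- The matrix `Γᵢ` of the endomorphism `∂ⱼ ↦ ∇_{∂ᵢ} ∂ⱼ`. -/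
def gam (G : MatField n) (i : Fin n) : MatField n :=
  fun x ↦ Matrix.of fun k j ↦ christoffel G x k i j

/-- The matrix `Fᵢⱼ` of the curvature operator `R(∂ᵢ,∂ⱼ)`. -/
def crv (G : MatField n) (i j : Fin n) : MatField n :=
  fun x ↦ Matrix.of fun l k ↦ curvUp G x i j k l

lemma crv_eq (G : MatField n) (i j : Fin n) (x : Coord n) :
    crv G i j x = pdM i (gam G j) x - pdM j (gam G i) x
      + (gam G i x * gam G j x - gam G j x * gam G i x) := by
  ext l k
  simp only [crv, curvUp, Matrix.of_apply, Matrix.add_apply, Matrix.sub_apply, pdM, gam,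
    Matrix.mul_apply, Finset.sum_sub_distrib]
  simp only [mul_comm]

lemma crv_antisymm (G : MatField n) (i j : Fin n) (x : Coord n) :
    crv G i j x = -crv G j i x := by
  rw [crv_eq, crv_eq]; abel

lemma IsMetricOn.smooth_gam (h : IsMetricOn U G) (i : Fin n) : SmoothOn U (gam G i) := by
  intro k j
  simp only [gam, Matrix.of_apply, christoffel]
  refine contDiffOn_const.mul (ContDiffOn.sum fun l _ ↦ (h.smooth_inv k l).mul ?_)
  exact ((ContDiffOn.pd h.isOpen (h.smooth j l) i).add (ContDiffOn.pd h.isOpen (h.smooth i l) j)).sub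
    (ContDiffOn.pd h.isOpen (h.smooth i j) l)

lemma IsMetricOn.smooth_crv (h : IsMetricOn U G) (i j : Fin n) : SmoothOn U (crv G i j) := by
  refine SmoothOn.congr ?_ fun y _ ↦ crv_eq G i j y
  exact (((h.smooth_gam j).pdM h.isOpen i).sub ((h.smooth_gam i).pdM h.isOpen j)).add
    (((h.smooth_gam i).mul (h.smooth_gam j)).sub ((h.smooth_gam j).mul (h.smooth_gam i)))

lemma IsMetricOn.pd_symm (h : IsMetricOn U G) (hx : x ∈ U) (l i j : Fin n) :
    pd l (fun y ↦ G y i j) x = pd l (fun y ↦ G y j i) x :=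
  pd_congr h.isOpen hx (fun _ hy ↦ h.symm hy i j) l

/-- The Levi-Civita connection is torsion free. -/
lemma IsMetricOn.gam_symm (h : IsMetricOn U G) (hx : x ∈ U) (i j k : Fin n) :
    gam G i x k j = gam G j x k i := by
  simp only [gam, Matrix.of_apply, christoffel]
  congr 1
  refine Finset.sum_congr rfl fun l _ ↦ ?_
  rw [h.pd_symm hx l i j]
  ring

/-- The Christoffel symbols of the first kind. -/
lemma IsMetricOn.mul_gam (h : IsMetricOn U G) (hx : x ∈ U) (i j l : Fin n) :
    (G x * gam G i x) l j = (1 / 2) *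
      (pd i (fun y ↦ G y j l) x + pd j (fun y ↦ G y i l) x - pd l (fun y ↦ G y i j) x) := by
  set c : Fin n → ℝ := fun l ↦
    pd i (fun y ↦ G y j l) x + pd j (fun y ↦ G y i l) x - pd l (fun y ↦ G y i j) x with hc
  have h1 : (fun k ↦ gam G i x k j) = (1 / 2 : ℝ) • (G x)⁻¹.mulVec c := by
    ext k
    simp [gam, christoffel, Matrix.mulVec, dotProduct, hc]
  have h2 : (G x * gam G i x) l j = (G x).mulVec (fun k ↦ gam G i x k j) l := by
    simp [Matrix.mul_apply, Matrix.mulVec, dotProduct]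
  rw [h2, h1, Matrix.mulVec_smul, Matrix.mulVec_mulVec, h.mul_inv hx, Matrix.one_mulVec]
  simp [hc]

/-- The Levi-Civita connection is compatible with the metric. -/
lemma IsMetricOn.pdM_metric (h : IsMetricOn U G) (hx : x ∈ U) (i : Fin n) :
    pdM i G x = (gam G i x).transpose * G x + G x * gam G i x := by
  have h1 : (gam G i x).transpose * G x = (G x * gam G i x).transpose := by
    rw [Matrix.transpose_mul, h.transpose hx]
  ext a b
  rw [h1, Matrix.add_apply, Matrix.transpose_apply, h.mul_gam hx, h.mul_gam hx]
  simp only [pdM, Matrix.of_apply]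
  rw [h.pd_symm hx i b a, h.pd_symm hx b i a, h.pd_symm hx a i b]
  ring

/-- The Levi-Civita connection is the only torsion free connection that is compatible with the
metric (here: at a point). -/
lemma IsMetricOn.eq_gam (h : IsMetricOn U G) (hx : x ∈ U) {B : Fin n → Matrix (Fin n) (Fin n) ℝ}
    (hB : ∀ i, pdM i G x = (B i).transpose * G x + G x * B i)
    (hs : ∀ i j k, B i k j = B j k i) (i : Fin n) : B i = gam G i x := by
  -- `C i` is the lowered connection; it is symmetric in `i, j` and its symmetrisation in the
  -- other pair of indices is `∂ᵢ G`, whence the Koszul formula.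
  set C : Fin n → Matrix (Fin n) (Fin n) ℝ := fun i ↦ G x * B i with hC
  have hCs : ∀ i j k, C i k j = C j k i := by
    intro i j k
    simp only [hC, Matrix.mul_apply, hs i j]
  have hCd : ∀ i j k, pd i (fun y ↦ G y j k) x = C i k j + C i j k := by
    intro i j k
    have := congrFun (congrFun (hB i) j) k
    have h1 : (B i).transpose * G x = (C i).transpose := by
      simp only [hC]; rw [Matrix.transpose_mul, h.transpose hx]
    rw [h1] at this
    simpa [pdM] using this
  have h2 : G x * B i = G x * gam G i x := by
    ext l j
    rw [h.mul_gam hx, hCd, hCd, hCd]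
    have e1 := hCs i j l
    have e2 := hCs i l j
    have e3 := hCs l j i
    simp only [hC] at *
    linarith
  have h3 := congrArg (fun M ↦ (G x)⁻¹ * M) h2
  simpa [← Matrix.mul_assoc, h.inv_mul hx] using h3

/-- The covariant derivative of an endomorphism field in matrix form. -/
lemma nablaJ_eq (G J : MatField n) (x : Coord n) (i : Fin n) :
    Matrix.of (fun k j ↦ nablaJ G J x i k j) = pdM i J x + gam G i x * J x - J x * gam G i x := by
  ext k j
  simp only [nablaJ, Matrix.of_apply, Matrix.sub_apply, Matrix.add_apply, pdM, gam,
    Matrix.mul_apply]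
  congr 1
  exact Finset.sum_congr rfl fun l _ ↦ mul_comm _ _

lemma pdM_of_nablaJ_eq_zero (i : Fin n) (h : ∀ k j, nablaJ G J x i k j = 0) :
    pdM i J x = J x * gam G i x - gam G i x * J x := by
  have h1 := nablaJ_eq G J x i
  have h2 : Matrix.of (fun k j ↦ nablaJ G J x i k j) = 0 := by
    ext k j; simp [h]
  rw [h2] at h1
  rw [eq_sub_iff_add_eq, ← sub_eq_zero]
  exact h1.symm

/-- A parallel endomorphism field commutes with the curvature. -/
lemma IsMetricOn.crv_commute (h : IsMetricOn U G) {S : MatField n} (hS : SmoothOn U S)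
    (hp : ∀ y ∈ U, ∀ i, pdM i S y = S y * gam G i y - gam G i y * S y) (hx : x ∈ U)
    (i j : Fin n) : crv G i j x * S x = S x * crv G i j x := by
  have key : ∀ i j, pdM j (fun y ↦ pdM i S y) x =
      (S x * gam G j x - gam G j x * S x) * gam G i x + S x * pdM j (gam G i) x
      - (pdM j (gam G i) x * S x + gam G i x * (S x * gam G j x - gam G j x * S x)) := by
    intro i j
    rw [pdM_congr h.isOpen hx (fun y hy ↦ hp y hy i),
      pdM_sub h.isOpen hx (hS.mul (h.smooth_gam i)) ((h.smooth_gam i).mul hS),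
      pdM_mul h.isOpen hx hS (h.smooth_gam i), pdM_mul h.isOpen hx (h.smooth_gam i) hS,
      hp x hx j]
  have h1 := pdM_comm h.isOpen hx hS i j
  rw [key i j, key j i] at h1
  rw [← sub_eq_zero] at h1
  rw [crv_eq, ← sub_eq_zero, ← neg_eq_zero, ← h1]
  noncomm_ring

/-- The curvature operators are skew with respect to the metric. -/
lemma IsMetricOn.crv_skew (h : IsMetricOn U G) (hx : x ∈ U) (i j : Fin n) :
    (crv G i j x).transpose * G x + G x * crv G i j x = 0 := by
  have key : ∀ i j, pdM j (fun y ↦ pdM i G y) x =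
      ((pdM j (gam G i) x).transpose * G x
        + (gam G i x).transpose * ((gam G j x).transpose * G x + G x * gam G j x))
      + (((gam G j x).transpose * G x + G x * gam G j x) * gam G i x
        + G x * pdM j (gam G i) x) := by
    intro i j
    rw [pdM_congr h.isOpen hx (fun y hy ↦ h.pdM_metric hy i),
      pdM_add h.isOpen hx ((h.smooth_gam i).transpose.mul h.smooth) (h.smooth.mul (h.smooth_gam i)),
      pdM_mul h.isOpen hx (h.smooth_gam i).transpose h.smooth,
      pdM_mul h.isOpen hx h.smooth (h.smooth_gam i), h.pdM_metric hx j, pdM_transpose]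
  have h1 := pdM_comm h.isOpen hx h.smooth i j
  rw [key i j, key j i] at h1
  rw [← sub_eq_zero] at h1
  rw [crv_eq, ← h1]
  simp only [Matrix.transpose_add, Matrix.transpose_sub, Matrix.transpose_mul]
  noncomm_ring

/-- The first Bianchi identity. -/
lemma IsMetricOn.bianchi_first (h : IsMetricOn U G) (hx : x ∈ U) (i j k l : Fin n) :
    curvUp G x i j k l + curvUp G x j k i l + curvUp G x k i j l = 0 := by
  have hd : ∀ a i j k, pd a (fun y ↦ christoffel G y k i j) x
      = pd a (fun y ↦ christoffel G y k j i) x := fun a i j k ↦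
    pd_congr h.isOpen hx (fun y hy ↦ h.gam_symm hy i j k) a
  have hs : ∀ i j k, christoffel G x k i j = christoffel G x k j i := fun i j k ↦
    h.gam_symm hx i j k
  simp only [curvUp]
  rw [hd i k j, hd j i k, hd k j i]
  have : (∑ m, (christoffel G x m j k * christoffel G x l i m
      - christoffel G x m i k * christoffel G x l j m))
      + (∑ m, (christoffel G x m k i * christoffel G x l j m
      - christoffel G x m j i * christoffel G x l k m))
      + (∑ m, (christoffel G x m i j * christoffel G x l k m
      - christoffel G x m k j * christoffel G x l i m)) = 0 := by
    rw [← Finset.sum_add_distrib, ← Finset.sum_add_distrib]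
    refine Finset.sum_eq_zero fun m _ ↦ ?_
    rw [hs k i m, hs j i m, hs k j m]
    ring
  linarith

lemma curv_eq (h : IsMetricOn U G) (hx : x ∈ U) (i j k l : Fin n) :
    curv G x i j k l = (G x * crv G i j x) l k := by
  simp only [curv, Matrix.mul_apply, crv, Matrix.of_apply]
  exact Finset.sum_congr rfl fun m _ ↦ by rw [h.symm hx l m, mul_comm]

lemma curv_antisymm_left (G : MatField n) (x : Coord n) (i j k l : Fin n) :
    curv G x i j k l = -curv G x j i k l := by
  have h1 : ∀ m, curvUp G x i j k m = -curvUp G x j i k m := fun m ↦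
    congrFun (congrFun (crv_antisymm G i j x) m) k
  simp only [curv, h1, neg_mul, Finset.sum_neg_distrib]

lemma IsMetricOn.curv_antisymm_right (h : IsMetricOn U G) (hx : x ∈ U) (i j k l : Fin n) :
    curv G x i j k l = -curv G x i j l k := by
  rw [curv_eq h hx, curv_eq h hx]
  have h1 := congrFun (congrFun (h.crv_skew hx i j) l) k
  have h2 : (crv G i j x).transpose * G x = (G x * crv G i j x).transpose := by
    rw [Matrix.transpose_mul, h.transpose hx]
  rw [h2] at h1
  simp only [Matrix.add_apply, Matrix.transpose_apply, Matrix.zero_apply] at h1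
  linarith

lemma IsMetricOn.curv_bianchi (h : IsMetricOn U G) (hx : x ∈ U) (i j k l : Fin n) :
    curv G x i j k l + curv G x j k i l + curv G x k i j l = 0 := by
  simp only [curv]
  rw [← Finset.sum_add_distrib, ← Finset.sum_add_distrib]
  refine Finset.sum_eq_zero fun m _ ↦ ?_
  rw [← add_mul, ← add_mul, h.bianchi_first hx, zero_mul]

lemma IsMetricOn.curv_pair (h : IsMetricOn U G) (hx : x ∈ U) (i j k l : Fin n) :
    curv G x i j k l = curv G x k l i j := by
  have b := h.curv_bianchi hx
  have l := curv_antisymm_left G x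
  have r := h.curv_antisymm_right hx
  grind

end LeviCivita

/-! ### Behaviour of the connection and of the curvature under changes of coordinates -/

section Transformation

variable {n : ℕ} {U V : Set (Coord n)} {x : Coord n} {G G' : MatField n} {h : Coord n → Coord n}

/-- The map `h` is an isometric immersion of the coordinate domain `(U, G)` into `(V, G')`. -/
structure IsIsometricOn (U V : Set (Coord n)) (G G' : MatField n) (h : Coord n → Coord n) :
    Prop where
  source : IsMetricOn U G
  target : IsMetricOn V G'
  smooth : ContDiffOn ℝ ∞ h U
  mapsTo : ∀ y ∈ U, h y ∈ V
  metric_eq : ∀ y ∈ U, G y = (jac h y).transpose * G' (h y) * jac h y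

lemma IsIsometricOn.det_ne_zero (H : IsIsometricOn U V G G' h) (hx : x ∈ U) :
    (jac h x).det ≠ 0 := by
  have h1 := (H.source.posDef x hx).det_pos.ne'
  rw [H.metric_eq x hx, Matrix.det_mul] at h1
  exact right_ne_zero_of_mul h1

lemma IsIsometricOn.diffAt (H : IsIsometricOn U V G G' h) (hx : x ∈ U) : DifferentiableAt ℝ h x :=
  ContDiffOn.differentiableAt_of_isOpen H.smooth H.source.isOpen hx

lemma IsIsometricOn.smooth_jac (H : IsIsometricOn U V G G' h) : SmoothOn U (jac h) :=
  SmoothOn.jac H.source.isOpen H.smooth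

lemma IsIsometricOn.pdM_jac_symm (H : IsIsometricOn U V G G' h) (hx : x ∈ U) (i j k : Fin n) :
    pdM i (jac h) x k j = pdM j (jac h) x k i :=
  pd_comm H.source.isOpen (contDiffOn_coord H.smooth k) hx i j

/-- The pullback of the connection matrices of `G'` under `h`, with values in the frame of the
target. -/
def pullGam (G' : MatField n) (h : Coord n → Coord n) (i : Fin n) : MatField n :=
  fun y ↦ ∑ k, jac h y k i • gam G' k (h y)

lemma SmoothOn.sum {ι : Type*} (s : Finset ι) {A : ι → MatField n}
    (hA : ∀ a ∈ s, SmoothOn U (A a)) : SmoothOn U (fun y ↦ ∑ a ∈ s, A a y) := by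
  intro k l
  simp only [Matrix.sum_apply]
  exact ContDiffOn.sum fun a ha ↦ hA a ha k l

lemma pdM_sum {ι : Type*} (s : Finset ι) {A : ι → MatField n} (hU : IsOpen U) (hx : x ∈ U)
    (hA : ∀ a ∈ s, SmoothOn U (A a)) (i : Fin n) :
    pdM i (fun y ↦ ∑ a ∈ s, A a y) x = ∑ a ∈ s, pdM i (A a) x := by
  ext k l
  simp only [pdM, Matrix.sum_apply, Matrix.of_apply]
  exact pd_sum s (fun a ha ↦ (hA a ha).diffAt hU hx k l) i

lemma IsIsometricOn.smooth_pullGam (H : IsIsometricOn U V G G' h) (i : Fin n) :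
    SmoothOn U (pullGam G' h i) :=
  SmoothOn.sum _ fun k _ ↦ SmoothOn.smul (H.smooth_jac k i)
    ((H.target.smooth_gam k).comp H.smooth H.mapsTo)

/-- The transformation law of the Levi-Civita connection. -/
lemma IsIsometricOn.jac_mul_gam (H : IsIsometricOn U V G G' h) (hx : x ∈ U) (i : Fin n) :
    jac h x * gam G i x = pullGam G' h i x * jac h x + pdM i (jac h) x := by
  have hu : IsUnit (jac h x).det := isUnit_iff_ne_zero.2 (H.det_ne_zero hx)
  have hG' := H.target.transpose (H.mapsTo x hx)
  set A := jac h x with hA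
  have hcan : ∀ M, A * (A⁻¹ * M) = M := fun M ↦ by
    rw [← Matrix.mul_assoc, Matrix.mul_nonsing_inv _ hu, Matrix.one_mul]
  have hgen : ∀ i, A⁻¹ * (pullGam G' h i x * A + pdM i (jac h) x) = gam G i x := by
    refine H.source.eq_gam hx
      (B := fun i ↦ A⁻¹ * (pullGam G' h i x * A + pdM i (jac h) x)) (fun i ↦ ?_) fun i j k ↦ ?_
    · have hcomp : pdM i (fun y ↦ G' (h y)) x
          = (pullGam G' h i x).transpose * G' (h x) + G' (h x) * pullGam G' h i x := by
        rw [pdM_comp H.target.isOpen (H.mapsTo x hx) H.target.smooth (H.diffAt hx)]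
        simp only [pullGam, Matrix.transpose_sum, Matrix.transpose_smul, Finset.sum_mul,
          Finset.mul_sum, ← Finset.sum_add_distrib, Matrix.smul_mul, Matrix.mul_smul, ← smul_add,
          H.target.pdM_metric (H.mapsTo x hx)]
      have hl : G x * (A⁻¹ * (pullGam G' h i x * A + pdM i (jac h) x))
          = A.transpose * G' (h x) * (pullGam G' h i x * A + pdM i (jac h) x) := by
        rw [H.metric_eq x hx, Matrix.mul_assoc _ (jac h x), hcan]
      have hr : (A⁻¹ * (pullGam G' h i x * A + pdM i (jac h) x)).transpose * G x
          = (G x * (A⁻¹ * (pullGam G' h i x * A + pdM i (jac h) x))).transpose := by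
        rw [Matrix.transpose_mul (G x), H.source.transpose hx]
      rw [hr, hl, pdM_congr H.source.isOpen hx H.metric_eq,
        pdM_mul H.source.isOpen hx
          (H.smooth_jac.transpose.mul (H.target.smooth.comp H.smooth H.mapsTo)) H.smooth_jac,
        pdM_mul H.source.isOpen hx H.smooth_jac.transpose
          (H.target.smooth.comp H.smooth H.mapsTo), hcomp, pdM_transpose]
      simp only [Matrix.transpose_add, Matrix.transpose_mul, Matrix.transpose_transpose, hG', ← hA]
      noncomm_ring
    · simp only [Matrix.mul_apply (M := A⁻¹)]
      refine Finset.sum_congr rfl fun l _ ↦ ?_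
      congr 1
      rw [Matrix.add_apply, Matrix.add_apply, H.pdM_jac_symm hx i j]
      congr 1
      simp only [pullGam, Matrix.mul_apply, Matrix.sum_apply, Matrix.smul_apply, smul_eq_mul,
        Finset.sum_mul]
      rw [Finset.sum_comm]
      refine Finset.sum_congr rfl fun a _ ↦ Finset.sum_congr rfl fun b _ ↦ ?_
      rw [H.target.gam_symm (H.mapsTo x hx) b a l, ← hA]
      ring
  rw [← hgen i, hcan]

/-- The transformation law of the curvature. -/
lemma IsIsometricOn.jac_mul_crv (H : IsIsometricOn U V G G' h) (hx : x ∈ U) (i j : Fin n) :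
    jac h x * crv G i j x
      = (∑ k, ∑ l, (jac h x k i * jac h x l j) • crv G' k l (h x)) * jac h x := by
  have hU := H.source.isOpen
  have hA := H.smooth_jac
  have hB := H.smooth_pullGam
  have hΓ := H.source.smooth_gam
  have hd : ∀ i, pdM i (jac h) x = jac h x * gam G i x - pullGam G' h i x * jac h x := fun i ↦ by
    rw [H.jac_mul_gam hx i]; abel
  have key : ∀ i j, pdM j (jac h) x * gam G i x + jac h x * pdM j (gam G i) x
      = pdM j (pullGam G' h i) x * jac h x + pullGam G' h i x * pdM j (jac h) x
        + pdM j (fun y ↦ pdM i (jac h) y) x := fun i j ↦ by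
    rw [← pdM_mul hU hx hA (hΓ i), pdM_congr hU hx (fun y hy ↦ H.jac_mul_gam hy i),
      pdM_add hU hx ((hB i).mul hA) (hA.pdM hU i), pdM_mul hU hx (hB i) hA]
  have k1 := key i j
  have k2 := key j i
  rw [pdM_comm hU hx hA i j] at k2
  have e1 : jac h x * crv G i j x = (pdM i (pullGam G' h j) x - pdM j (pullGam G' h i) x
      + (pullGam G' h i x * pullGam G' h j x - pullGam G' h j x * pullGam G' h i x))
      * jac h x := by
    rw [hd] at k1 k2
    rw [crv_eq, ← sub_eq_zero]
    rw [← sub_eq_zero] at k1 k2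
    have k3 := congrArg₂ (fun a b ↦ b - a) k1 k2
    simp only [sub_zero] at k3
    rw [← k3]
    noncomm_ring
  have hpd : ∀ i j, pdM i (pullGam G' h j) x = ∑ k, (pdM i (jac h) x k j • gam G' k (h x)
      + jac h x k j • ∑ l, jac h x l i • pdM l (gam G' k) (h x)) := fun i j ↦ by
    have hs := fun k ↦ (H.target.smooth_gam k).comp H.smooth H.mapsTo
    rw [show pullGam G' h j = fun y ↦ ∑ k, jac h y k j • gam G' k (h y) from rfl,
      pdM_sum _ hU hx fun k _ ↦ SmoothOn.smul (hA k j) (hs k)]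
    refine Finset.sum_congr rfl fun k _ ↦ ?_
    rw [pdM_smul hU hx (hA k j) (hs k),
      pdM_comp H.target.isOpen (H.mapsTo x hx) (H.target.smooth_gam k) (H.diffAt hx)]
    rfl
  rw [e1, hpd, hpd]
  congr 1
  simp only [H.pdM_jac_symm hx i j]
  simp only [pullGam, Finset.sum_add_distrib, Finset.smul_sum, smul_smul, Finset.sum_mul,
    Finset.mul_sum, Matrix.smul_mul, Matrix.mul_smul, crv_eq, smul_add, smul_sub,
    Finset.sum_sub_distrib]
  rw [Finset.sum_comm (f := fun a b ↦ (jac h x a j * jac h x b i) • pdM b (gam G' a) (h x)),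
    Finset.sum_comm (f := fun a b ↦ (jac h x a j * jac h x b i) • (gam G' b (h x) * gam G' a (h x)))]
  simp only [mul_comm (jac h x _ j)]
  abel

lemma ricci_eq (G : MatField n) (x : Coord n) (i j : Fin n) :
    ricci G x i j = ∑ a, crv G a i x a j := rfl

/-- The transformation law of the Ricci tensor. -/
lemma IsIsometricOn.ricci_eq (H : IsIsometricOn U V G G' h) (hx : x ∈ U) :
    ricci G x = (jac h x).transpose * ricci G' (h x) * jac h x := by
  have hu : IsUnit (jac h x).det := isUnit_iff_ne_zero.2 (H.det_ne_zero hx)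
  have h1 : ∀ i j, crv G i j x = ∑ k, ∑ l, (jac h x k i * jac h x l j) •
      ((jac h x)⁻¹ * (crv G' k l (h x) * jac h x)) := fun i j ↦ by
    have h2 := congrArg (fun M ↦ (jac h x)⁻¹ * M) (H.jac_mul_crv hx i j)
    simp only [← Matrix.mul_assoc, Matrix.nonsing_inv_mul _ hu, Matrix.one_mul] at h2
    rw [h2]
    simp only [Finset.sum_mul, Finset.mul_sum, Matrix.mul_smul, Matrix.smul_mul, Matrix.mul_assoc]
  ext i j
  rw [KahlerSurface.ricci_eq]
  simp only [h1, Matrix.sum_apply, Matrix.smul_apply, smul_eq_mul]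
  have h3 : ∀ k l, ∑ a, jac h x k a * jac h x l i
      * ((jac h x)⁻¹ * (crv G' k l (h x) * jac h x)) a j
      = jac h x l i * (crv G' k l (h x) * jac h x) k j := fun k l ↦ by
    have h4 : crv G' k l (h x) * jac h x
        = jac h x * ((jac h x)⁻¹ * (crv G' k l (h x) * jac h x)) := by
      rw [← Matrix.mul_assoc, Matrix.mul_nonsing_inv _ hu, Matrix.one_mul]
    conv_rhs => rw [h4, Matrix.mul_apply, Finset.mul_sum]
    exact Finset.sum_congr rfl fun a _ ↦ by ring
  rw [Finset.sum_comm_cycle]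
  simp only [Matrix.mul_assoc, Matrix.mul_apply (M := (jac h x).transpose),
    Matrix.transpose_apply]
  refine Finset.sum_congr rfl fun l _ ↦ ?_
  rw [Finset.sum_comm]
  simp only [h3]
  rw [← Finset.mul_sum]
  congr 1
  simp only [Matrix.mul_apply, KahlerSurface.ricci_eq, Finset.sum_mul]
  rw [Finset.sum_comm]

end Transformation

/-! ### Metrics and endomorphism fields of a manifold in charts -/

section Charts

variable {M : Type*} [TopologicalSpace M] [ChartedSpace (Coord 4) M] [IsManifold (𝓡 4) ∞ M]
  {g : Metric M} {J : EndField M} {φ ψ : OpenPartialHomeomorph M (Coord 4)}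

lemma mdifferentiable_of_mem (hφ : φ ∈ IsManifold.maximalAtlas (𝓡 4) ∞ M) :
    φ.MDifferentiable (𝓡 4) (𝓡 4) :=
  ⟨(contMDiffOn_of_mem_maximalAtlas hφ).mdifferentiableOn (by simp),
    (contMDiffOn_symm_of_mem_maximalAtlas hφ).mdifferentiableOn (by simp)⟩

/-- The differential of `φ⁻¹` applied to a vector with constant components is smooth. -/
lemma contMDiffOn_mfderiv_symm (hφ : φ ∈ IsManifold.maximalAtlas (𝓡 4) ∞ M) (v : Coord 4) :
    ContMDiffOn (𝓡 4) ((𝓡 4).prod 𝓘(ℝ, Coord 4)) ∞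
      (fun y : Coord 4 ↦ Bundle.TotalSpace.mk' (Coord 4) (E := fun p : M ↦ TangentSpace (𝓡 4) p)
        (φ.symm y) (mfderiv (𝓡 4) (𝓡 4) φ.symm y v)) φ.target := by
  have : IsManifold (𝓡 4) 1 M := IsManifold.of_le (n := ∞) (by simp)
  have h1 := (contMDiffOn_symm_of_mem_maximalAtlas hφ).contMDiffOn_tangentMapWithin
    (m := ∞) (by simp) φ.open_target.uniqueMDiffOn
  have h2 : ContMDiffOn (𝓡 4) ((𝓡 4).prod 𝓘(ℝ, Coord 4)) ∞
      (fun y : Coord 4 ↦ (⟨y, v⟩ : TangentBundle (𝓡 4) (Coord 4))) φ.target := by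
    intro y hy
    exact contMDiffWithinAt_vectorSpace_iff_contDiffWithinAt.2 contDiffWithinAt_const
  refine (h1.comp h2 fun y hy ↦ hy).congr fun y hy ↦ ?_
  simp only [Function.comp_def, tangentMapWithin]
  rw [mfderivWithin_of_isOpen φ.open_target hy]

lemma smoothOn_metric_inChart (hφ : φ ∈ IsManifold.maximalAtlas (𝓡 4) ∞ M) :
    SmoothOn φ.target (g.inChart φ) := by
  intro i j
  have hg : ContMDiffOn (𝓡 4) ((𝓡 4).prod 𝓘(ℝ, Coord 4 →L[ℝ] Coord 4 →L[ℝ] ℝ)) ∞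
      (fun y : Coord 4 ↦ Bundle.TotalSpace.mk' (Coord 4 →L[ℝ] Coord 4 →L[ℝ] ℝ)
        (E := fun p : M ↦ (TangentSpace (𝓡 4) p →L[ℝ] TangentSpace (𝓡 4) p →L[ℝ] ℝ))
        (φ.symm y) (g.inner (φ.symm y))) φ.target :=
    g.contMDiff.comp_contMDiffOn (contMDiffOn_symm_of_mem_maximalAtlas hφ)
  have h := ContMDiffOn.clm_bundle_apply₂ (F₁ := Coord 4) (F₂ := Coord 4)
    (E₃ := fun _ : M ↦ ℝ) hg
    (contMDiffOn_mfderiv_symm hφ (EuclideanSpace.single i 1))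
    (contMDiffOn_mfderiv_symm hφ (EuclideanSpace.single j 1))
  rw [← contMDiffOn_iff_contDiffOn]
  intro y hy
  have h1 := (Bundle.contMDiffWithinAt_totalSpace.1 (h y hy)).2
  simp only [Bundle.Trivial.fiberBundle_trivializationAt'] at h1
  exact h1

/-- The inner product at `p`, on the model space. -/
def Metric.form (g : Metric M) (p : M) (v w : Coord 4) : ℝ :=
  g.inner p (v : TangentSpace (𝓡 4) p) (w : TangentSpace (𝓡 4) p)

/-- The endomorphism at `p`, on the model space. -/
def EndField.map (J : EndField M) (p : M) : Coord 4 →L[ℝ] Coord 4 := J p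

/-- The differential of `φ`, on the model space. -/
def chartD (φ : OpenPartialHomeomorph M (Coord 4)) (p : M) : Coord 4 →L[ℝ] Coord 4 :=
  mfderiv (𝓡 4) (𝓡 4) φ p

/-- The differential of the inverse of `φ`, on the model space. -/
def chartDSymm (φ : OpenPartialHomeomorph M (Coord 4)) (y : Coord 4) : Coord 4 →L[ℝ] Coord 4 :=
  mfderiv (𝓡 4) (𝓡 4) φ.symm y

/-- The matrix of an endomorphism of `ℝ⁴`. -/
def mat (L : Coord 4 →L[ℝ] Coord 4) : Matrix (Fin 4) (Fin 4) ℝ :=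
  Matrix.of fun k j ↦ L (EuclideanSpace.single j 1) k

lemma clm_apply_eq_sum {F : Type*} [NormedAddCommGroup F] [NormedSpace ℝ F]
    (L : Coord 4 →L[ℝ] F) (v : Coord 4) : L v = ∑ j, v j • L (EuclideanSpace.single j 1) := by
  have hv : v = ∑ i, v i • EuclideanSpace.single i (1 : ℝ) := by
    ext j
    simp [Pi.single_apply]
  conv_lhs => rw [hv]
  simp

lemma mat_comp (L L' : Coord 4 →L[ℝ] Coord 4) : mat (L.comp L') = mat L * mat L' := by
  ext k j
  simp only [mat, Matrix.of_apply, Matrix.mul_apply, ContinuousLinearMap.comp_apply]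
  rw [clm_apply_eq_sum L]
  simp [mul_comm]

lemma mat_id : mat (ContinuousLinearMap.id ℝ (Coord 4)) = 1 := by
  ext k j
  simp [mat, Matrix.one_apply]

lemma mat_neg (L : Coord 4 →L[ℝ] Coord 4) : mat (-L) = -mat L := by
  ext k j
  simp [mat]

lemma chartD_comp (hφ : φ ∈ IsManifold.maximalAtlas (𝓡 4) ∞ M) {y : Coord 4} (hy : y ∈ φ.target) :
    (chartD φ (φ.symm y)).comp (chartDSymm φ y) = ContinuousLinearMap.id ℝ (Coord 4) :=
  (mdifferentiable_of_mem hφ).comp_symm_deriv hy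

lemma chartDSymm_comp (hφ : φ ∈ IsManifold.maximalAtlas (𝓡 4) ∞ M) {y : Coord 4}
    (hy : y ∈ φ.target) :
    (chartDSymm φ y).comp (chartD φ (φ.symm y)) = ContinuousLinearMap.id ℝ (Coord 4) := by
  have h := (mdifferentiable_of_mem hφ).symm_comp_deriv (φ.map_target hy)
  rw [φ.right_inv hy] at h
  exact h

lemma metric_inChart_eq (g : Metric M) (φ : OpenPartialHomeomorph M (Coord 4)) (y : Coord 4)
    (i j : Fin 4) : g.inChart φ y i j = g.form (φ.symm y)
      (chartDSymm φ y (EuclideanSpace.single i 1)) (chartDSymm φ y (EuclideanSpace.single j 1)) :=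
  rfl

lemma complex_inChart_eq (J : EndField M) (φ : OpenPartialHomeomorph M (Coord 4)) (y : Coord 4) :
    J.inChart φ y = mat ((chartD φ (φ.symm y)).comp ((J.map (φ.symm y)).comp (chartDSymm φ y))) :=
  rfl

/-- The bilinear form `g` in terms of coordinates. -/
lemma Metric.form_apply (g : Metric M) (p : M) (L : Coord 4 →L[ℝ] Coord 4) (v w : Coord 4) :
    g.form p (L v) (L w) = ∑ i, ∑ j, v i * w j *
      g.form p (L (EuclideanSpace.single i 1)) (L (EuclideanSpace.single j 1)) := by
  set B : Coord 4 →L[ℝ] Coord 4 →L[ℝ] ℝ := g.inner p with hB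
  have hf : ∀ v w, g.form p v w = B v w := fun _ _ ↦ rfl
  simp only [hf]
  rw [clm_apply_eq_sum L v, clm_apply_eq_sum L w]
  simp only [map_sum, map_smul, sum_apply, smul_apply,
    smul_eq_mul, Finset.mul_sum]
  rw [Finset.sum_comm]
  exact Finset.sum_congr rfl fun i _ ↦ Finset.sum_congr rfl fun j _ ↦ by ring

lemma Metric.form_symm (g : Metric M) (p : M) (v w : Coord 4) : g.form p v w = g.form p w v :=
  g.symm p v w

lemma posDef_metric_inChart (g : Metric M) (hφ : φ ∈ IsManifold.maximalAtlas (𝓡 4) ∞ M)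
    {y : Coord 4} (hy : y ∈ φ.target) : (g.inChart φ y).PosDef := by
  refine Matrix.PosDef.of_dotProduct_mulVec_pos ?_ fun v hv ↦ ?_
  · ext i j
    simp [metric_inChart_eq, g.form_symm]
  · set w : Coord 4 := WithLp.toLp 2 v with hw
    have h1 : star v ⬝ᵥ (g.inChart φ y).mulVec v
        = g.form (φ.symm y) (chartDSymm φ y w) (chartDSymm φ y w) := by
      rw [g.form_apply]
      simp only [dotProduct, Matrix.mulVec, Finset.mul_sum, star_trivial, metric_inChart_eq, hw]
      exact Finset.sum_congr rfl fun i _ ↦ Finset.sum_congr rfl fun j _ ↦ by ring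
    rw [h1]
    refine g.pos _ _ fun h0 ↦ hv ?_
    have h2 := congrArg (fun L ↦ L w) (chartD_comp hφ hy)
    simp only [ContinuousLinearMap.comp_apply, ContinuousLinearMap.id_apply] at h2
    have h3 : chartDSymm φ y w = 0 := h0
    rw [h3, map_zero] at h2
    ext i
    have := congrArg (fun u : Coord 4 ↦ u i) h2
    simpa [hw] using this.symm

lemma smoothOn_complex_inChart (hK : IsKahler g J)
    (hφ : φ ∈ IsManifold.maximalAtlas (𝓡 4) ∞ M) : SmoothOn φ.target (J.inChart φ) := by
  have : IsManifold (𝓡 4) 1 M := IsManifold.of_le (n := ∞) (by simp)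
  intro k j
  have hJ : ContMDiffOn (𝓡 4) ((𝓡 4).prod 𝓘(ℝ, Coord 4 →L[ℝ] Coord 4)) ∞
      (fun y : Coord 4 ↦ Bundle.TotalSpace.mk' (Coord 4 →L[ℝ] Coord 4)
        (E := fun p : M ↦ (TangentSpace (𝓡 4) p →L[ℝ] TangentSpace (𝓡 4) p))
        (φ.symm y) (J (φ.symm y))) φ.target :=
    hK.smooth.comp_contMDiffOn (contMDiffOn_symm_of_mem_maximalAtlas hφ)
  have h := ContMDiffOn.clm_bundle_apply (F₁ := Coord 4) (F₂ := Coord 4) hJ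
    (contMDiffOn_mfderiv_symm hφ (EuclideanSpace.single j 1))
  have h1 := ((contMDiffOn_of_mem_maximalAtlas hφ).contMDiffOn_tangentMapWithin
    (m := ∞) (by simp) φ.open_source.uniqueMDiffOn).comp h fun y hy ↦ φ.map_target hy
  have hb : ∀ (a b : Coord 4) (_ : a = b) (w : Coord 4),
      (⟨a, w⟩ : TangentBundle (𝓡 4) (Coord 4)) = ⟨b, w⟩ := by
    rintro a b rfl w; rfl
  have h2 : ContDiffOn ℝ ∞ (fun y : Coord 4 ↦
      chartD φ (φ.symm y) (J.map (φ.symm y) (chartDSymm φ y (EuclideanSpace.single j 1))))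
      φ.target := by
    intro y hy
    refine contMDiffWithinAt_vectorSpace_iff_contDiffWithinAt.1 ?_
    have hc : ∀ z ∈ φ.target, (⟨z, chartD φ (φ.symm z) (J.map (φ.symm z)
        (chartDSymm φ z (EuclideanSpace.single j 1)))⟩ : TangentBundle (𝓡 4) (Coord 4))
        = tangentMapWithin (𝓡 4) (𝓡 4) φ φ.source (Bundle.TotalSpace.mk' (Coord 4)
          (E := fun p : M ↦ TangentSpace (𝓡 4) p) (φ.symm z) (J (φ.symm z)
          (mfderiv (𝓡 4) (𝓡 4) φ.symm z (EuclideanSpace.single j 1 : Coord 4)))) := by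
      intro z hz
      simp only [tangentMapWithin]
      rw [mfderivWithin_of_isOpen φ.open_source (φ.map_target hz)]
      exact hb _ _ (φ.right_inv hz).symm _
    exact (h1 y hy).congr (fun z hz ↦ hc z hz) (hc y hy)
  exact contDiffOn_euclidean.1 h2 k

lemma complex_inChart_sq (hK : IsKahler g J) (hφ : φ ∈ IsManifold.maximalAtlas (𝓡 4) ∞ M)
    {y : Coord 4} (hy : y ∈ φ.target) : J.inChart φ y * J.inChart φ y = -1 := by
  have h1 : (J.map (φ.symm y)).comp (J.map (φ.symm y)) = -ContinuousLinearMap.id ℝ (Coord 4) := by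
    ext1 v
    exact hK.sq_eq (φ.symm y) v
  have h2 := chartDSymm_comp hφ hy
  have h3 := chartD_comp hφ hy
  rw [complex_inChart_eq, ← mat_comp, ← mat_id, ← mat_neg]
  congr 1
  ext1 v
  have e1 : ∀ w, J.map (φ.symm y) (J.map (φ.symm y) w) = -w := fun w ↦
    congrArg (fun L ↦ L w) h1
  have e2 : ∀ w, chartDSymm φ y (chartD φ (φ.symm y) w) = w := fun w ↦ congrArg (fun L ↦ L w) h2
  have e3 : ∀ w, chartD φ (φ.symm y) (chartDSymm φ y w) = w := fun w ↦ congrArg (fun L ↦ L w) h3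
  simp [e1, e2, e3]

/-- The bilinear form of the metric in a chart, evaluated on the columns of matrices. -/
lemma Metric.form_comp (g : Metric M) (p : M) (L K : Coord 4 →L[ℝ] Coord 4) :
    (Matrix.of fun i j ↦ g.form p (L (K (EuclideanSpace.single i 1)))
        (L (K (EuclideanSpace.single j 1))))
      = (mat K).transpose * (Matrix.of fun i j ↦ g.form p (L (EuclideanSpace.single i 1))
        (L (EuclideanSpace.single j 1))) * mat K := by
  ext i j
  rw [Matrix.of_apply, g.form_apply p L]
  simp only [Matrix.mul_apply, Finset.sum_mul, mat, Matrix.of_apply, Matrix.transpose_apply]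
  rw [Finset.sum_comm]
  exact Finset.sum_congr rfl fun a _ ↦ Finset.sum_congr rfl fun b _ ↦ by ring

lemma complex_inChart_orthogonal (hK : IsKahler g J)
    (hφ : φ ∈ IsManifold.maximalAtlas (𝓡 4) ∞ M) {y : Coord 4} (hy : y ∈ φ.target) :
    (J.inChart φ y).transpose * g.inChart φ y * J.inChart φ y = g.inChart φ y := by
  have h2 := chartDSymm_comp hφ hy
  have e2 : ∀ w, chartDSymm φ y (chartD φ (φ.symm y) w) = w := fun w ↦ congrArg (fun L ↦ L w) h2
  have h3 : g.inChart φ y = Matrix.of fun i j ↦ g.form (φ.symm y)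
    (chartDSymm φ y (EuclideanSpace.single i 1)) (chartDSymm φ y (EuclideanSpace.single j 1)) := rfl
  rw [complex_inChart_eq, h3, ← g.form_comp]
  ext i j
  simp only [Matrix.of_apply, ContinuousLinearMap.comp_apply, e2]
  exact hK.orthogonal _ _ _

lemma isAlmostHermitianOn_inChart (hK : IsKahler g J)
    (hφ : φ ∈ IsManifold.maximalAtlas (𝓡 4) ∞ M) :
    IsAlmostHermitianOn φ.target (g.inChart φ) (J.inChart φ) where
  isOpen := φ.open_target
  contDiffOn_metric := smoothOn_metric_inChart hφ
  contDiffOn_complex := smoothOn_complex_inChart hK hφ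
  posDef _ hy := posDef_metric_inChart g hφ hy
  sq_eq _ hy := complex_inChart_sq hK hφ hy
  orthogonal _ hy := complex_inChart_orthogonal hK hφ hy

/-- The domain on which the change of coordinates from `φ` to `ψ` is defined. -/
def overlap (φ ψ : OpenPartialHomeomorph M (Coord 4)) : Set (Coord 4) :=
  φ.target ∩ φ.symm ⁻¹' ψ.source

/-- The change of coordinates from `φ` to `ψ`. -/
def transition (φ ψ : OpenPartialHomeomorph M (Coord 4)) (y : Coord 4) : Coord 4 :=
  ψ (φ.symm y)

lemma isOpen_overlap (φ ψ : OpenPartialHomeomorph M (Coord 4)) : IsOpen (overlap φ ψ) :=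
  φ.symm.isOpen_inter_preimage ψ.open_source

lemma contDiffOn_transition (hφ : φ ∈ IsManifold.maximalAtlas (𝓡 4) ∞ M)
    (hψ : ψ ∈ IsManifold.maximalAtlas (𝓡 4) ∞ M) :
    ContDiffOn ℝ ∞ (transition φ ψ) (overlap φ ψ) := by
  rw [← contMDiffOn_iff_contDiffOn]
  exact (contMDiffOn_of_mem_maximalAtlas hψ).comp
    ((contMDiffOn_symm_of_mem_maximalAtlas hφ).mono Set.inter_subset_left) fun y hy ↦ hy.2

lemma mat_fderiv {h : Coord 4 → Coord 4} {x : Coord 4} (hh : DifferentiableAt ℝ h x) :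
    mat (fderiv ℝ h x) = jac h x := by
  ext k i
  have h2 : (fun y ↦ h y k) = fun y ↦ EuclideanSpace.proj (𝕜 := ℝ) k (h y) := rfl
  have h3 := (EuclideanSpace.proj (𝕜 := ℝ) k : Coord 4 →L[ℝ] ℝ).hasFDerivAt.comp x hh.hasFDerivAt
  have h4 := h3.fderiv
  simp only [Function.comp_def] at h4
  rw [jac, Matrix.of_apply, pd, h2, h4]
  rfl

lemma chartDSymm_eq (hφ : φ ∈ IsManifold.maximalAtlas (𝓡 4) ∞ M)
    (hψ : ψ ∈ IsManifold.maximalAtlas (𝓡 4) ∞ M) {y : Coord 4} (hy : y ∈ overlap φ ψ) :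
    chartDSymm φ y
      = (chartDSymm ψ (transition φ ψ y)).comp (fderiv ℝ (transition φ ψ) y) := by
  have hd : MDifferentiableAt (𝓡 4) (𝓡 4) (transition φ ψ) y :=
    (ContDiffOn.differentiableAt_of_isOpen (contDiffOn_transition hφ hψ)
      (isOpen_overlap φ ψ) hy).mdifferentiableAt
  have hs : MDifferentiableAt (𝓡 4) (𝓡 4) ψ.symm (transition φ ψ y) :=
    (mdifferentiable_of_mem hψ).mdifferentiableAt_symm (ψ.map_source hy.2)
  have h1 := mfderiv_comp y hs hd
  have h2 : φ.symm =ᶠ[nhds y] ψ.symm ∘ transition φ ψ := by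
    filter_upwards [(isOpen_overlap φ ψ).mem_nhds hy] with z hz
    simp [transition, ψ.left_inv hz.2]
  rw [← h2.mfderiv_eq] at h1
  rw [mfderiv_eq_fderiv] at h1
  exact h1

/-- The components of a metric in two charts are related by the Jacobian matrix of the change of
coordinates. -/
lemma isIsometricOn_transition (g : Metric M) (hφ : φ ∈ IsManifold.maximalAtlas (𝓡 4) ∞ M)
    (hψ : ψ ∈ IsManifold.maximalAtlas (𝓡 4) ∞ M) :
    IsIsometricOn (overlap φ ψ) ψ.target (g.inChart φ) (g.inChart ψ) (transition φ ψ) where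
  source := ⟨isOpen_overlap φ ψ, (smoothOn_metric_inChart hφ).mono Set.inter_subset_left,
    fun y hy ↦ posDef_metric_inChart g hφ hy.1⟩
  target := ⟨ψ.open_target, smoothOn_metric_inChart hψ, fun y hy ↦ posDef_metric_inChart g hψ hy⟩
  smooth := contDiffOn_transition hφ hψ
  mapsTo y hy := ψ.map_source hy.2
  metric_eq y hy := by
    have hp : ψ.symm (transition φ ψ y) = φ.symm y := ψ.left_inv hy.2
    have h3 : g.inChart ψ (transition φ ψ y) = Matrix.of fun i j ↦
      g.form (ψ.symm (transition φ ψ y))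
      (chartDSymm ψ (transition φ ψ y) (EuclideanSpace.single i 1))
      (chartDSymm ψ (transition φ ψ y) (EuclideanSpace.single j 1)) := rfl
    rw [h3, hp, ← mat_fderiv (ContDiffOn.differentiableAt_of_isOpen
      (contDiffOn_transition hφ hψ) (isOpen_overlap φ ψ) hy), ← g.form_comp]
    ext i j
    rw [metric_inChart_eq, chartDSymm_eq hφ hψ hy]
    rfl

/-- The components of an endomorphism field in two charts are conjugate under the Jacobian matrix of
the change of coordinates. -/
lemma jac_mul_complex_inChart (J : EndField M) (hφ : φ ∈ IsManifold.maximalAtlas (𝓡 4) ∞ M)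
    (hψ : ψ ∈ IsManifold.maximalAtlas (𝓡 4) ∞ M) {y : Coord 4} (hy : y ∈ overlap φ ψ) :
    jac (transition φ ψ) y * J.inChart φ y
      = J.inChart ψ (transition φ ψ y) * jac (transition φ ψ) y := by
  have hp : ψ.symm (transition φ ψ y) = φ.symm y := ψ.left_inv hy.2
  have hD := chartDSymm_eq hφ hψ hy
  have e1 := chartDSymm_comp hφ hy.1
  have e2 := chartD_comp (y := transition φ ψ y) hψ (ψ.map_source hy.2)
  rw [hp] at e2
  rw [← mat_fderiv (ContDiffOn.differentiableAt_of_isOpen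
      (contDiffOn_transition hφ hψ) (isOpen_overlap φ ψ) hy), complex_inChart_eq,
    complex_inChart_eq, hp, ← mat_comp, ← mat_comp]
  congr 1
  have e3 : fderiv ℝ (transition φ ψ) y = (chartD ψ (φ.symm y)).comp (chartDSymm φ y) := by
    rw [hD, ← ContinuousLinearMap.comp_assoc, e2, ContinuousLinearMap.id_comp]
  have e1' : ∀ w, chartDSymm φ y (chartD φ (φ.symm y) w) = w := fun w ↦ congrArg (fun L ↦ L w) e1
  ext1 v
  simp only [ContinuousLinearMap.comp_apply]
  have hD' := congrArg (fun L ↦ L v) hD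
  simp only [ContinuousLinearMap.comp_apply] at hD'
  rw [← hD', e3]
  simp only [ContinuousLinearMap.comp_apply, e1']

/-- New charts arise from old ones by composition with local diffeomorphisms of `ℝ⁴`. -/
lemma exists_chart_comp (hφ : φ ∈ IsManifold.maximalAtlas (𝓡 4) ∞ M) {U : Set (Coord 4)}
    (hU : IsOpen U) (hUφ : U ⊆ φ.target) {h : Coord 4 → Coord 4} (hh : ContDiffOn ℝ ∞ h U)
    (hd : ∀ y ∈ U, (jac h y).det ≠ 0) {y₀ : Coord 4} (hy₀ : y₀ ∈ U) :
    ∃ ψ ∈ IsManifold.maximalAtlas (𝓡 4) ∞ M, φ.symm y₀ ∈ ψ.source ∧ ψ.source ⊆ φ.source ∧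
      ∀ p ∈ ψ.source, φ p ∈ U ∧ ψ p = h (φ p) := by
  have hequiv : ∀ y ∈ U, ∃ L : Coord 4 ≃L[ℝ] Coord 4, HasFDerivAt h (L : Coord 4 →L[ℝ] Coord 4) y := by
    intro y hy
    have hdy : DifferentiableAt ℝ h y := ContDiffOn.differentiableAt_of_isOpen hh hU hy
    have hinj : Function.Injective (fderiv ℝ h y) := by
      rw [injective_iff_map_eq_zero]
      intro v hv
      have h1 : (jac h y).mulVec (fun i ↦ v i) = 0 := by
        ext k
        have h2 := congrArg (fun u : Coord 4 ↦ u k) hv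
        rw [clm_apply_eq_sum] at h2
        simp only [← mat_fderiv hdy, mat, Matrix.mulVec, dotProduct, Matrix.of_apply]
        simpa [mul_comm] using h2
      have h2 := Matrix.eq_zero_of_mulVec_eq_zero (hd y hy) h1
      ext i
      exact congrFun h2 i
    let e := LinearEquiv.ofInjectiveEndo (fderiv ℝ h y : Coord 4 →ₗ[ℝ] Coord 4) hinj
    refine ⟨e.toContinuousLinearEquiv, ?_⟩
    convert hdy.hasFDerivAt using 1
    exact ContinuousLinearMap.ext fun v ↦ rfl
  obtain ⟨L, hL⟩ := hequiv y₀ hy₀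
  have hc : ∀ y ∈ U, ContDiffAt ℝ ∞ h y := fun y hy ↦ hh.contDiffAt (hU.mem_nhds hy)
  set e := ((hc y₀ hy₀).toOpenPartialHomeomorph h hL (by simp)).restr U with he
  have hes : e.source ⊆ U := by
    rw [he, OpenPartialHomeomorph.restr_source, hU.interior_eq]
    exact Set.inter_subset_right
  have heh : ∀ y, e y = h y := fun y ↦ rfl
  have hy₀e : y₀ ∈ e.source := by
    rw [he, OpenPartialHomeomorph.restr_source, hU.interior_eq]
    exact ⟨(hc y₀ hy₀).mem_toOpenPartialHomeomorph_source hL (by simp), hy₀⟩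
  refine ⟨φ.trans e, ?_, ?_, ?_, ?_⟩
  · rw [IsManifold.mem_maximalAtlas_iff_contMDiffOn]
    constructor
    · have h1 : ContMDiffOn (𝓡 4) (𝓡 4) ∞ h U := contMDiffOn_iff_contDiffOn.2 hh
      refine h1.comp ((contMDiffOn_of_mem_maximalAtlas hφ).mono ?_) ?_
      · exact fun p hp ↦ hp.1
      · exact fun p hp ↦ hes hp.2
    · have h1 : ContMDiffOn (𝓡 4) (𝓡 4) ∞ e.symm e.target := by
        refine contMDiffOn_iff_contDiffOn.2 fun z hz ↦ ?_
        obtain ⟨L', hL'⟩ := hequiv _ (hes (e.map_target hz))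
        exact (e.contDiffAt_symm hz hL' (hc _ (hes (e.map_target hz)))).contDiffWithinAt
      refine (contMDiffOn_symm_of_mem_maximalAtlas hφ).comp (h1.mono ?_) ?_
      · intro z hz
        rw [OpenPartialHomeomorph.trans_target] at hz
        exact hz.1
      · intro z hz
        rw [OpenPartialHomeomorph.trans_target] at hz
        exact hz.2
  · rw [OpenPartialHomeomorph.trans_source]
    refine ⟨φ.map_target (hUφ hy₀), ?_⟩
    rw [Set.mem_preimage, φ.right_inv (hUφ hy₀)]
    exact hy₀e
  · exact fun p hp ↦ hp.1
  · exact fun p hp ↦ ⟨hes hp.2, rfl⟩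

/-- Charts can be restricted to prescribed open subsets of the coordinate domain. -/
lemma exists_chart_restr (hφ : φ ∈ IsManifold.maximalAtlas (𝓡 4) ∞ M) {W : Set (Coord 4)}
    (hW : IsOpen W) (hWφ : W ⊆ φ.target) :
    ∃ ψ ∈ IsManifold.maximalAtlas (𝓡 4) ∞ M, ψ.target = W ∧ ψ.source ⊆ φ.source ∧
      (∀ p ∈ φ.source, φ p ∈ W → p ∈ ψ.source) ∧
      ∀ y ∈ W, (g.inChart ψ y = g.inChart φ y ∧ J.inChart ψ y = J.inChart φ y) := by
  have hs : IsOpen (φ.source ∩ φ ⁻¹' W) := φ.isOpen_inter_preimage hW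
  refine ⟨φ.restr (φ.source ∩ φ ⁻¹' W), restr_mem_maximalAtlas _ hφ hs, ?_, ?_, ?_, ?_⟩
  · rw [OpenPartialHomeomorph.restr_target, hs.interior_eq]
    ext y
    constructor
    · rintro ⟨h1, h2, h3⟩
      rwa [Set.mem_preimage, φ.right_inv h1] at h3
    · intro hy
      exact ⟨hWφ hy, φ.map_target (hWφ hy), by rwa [Set.mem_preimage, φ.right_inv (hWφ hy)]⟩
  · exact fun p hp ↦ hp.1
  · intro p hp hpW
    rw [OpenPartialHomeomorph.restr_source, hs.interior_eq]
    exact ⟨hp, hp, hpW⟩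
  · exact fun y hy ↦ ⟨rfl, rfl⟩

end Charts

/-! ### Flat linear systems of partial differential equations -/

section FlatSystem

open Set

set_option synthInstance.maxHeartbeats 400000
set_option maxHeartbeats 1000000

variable {X E F : Type*} [NormedAddCommGroup X] [NormedSpace ℝ X]
  [NormedAddCommGroup E] [NormedSpace ℝ E] [NormedAddCommGroup F] [NormedSpace ℝ F]

/-- Evaluation of a continuous family of linear maps, as a linear map into the continuous
functions. -/
def flipFamily (G : C(unitInterval, X →L[ℝ] F)) : X →L[ℝ] C(unitInterval, F) :=
  LinearMap.mkContinuous
    { toFun := fun h ↦ ⟨fun t ↦ G t h, by fun_prop⟩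
      map_add' := fun h k ↦ by ext t; simp
      map_smul' := fun c h ↦ by ext t; simp } ‖G‖ fun h ↦ by
    refine (ContinuousMap.norm_le _ (by positivity)).2 fun t ↦ ?_
    exact ((G t).le_opNorm h).trans (mul_le_mul_of_nonneg_right (G.norm_coe_le_norm t) (norm_nonneg h))

lemma flipFamily_apply (G : C(unitInterval, X →L[ℝ] F)) (h : X) (t : unitInterval) :
    flipFamily G h t = G t h := rfl

/-- A family of functions that is continuously differentiable in a parameter, jointly continuously
in the parameter and in the variable of the compact interval, is differentiable as a map into the
space of continuous functions. -/
lemma hasFDerivAt_continuousMap {f : X → C(unitInterval, F)} {f' : C(X × unitInterval, X →L[ℝ] F)}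
    (hf : ∀ x t, HasFDerivAt (fun y ↦ f y t) (f' (x, t)) x) (x : X) :
    HasFDerivAt f (flipFamily (f'.curry x)) x := by
  rw [hasFDerivAt_iff_isLittleO, Asymptotics.isLittleO_iff]
  intro ε hε
  have h1 : ∀ᶠ y in nhds x, dist (f'.curry y) (f'.curry x) < ε :=
    Metric.tendsto_nhds.1 (f'.curry.continuous.tendsto x) ε hε
  obtain ⟨δ, hδ, hball⟩ := Metric.eventually_nhds_iff_ball.1 h1
  filter_upwards [Metric.ball_mem_nhds x hδ] with y hy
  refine (ContinuousMap.norm_le _ (by positivity)).2 fun t ↦ ?_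
  have h2 := (convex_ball x δ).norm_image_sub_le_of_norm_hasFDerivWithin_le'
    (f := fun y ↦ f y t) (f' := fun y ↦ f' (y, t)) (φ := f' (x, t)) (C := ε)
    (fun z _ ↦ (hf z t).hasFDerivWithinAt)
    (fun z hz ↦ by
      have h3 := (ContinuousMap.dist_apply_le_dist (f := f'.curry z) (g := f'.curry x) t).trans
        (hball z hz).le
      rwa [dist_eq_norm] at h3)
    (Metric.mem_ball_self hδ) hy
  simpa [flipFamily_apply] using h2

/-- The extension of a continuous function on the unit interval to the real line that is constant
outside the interval. -/
def extI (c : C(unitInterval, F)) : ℝ → F := IccExtend zero_le_one c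

lemma continuous_extI (c : C(unitInterval, F)) : Continuous (extI c) := c.continuous.Icc_extend'

lemma extI_coe (c : C(unitInterval, F)) (t : unitInterval) : extI c t = c t := IccExtend_val _ _ t

lemma norm_extI_le (c : C(unitInterval, F)) (t : ℝ) : ‖extI c t‖ ≤ ‖c‖ := c.norm_coe_le_norm _

/-- The function `t ↦ ∫₀ᵗ a(s) σ(s) ds`. -/
def volterraFun (a : C(unitInterval, E →L[ℝ] E)) (σ : C(unitInterval, E)) : C(unitInterval, E) :=
  ⟨fun t ↦ ∫ s in (0 : ℝ)..t, extI a s (extI σ s),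
    (intervalIntegral.continuous_primitive (fun _ _ ↦ (Continuous.intervalIntegrable
      ((continuous_extI a).clm_apply (continuous_extI σ)) _ _)) 0).comp continuous_subtype_val⟩

lemma volterraFun_apply (a : C(unitInterval, E →L[ℝ] E)) (σ : C(unitInterval, E))
    (t : unitInterval) : volterraFun a σ t = ∫ s in (0 : ℝ)..t, extI a s (extI σ s) := rfl

lemma intervalIntegrable_extI (a : C(unitInterval, E →L[ℝ] E)) (σ : C(unitInterval, E)) (c d : ℝ) :
    IntervalIntegrable (fun s ↦ extI a s (extI σ s)) MeasureTheory.volume c d :=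
  ((continuous_extI a).clm_apply (continuous_extI σ)).intervalIntegrable _ _

lemma norm_volterraFun_le (a : C(unitInterval, E →L[ℝ] E)) (σ : C(unitInterval, E)) :
    ‖volterraFun a σ‖ ≤ ‖a‖ * ‖σ‖ := by
  have h0 : 0 ≤ ‖a‖ * ‖σ‖ := mul_nonneg (norm_nonneg a) (norm_nonneg σ)
  refine (ContinuousMap.norm_le _ h0).2 fun t ↦ ?_
  have h1 := intervalIntegral.norm_integral_le_of_norm_le_const (a := (0 : ℝ)) (b := t)
    (f := fun s ↦ extI a s (extI σ s)) (C := ‖a‖ * ‖σ‖) fun s _ ↦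
      ((extI a s).le_opNorm _).trans
        (mul_le_mul (norm_extI_le a s) (norm_extI_le σ s) (norm_nonneg _) (norm_nonneg a))
  refine h1.trans (mul_le_of_le_one_right h0 ?_)
  rw [sub_zero, abs_of_nonneg t.2.1]
  exact t.2.2

/-- The Volterra operator `σ ↦ (t ↦ ∫₀ᵗ a(s) σ(s) ds)`, as a bilinear map of `a` and `σ`. -/
def volterra :
    C(unitInterval, E →L[ℝ] E) →L[ℝ] C(unitInterval, E) →L[ℝ] C(unitInterval, E) :=
  LinearMap.mkContinuous₂
    (LinearMap.mk₂ ℝ (volterraFun (E := E))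
      (fun a b σ ↦ by
        ext t
        rw [ContinuousMap.add_apply, volterraFun_apply, volterraFun_apply, volterraFun_apply,
          ← intervalIntegral.integral_add (intervalIntegrable_extI _ _ _ _)
            (intervalIntegrable_extI _ _ _ _)]
        rfl)
      (fun c a σ ↦ by
        ext t
        rw [ContinuousMap.smul_apply, volterraFun_apply, volterraFun_apply,
          ← intervalIntegral.integral_smul]
        rfl)
      (fun a σ η ↦ by
        ext t
        rw [ContinuousMap.add_apply, volterraFun_apply, volterraFun_apply, volterraFun_apply,
          ← intervalIntegral.integral_add (intervalIntegrable_extI _ _ _ _)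
            (intervalIntegrable_extI _ _ _ _)]
        congr 1
        ext s
        exact map_add _ _ _)
      (fun c a σ ↦ by
        ext t
        rw [ContinuousMap.smul_apply, volterraFun_apply, volterraFun_apply,
          ← intervalIntegral.integral_smul]
        congr 1
        ext s
        exact map_smul _ _ _)) 1 fun a σ ↦ by
    rw [one_mul]
    exact norm_volterraFun_le a σ

lemma volterra_apply (a : C(unitInterval, E →L[ℝ] E)) (σ : C(unitInterval, E))
    (t : unitInterval) : volterra a σ t = ∫ s in (0 : ℝ)..t, extI a s (extI σ s) := rfl

/-- The solution `σ` of the fixed point equation `σ = y + V(a(x)) σ`, where `V` is bilinear and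
`a(0) = 0`, is a differentiable function of the parameter `x` near `0`. -/
lemma exists_differentiable_fixedPoint {W Y : Type*} [NormedAddCommGroup W] [NormedSpace ℝ W]
    [NormedAddCommGroup Y] [NormedSpace ℝ Y] [CompleteSpace Y] (V : W →L[ℝ] Y →L[ℝ] Y)
    {a : X → W} {a' : X → X →L[ℝ] W} (ha : ∀ x, HasFDerivAt a (a' x) x) (ha0 : a 0 = 0) (y : Y) :
    ∃ σ : X → Y, σ 0 = y ∧ ∀ᶠ x in nhds 0, DifferentiableAt ℝ σ x ∧ σ x = y + V (a x) (σ x) ∧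
      (∀ h, fderiv ℝ σ x h = V (a' x h) (σ x) + V (a x) (fderiv ℝ σ x h)) ∧
      ∀ z, z = V (a x) z → z = 0 := by
  -- `1 - V (a x)` is invertible for `x` near `0`, and inversion is differentiable
  let S : X → (Y →L[ℝ] Y) := fun x ↦ 1 - V (a x)
  have hS : ∀ x, HasFDerivAt S (-(V.comp (a' x))) x := fun x ↦
    (V.hasFDerivAt.comp x (ha x)).const_sub 1
  have hS0 : S 0 = 1 := by simp [S, ha0]
  have hunit : ∀ᶠ x in nhds 0, IsUnit (S x) := by
    have h1 : {T : Y →L[ℝ] Y | IsUnit T} ∈ nhds (S 0) := by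
      rw [hS0]
      exact Units.isOpen.mem_nhds isUnit_one
    exact (hS 0).continuousAt.eventually h1
  let σ : X → Y := fun x ↦ Ring.inverse (S x) y
  have hσ : ∀ x, IsUnit (S x) → σ x = y + V (a x) (σ x) := by
    intro x hx
    have h3 : S x (σ x) = y :=
      congrArg (fun T : Y →L[ℝ] Y ↦ T y) (Ring.mul_inverse_cancel _ hx)
    rw [← sub_eq_iff_eq_add, ← h3]
    simp [S]
  refine ⟨σ, by simp [σ, hS0], ?_⟩
  filter_upwards [hunit.eventually_nhds] with x hxu
  have hx : IsUnit (S x) := hxu.self_of_nhds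
  have hσd : DifferentiableAt ℝ σ x :=
    ((differentiableAt_inverse hx).comp x (hS x).differentiableAt).clm_apply
      (differentiableAt_const _)
  refine ⟨hσd, hσ x hx, fun h ↦ ?_, fun z hz ↦ ?_⟩
  · have h1 := ((V.hasFDerivAt.comp x (ha x)).clm_apply hσd.hasFDerivAt).const_add y
    have h2 : σ =ᶠ[nhds x] fun z ↦ y + V (a z) (σ z) := by
      filter_upwards [hxu] with z hz using hσ z hz
    have h3 := (h1.congr_of_eventuallyEq h2).fderiv
    conv_lhs => rw [h3]
    simp [add_comm]
  · have h1 : S x z = 0 := by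
      simp only [S, sub_apply, one_apply_eq_self]
      exact sub_eq_zero.2 hz
    have h5 : Ring.inverse (S x) (S x z) = z :=
      congrArg (fun T : Y →L[ℝ] Y ↦ T z) (Ring.inverse_mul_cancel _ hx)
    rw [← h5, h1, map_zero]

end FlatSystem

section FlatSystem

open Set

set_option synthInstance.maxHeartbeats 400000
set_option maxHeartbeats 1000000

variable {X E F : Type*} [NormedAddCommGroup X] [NormedSpace ℝ X]
  [NormedAddCommGroup E] [NormedSpace ℝ E] [NormedAddCommGroup F] [NormedSpace ℝ F]

/-- The coefficient `t ↦ A(tx)x` of the system `ds = A s` along the ray through `x`. -/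
def rayCoeff (A : X → X →L[ℝ] F) (hA : Continuous A) (x : X) : C(unitInterval, F) :=
  ⟨fun t ↦ A ((t : ℝ) • x) x, by fun_prop⟩

/-- The derivative of `rayCoeff` in the parameter `x`. -/
def rayCoeffDeriv (A : X → X →L[ℝ] F) (hA : ContDiff ℝ 1 A) : C(X × unitInterval, X →L[ℝ] F) :=
  ⟨fun p ↦ A ((p.2 : ℝ) • p.1) + (p.2 : ℝ) • (fderiv ℝ A ((p.2 : ℝ) • p.1)).flip p.1, by
    have h1 := hA.continuous
    have h2 := hA.continuous_fderiv (by simp)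
    have h3 : Continuous fun p : X × unitInterval ↦ (fderiv ℝ A ((p.2 : ℝ) • p.1)).flip :=
      (ContinuousLinearMap.flipₗᵢ ℝ X X F).continuous.comp (by fun_prop)
    exact (by fun_prop : Continuous fun p : X × unitInterval ↦ A ((p.2 : ℝ) • p.1)).add
      ((by fun_prop : Continuous fun p : X × unitInterval ↦ (p.2 : ℝ)).smul
        (h3.clm_apply continuous_fst))⟩

lemma hasFDerivAt_rayCoeff {A : X → X →L[ℝ] F} (hA : ContDiff ℝ 1 A) (x : X) :
    HasFDerivAt (rayCoeff A hA.continuous) (flipFamily ((rayCoeffDeriv A hA).curry x)) x := by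
  refine hasFDerivAt_continuousMap (fun x t ↦ ?_) x
  have hd : HasFDerivAt A (fderiv ℝ A ((t : ℝ) • x)) ((fun y : X ↦ (t : ℝ) • y) x) :=
    (hA.differentiable (by simp) _).hasFDerivAt
  have h1 := hd.comp x ((hasFDerivAt_id x).const_smul (t : ℝ))
  have h2 := h1.clm_apply (hasFDerivAt_id x)
  refine h2.congr_fderiv ?_
  ext h
  simp [rayCoeffDeriv]

variable [CompleteSpace E]

/-- Flatness of `A` means that `t ↦ t A(tx)(h) σ(t)` solves the linearisation of the integral
equation `σ = e + ∫ A(tx)(x) σ` of the system along a ray. -/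
lemma eq_volterra_of_flat {A : X → X →L[ℝ] E →L[ℝ] E} (hA : ContDiff ℝ 1 A) (x h : X)
    (hflat : ∀ t ∈ Icc (0 : ℝ) 1, fderiv ℝ A (t • x) h x + A (t • x) x ∘L A (t • x) h
      = fderiv ℝ A (t • x) x h + A (t • x) h ∘L A (t • x) x) (e : E)
    (σ u : C(unitInterval, E))
    (hσ : σ = ContinuousMap.const unitInterval e + volterra (rayCoeff A hA.continuous x) σ)
    (hu : ∀ t, u t = (t : ℝ) • A ((t : ℝ) • x) h (σ t)) :
    u = volterra (flipFamily ((rayCoeffDeriv A hA).curry x) h) σ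
      + volterra (rayCoeff A hA.continuous x) u := by
  have hux : ∀ s ∈ Icc (0 : ℝ) 1, extI u s = s • A (s • x) h (extI σ s) := by
    intro s hs
    have h1 := extI_coe σ ⟨s, hs⟩
    have h2 := extI_coe u ⟨s, hs⟩
    simp only at h1 h2
    rw [h2, hu, h1]
  have hσx : ∀ s ∈ Icc (0 : ℝ) 1, extI σ s
      = e + ∫ r in (0 : ℝ)..s, extI (rayCoeff A hA.continuous x) r (extI σ r) := by
    intro s hs
    have h1 := extI_coe σ ⟨s, hs⟩
    have h2 := congrArg (fun f : C(unitInterval, E) ↦ f ⟨s, hs⟩) hσ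
    simp only at h1
    rw [h1]
    exact h2
  have hax : ∀ s ∈ Icc (0 : ℝ) 1, extI (rayCoeff A hA.continuous x) s = A (s • x) x := fun s hs ↦
    extI_coe (rayCoeff A hA.continuous x) ⟨s, hs⟩
  have ha'x : ∀ s ∈ Icc (0 : ℝ) 1, extI (flipFamily ((rayCoeffDeriv A hA).curry x) h) s
      = A (s • x) h + s • fderiv ℝ A (s • x) h x := fun s hs ↦
    extI_coe (flipFamily ((rayCoeffDeriv A hA).curry x) h) ⟨s, hs⟩
  ext t
  rw [ContinuousMap.add_apply, volterra_apply, volterra_apply,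
    ← intervalIntegral.integral_add (intervalIntegrable_extI _ _ _ _)
      (intervalIntegrable_extI _ _ _ _)]
  have hσd : ∀ s ∈ Ioo (0 : ℝ) 1, HasDerivAt (extI σ) (A (s • x) x (extI σ s)) s := by
    intro s hs
    have hcont : Continuous fun s ↦ extI (rayCoeff A hA.continuous x) s (extI σ s) :=
      (continuous_extI (rayCoeff A hA.continuous x)).clm_apply (continuous_extI σ)
    have h1 : HasDerivAt (fun s ↦ e + ∫ r in (0 : ℝ)..s,
        extI (rayCoeff A hA.continuous x) r (extI σ r))
        (extI (rayCoeff A hA.continuous x) s (extI σ s)) s :=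
      (intervalIntegral.integral_hasDerivAt_right (intervalIntegrable_extI _ _ _ _)
        (hcont.stronglyMeasurableAtFilter _ _) hcont.continuousAt).const_add e
    rw [hax s ⟨hs.1.le, hs.2.le⟩] at h1
    refine h1.congr_of_eventuallyEq ?_
    filter_upwards [Ioo_mem_nhds hs.1 hs.2] with r hr using hσx r ⟨hr.1.le, hr.2.le⟩
  have hFTC := intervalIntegral.integral_eq_sub_of_hasDerivAt_of_le (a := 0) (b := (t : ℝ))
    (f := fun s ↦ s • A (s • x) h (extI σ s))
    (f' := fun s ↦ extI (flipFamily ((rayCoeffDeriv A hA).curry x) h) s (extI σ s)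
      + extI (rayCoeff A hA.continuous x) s (extI u s)) t.2.1 ?_ ?_ ?_
  · rw [hFTC, hu]
    have h1 := extI_coe σ t
    rw [h1]
    simp
  · have h1 := hA.continuous
    have h2 := continuous_extI σ
    exact Continuous.continuousOn (by fun_prop)
  · intro s hs
    have hs' : s ∈ Ioo (0 : ℝ) 1 := ⟨hs.1, hs.2.trans_le t.2.2⟩
    have hs'' : s ∈ Icc (0 : ℝ) 1 := ⟨hs'.1.le, hs'.2.le⟩
    have hA1 : HasDerivAt (fun s : ℝ ↦ A (s • x)) (fderiv ℝ A (s • x) x) s := by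
      have h1 : HasDerivAt (fun s : ℝ ↦ s • x) x s := by
        simpa using (hasDerivAt_id s).smul_const x
      exact ((hA.differentiable (by simp) _).hasFDerivAt).comp_hasDerivAt s h1
    have hA2 : HasDerivAt (fun s : ℝ ↦ A (s • x) h) (fderiv ℝ A (s • x) x h) s := by
      simpa using hA1.clm_apply (hasDerivAt_const s h)
    have h3 := (hasDerivAt_id s).smul (hA2.clm_apply (hσd s hs'))
    refine h3.congr_deriv ?_
    rw [hux s hs'', hax s hs'', ha'x s hs'']
    have h4 := congrArg (fun T : E →L[ℝ] E ↦ T (extI σ s)) (hflat s hs'')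
    simp only [add_apply, ContinuousLinearMap.comp_apply] at h4
    simp only [id, add_apply, smul_apply, map_smul, one_smul]
    rw [← h4, smul_add]
    abel
  · exact ((intervalIntegrable_extI _ _ _ _).add (intervalIntegrable_extI _ _ _ _))

/-- A linear system `ds = A s` of total differential equations that is flat, that is, satisfies the
integrability condition near `0`, has a solution near `0` with any prescribed value at `0`. The
solution is obtained by integrating along rays. -/
lemma exists_flat_solution_zero {A : X → X →L[ℝ] E →L[ℝ] E} (hA : ContDiff ℝ 1 A) {r : ℝ}
    (hr : 0 < r) (hflat : ∀ x ∈ Metric.ball (0 : X) r, ∀ h k : X,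
      fderiv ℝ A x h k + A x k ∘L A x h = fderiv ℝ A x k h + A x h ∘L A x k) (e : E) :
    ∃ s : X → E, s 0 = e ∧ ∀ᶠ x in nhds 0, HasFDerivAt s ((A x).flip (s x)) x := by
  have ha0 : rayCoeff A hA.continuous 0 = 0 := by
    ext t : 1
    simp [rayCoeff]
  obtain ⟨σ, hσ0, hσ⟩ := exists_differentiable_fixedPoint (volterra (E := E))
    (hasFDerivAt_rayCoeff hA) ha0 (ContinuousMap.const unitInterval e)
  refine ⟨fun x ↦ σ x 1, by simp [hσ0], ?_⟩
  filter_upwards [hσ, Metric.ball_mem_nhds (0 : X) hr] with x hx hxr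
  obtain ⟨hσd, hσe, hlin, huniq⟩ := hx
  -- `∂ₕσ` and `t ↦ t A(tx)(h) σ(t)` solve the same linear integral equation, and its solution is
  -- unique
  have hu : ∀ h, fderiv ℝ σ x h 1 = A x h (σ x 1) := by
    intro h
    have hAc := hA.continuous
    have hc : Continuous fun t : unitInterval ↦ (t : ℝ) • A ((t : ℝ) • x) h (σ x t) := by fun_prop
    set u : C(unitInterval, E) := ⟨fun t ↦ (t : ℝ) • A ((t : ℝ) • x) h (σ x t), hc⟩ with hudef
    have hueq := eq_volterra_of_flat hA x h (fun t ht ↦ hflat _ (by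
      rw [mem_ball_zero_iff] at hxr ⊢
      rw [norm_smul, Real.norm_of_nonneg ht.1]
      exact (mul_le_of_le_one_left (norm_nonneg x) ht.2).trans_lt hxr) h x) e (σ x) u hσe
      fun t ↦ rfl
    have h2 : fderiv ℝ σ x h - u = 0 := by
      refine huniq _ ?_
      rw [map_sub]
      conv_lhs => rw [hlin h, hueq]
      abel
    rw [sub_eq_zero] at h2
    rw [h2]
    simp [hudef]
  have hev := (ContinuousMap.evalCLM ℝ (1 : unitInterval) : C(unitInterval, E) →L[ℝ] E).hasFDerivAt.comp x
    hσd.hasFDerivAt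
  refine hev.congr_fderiv ?_
  ext h : 1
  exact hu h

end FlatSystem

section FlatSystem

open Set

set_option synthInstance.maxHeartbeats 400000
set_option maxHeartbeats 2000000

variable {n : ℕ} {κ : Type*} [Fintype κ] [DecidableEq κ]

/-- A cutoff function that localises smooth functions on `U` near `x₀`. -/
lemma exists_cutoff {U : Set (Coord n)} (hU : IsOpen U) {x₀ : Coord n} (hx₀ : x₀ ∈ U) :
    ∃ (χ : Coord n → ℝ) (r : ℝ), 0 < r ∧ Metric.ball x₀ r ⊆ U ∧
      (∀ y ∈ Metric.ball x₀ r, χ y = 1) ∧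
      ∀ f : Coord n → ℝ, ContDiffOn ℝ ∞ f U → ContDiff ℝ ∞ (fun y ↦ χ y * f y) := by
  obtain ⟨R, hR, hRU⟩ := Metric.isOpen_iff.1 hU x₀ hx₀
  let χ : ContDiffBump x₀ := ⟨R / 4, R / 2, by linarith, by linarith⟩
  have hsub : Metric.closedBall x₀ (R / 2) ⊆ U := fun y hy ↦
    hRU ((Metric.mem_closedBall.1 hy).trans_lt (by linarith))
  refine ⟨χ, R / 4, by linarith, fun y hy ↦ hRU ?_, fun y hy ↦ ?_, fun f hf ↦ ?_⟩
  · exact (Metric.mem_ball.1 hy).trans (by linarith)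
  · exact χ.one_of_mem_closedBall (Metric.ball_subset_closedBall hy)
  · rw [contDiff_iff_contDiffAt]
    intro y
    by_cases hy : y ∈ Metric.closedBall x₀ (R / 2)
    · exact χ.contDiff.contDiffAt.mul (hf.contDiffAt (hU.mem_nhds (hsub hy)))
    · have h0 : (fun z ↦ χ z * f z) =ᶠ[nhds y] fun _ ↦ 0 := by
        filter_upwards [Metric.isClosed_closedBall.isOpen_compl.mem_nhds hy] with z hz
        have : χ z = 0 := χ.zero_of_le_dist (by
          simpa [Metric.mem_closedBall, χ] using le_of_lt (show R / 2 < dist z x₀ by simpa using hz))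
        rw [this, zero_mul]
      exact contDiffAt_const.congr_of_eventuallyEq h0

lemma contDiff_sum_smul {X H ι : Type*} [NormedAddCommGroup X] [NormedSpace ℝ X]
    [NormedAddCommGroup H] [NormedSpace ℝ H] [Fintype ι] {c : ι → X → ℝ}
    (hc : ∀ α, ContDiff ℝ ∞ (c α)) (T : ι → H) : ContDiff ℝ ∞ (fun y ↦ ∑ α, c α y • T α) :=
  ContDiff.sum fun α _ ↦ (hc α).smul contDiff_const

lemma fderiv_sum_smul {X H ι : Type*} [NormedAddCommGroup X] [NormedSpace ℝ X]
    [NormedAddCommGroup H] [NormedSpace ℝ H] [Fintype ι] {c : ι → X → ℝ}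
    (hc : ∀ α, ContDiff ℝ ∞ (c α)) (T : ι → H) (y h : X) :
    fderiv ℝ (fun y ↦ ∑ α, c α y • T α) y h = ∑ α, fderiv ℝ (c α) y h • T α := by
  have h1 : HasFDerivAt (fun y ↦ ∑ α, c α y • T α)
      (∑ α, (fderiv ℝ (c α) y).smulRight (T α)) y :=
    HasFDerivAt.fun_sum fun α _ ↦
      (((hc α).differentiable (by simp) y).hasFDerivAt).smul_const (T α)
  rw [h1.fderiv]
  simp

/-- Differentiable solutions of a linear system with smooth coefficients are smooth. -/
lemma contDiffOn_of_hasFDerivAt {X E : Type*} [NormedAddCommGroup X] [NormedSpace ℝ X]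
    [NormedAddCommGroup E] [NormedSpace ℝ E] {B : X → X →L[ℝ] E →L[ℝ] E}
    (hB : ContDiff ℝ ∞ B) {W : Set X} (hW : IsOpen W) {s : X → E}
    (hs : ∀ y ∈ W, HasFDerivAt s ((B y).flip (s y)) y) : ContDiffOn ℝ ∞ s W := by
  rw [contDiffOn_infty]
  intro m
  induction m with
  | zero =>
    exact contDiffOn_zero.2 fun y hy ↦ (hs y hy).continuousAt.continuousWithinAt
  | succ m ih =>
    have h1 : ((m + 1 : ℕ) : WithTop ℕ∞) = (m : WithTop ℕ∞) + 1 := by norm_cast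
    rw [h1, contDiffOn_succ_iff_fderiv_of_isOpen hW]
    refine ⟨fun y hy ↦ (hs y hy).differentiableAt.differentiableWithinAt, by simp, ?_⟩
    have h2 : ContDiff ℝ m fun L : X →L[ℝ] E →L[ℝ] E ↦ L.flip :=
      (IsLinearMap.with_bound ⟨fun _ _ ↦ rfl, fun _ _ ↦ rfl⟩ 1 fun L ↦ by
        rw [ContinuousLinearMap.opNorm_flip, one_mul]).contDiff
    have h3 : ContDiff ℝ m fun y ↦ (B y).flip := h2.comp (contDiff_infty.1 hB m)
    exact (h3.contDiffOn.clm_apply ih).congr fun y hy ↦ (hs y hy).fderiv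

/-- A flat linear system `∂ᵢ s = Aᵢ s` with smooth matrix coefficients has, near each point, a
smooth solution with prescribed value at this point. -/
lemma exists_flat_solution {U : Set (Coord n)} (hU : IsOpen U) {x₀ : Coord n} (hx₀ : x₀ ∈ U)
    {A : Fin n → Coord n → Matrix κ κ ℝ}
    (hA : ∀ i a b, ContDiffOn ℝ ∞ (fun y ↦ A i y a b) U)
    (hflat : ∀ y ∈ U, ∀ i j a b, pd j (fun z ↦ A i z a b) y + (A i y * A j y) a b
      = pd i (fun z ↦ A j z a b) y + (A j y * A i y) a b) (e : κ → ℝ) :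
    ∃ (W : Set (Coord n)) (s : κ → Coord n → ℝ), IsOpen W ∧ x₀ ∈ W ∧ W ⊆ U ∧
      (∀ a, s a x₀ = e a) ∧ (∀ a, ContDiffOn ℝ ∞ (s a) W) ∧
      ∀ y ∈ W, ∀ i a, pd i (s a) y = ∑ b, A i y a b * s b y := by
  obtain ⟨χ, r, hr, hrU, hχ1, hχ⟩ := exists_cutoff hU hx₀
  let T : Fin n × κ × κ → (Coord n →L[ℝ] (κ → ℝ) →L[ℝ] (κ → ℝ)) := fun α ↦
    (EuclideanSpace.proj (𝕜 := ℝ) α.1 : Coord n →L[ℝ] ℝ).smulRight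
      ((ContinuousLinearMap.proj (R := ℝ) (φ := fun _ : κ ↦ ℝ) α.2.2).smulRight
        (Pi.single α.2.1 (1 : ℝ) : κ → ℝ))
  let c : Fin n → κ → κ → Coord n → ℝ := fun i a b y ↦ χ (x₀ + y) * A i (x₀ + y) a b
  have hc : ∀ i a b, ContDiff ℝ ∞ (c i a b) := fun i a b ↦
    (hχ _ (hA i a b)).comp (contDiff_const.add contDiff_id)
  let B : Coord n → Coord n →L[ℝ] (κ → ℝ) →L[ℝ] (κ → ℝ) := fun y ↦
    ∑ α : Fin n × κ × κ, c α.1 α.2.1 α.2.2 y • T α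
  have hB : ContDiff ℝ ∞ B := contDiff_sum_smul (fun α : Fin n × κ × κ ↦ hc α.1 α.2.1 α.2.2) T
  have hTapp : ∀ i a b h v a', T (i, a, b) h v a' = if a = a' then h i * v b else 0 := by
    intro i a b h v a'
    simp only [T, ContinuousLinearMap.smulRight_apply, smul_apply,
      ContinuousLinearMap.proj_apply, Pi.smul_apply, smul_eq_mul, Pi.single_apply]
    by_cases h : a = a'
    · subst h; simp
    · simp [h, Ne.symm h]
  have hsum : ∀ (d : Fin n → κ → κ → ℝ) (h : Coord n) (v : κ → ℝ) (a : κ),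
      (∑ α : Fin n × κ × κ, d α.1 α.2.1 α.2.2 • T α) h v a = ∑ i, h i * ∑ b, d i a b * v b := by
    intro d h v a
    simp only [sum_apply, smul_apply, Finset.sum_apply, Pi.smul_apply, smul_eq_mul,
      Fintype.sum_prod_type, hTapp]
    refine Finset.sum_congr rfl fun i _ ↦ ?_
    rw [Finset.sum_comm, Finset.mul_sum]
    refine Finset.sum_congr rfl fun b _ ↦ ?_
    simp
    ring
  have hBapp : ∀ y h v a, B y h v a = ∑ i, h i * ∑ b, c i a b y * v b := fun y h v a ↦
    hsum (fun i a b ↦ c i a b y) h v a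
  have hBd : ∀ y h k v a, fderiv ℝ B y h k v a
      = ∑ i, k i * ∑ b, (∑ j, h j * pd j (c i a b) y) * v b := by
    intro y h k v a
    rw [fderiv_sum_smul (fun α : Fin n × κ × κ ↦ hc α.1 α.2.1 α.2.2) T]
    simp only [← fderiv_apply_eq_sum_pd]
    exact hsum (fun i a b ↦ fderiv ℝ (c i a b) y h) k v a
  have hcA : ∀ y ∈ Metric.ball (0 : Coord n) r, x₀ + y ∈ Metric.ball x₀ r := by
    intro y hy
    simpa using hy
  have hceq : ∀ y ∈ Metric.ball (0 : Coord n) r, ∀ i a b, c i a b y = A i (x₀ + y) a b := by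
    intro y hy i a b
    simp only [c, hχ1 _ (hcA y hy), one_mul]
  have hcpd : ∀ y ∈ Metric.ball (0 : Coord n) r, ∀ i j a b,
      pd j (c i a b) y = pd j (fun z ↦ A i z a b) (x₀ + y) := by
    intro y hy i j a b
    rw [pd_congr Metric.isOpen_ball hy (fun z hz ↦ hceq z hz i a b)]
    simp only [pd]
    rw [fderiv_comp_add_left (f := fun z ↦ A i z a b)]
  have hBflat : ∀ y ∈ Metric.ball (0 : Coord n) r, ∀ h k : Coord n,
      fderiv ℝ B y h k + B y k ∘L B y h = fderiv ℝ B y k h + B y h ∘L B y k := by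
    intro y hy h k
    have key : ∀ h k : Coord n, ∀ v a, (fderiv ℝ B y h k + B y k ∘L B y h) v a
        = ∑ i, ∑ j, k i * h j * ∑ b, (pd j (fun z ↦ A i z a b) (x₀ + y)
          + (A i (x₀ + y) * A j (x₀ + y)) a b) * v b := by
      intro h k v a
      simp only [add_apply, ContinuousLinearMap.comp_apply, Pi.add_apply, hBd, hBapp,
        hceq y hy, hcpd y hy, Matrix.mul_apply, add_mul, Finset.sum_add_distrib, mul_add]
      congr 1
      · refine Finset.sum_congr rfl fun i _ ↦ ?_
        simp only [Finset.sum_mul, Finset.mul_sum]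
        rw [Finset.sum_comm]
        exact Finset.sum_congr rfl fun j _ ↦ Finset.sum_congr rfl fun b _ ↦ by ring
      · refine Finset.sum_congr rfl fun i _ ↦ ?_
        simp only [Finset.sum_mul, Finset.mul_sum]
        rw [Finset.sum_comm]
        refine Finset.sum_congr rfl fun j _ ↦ ?_
        rw [Finset.sum_comm]
        exact Finset.sum_congr rfl fun j _ ↦ Finset.sum_congr rfl fun b _ ↦ by ring
    ext v a
    rw [key, key, Finset.sum_comm]
    refine Finset.sum_congr rfl fun i _ ↦ Finset.sum_congr rfl fun j _ ↦ ?_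
    rw [mul_comm (k j)]
    congr 1
    refine Finset.sum_congr rfl fun b _ ↦ ?_
    rw [hflat _ (hrU (hcA y hy))]
  obtain ⟨s, hs0, hs⟩ := exists_flat_solution_zero (hB.of_le (by simp)) hr hBflat e
  obtain ⟨δ, hδ, hsδ⟩ := Metric.eventually_nhds_iff_ball.1 hs
  have hWr : ∀ y ∈ Metric.ball x₀ (min δ r), y - x₀ ∈ Metric.ball (0 : Coord n) δ ∧
      y - x₀ ∈ Metric.ball (0 : Coord n) r := by
    intro y hy
    rw [Metric.mem_ball, dist_eq_norm] at hy
    simp only [mem_ball_zero_iff]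
    exact ⟨hy.trans_le (min_le_left _ _), hy.trans_le (min_le_right _ _)⟩
  have hder : ∀ y ∈ Metric.ball x₀ (min δ r), HasFDerivAt (fun z ↦ s (z - x₀))
      ((B (y - x₀)).flip (s (y - x₀))) y := by
    intro y hy
    simpa using (hsδ _ (hWr y hy).1).comp y ((hasFDerivAt_id y).sub_const x₀)
  have hsm : ContDiffOn ℝ ∞ (fun z ↦ s (z - x₀)) (Metric.ball x₀ (min δ r)) :=
    contDiffOn_of_hasFDerivAt (B := fun y ↦ B (y - x₀)) (hB.comp (contDiff_id.sub contDiff_const))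
      Metric.isOpen_ball hder
  refine ⟨Metric.ball x₀ (min δ r), fun a y ↦ s (y - x₀) a, Metric.isOpen_ball,
    Metric.mem_ball_self (lt_min hδ hr), fun y hy ↦ ?_, fun a ↦ by simp [hs0], fun a ↦ ?_, ?_⟩
  · have := hcA _ (hWr y hy).2
    rw [add_sub_cancel] at this
    exact hrU this
  · exact contDiffOn_pi.1 hsm a
  · intro y hy i a
    have h1 := (hasFDerivAt_pi'.1 (hder y hy)) a
    rw [pd, h1.fderiv]
    simp only [ContinuousLinearMap.comp_apply, ContinuousLinearMap.proj_apply,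
      ContinuousLinearMap.flip_apply, hBapp]
    rw [Finset.sum_eq_single i]
    · simp only [PiLp.single_apply, if_true, one_mul]
      refine Finset.sum_congr rfl fun b _ ↦ ?_
      rw [hceq _ (hWr y hy).2, add_sub_cancel]
    · intro j _ hj
      simp [hj]
    · simp

end FlatSystem

/-! ### The model surfaces of constant curvature -/

section Model

variable {K : ℝ} {x : Coord 2}

/-- The function `1 - K |x|²`, which is positive on the coordinate domain of the model surface. -/
def modelDisc (K : ℝ) (x : Coord 2) : ℝ := 1 - K * (x 0 ^ 2 + x 1 ^ 2)

/-- The coordinate domain of the model surface of curvature `K`. -/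
def modelSet (K : ℝ) : Set (Coord 2) := {x | 0 < modelDisc K x}

/-- The metric of constant curvature `K` in the coordinates given by two orthonormal linear
functions on the sphere (or hyperboloid); it is the inverse of the matrix `1 - K x xᵀ`. -/
def modelMetric (K : ℝ) : MatField 2 := fun x ↦ Matrix.of fun i j ↦
  (if i = j then 1 else 0) + K * (x i * x j) / modelDisc K x

/-- The rotation by a right angle for the metric `modelMetric K`. -/
def modelComplex (K : ℝ) : MatField 2 := fun x ↦
  -√(modelDisc K x) • (!![0, 1; -1, 0] * modelMetric K x)

lemma contDiff_modelDisc (K : ℝ) : ContDiff ℝ ∞ (modelDisc K) := by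
  unfold modelDisc
  fun_prop

lemma isOpen_modelSet (K : ℝ) : IsOpen (modelSet K) :=
  isOpen_lt continuous_const (contDiff_modelDisc K).continuous

lemma smoothOn_modelMetric (K : ℝ) : SmoothOn (modelSet K) (modelMetric K) := by
  intro i j
  simp only [modelMetric, Matrix.of_apply]
  refine contDiffOn_const.add (ContDiffOn.div ?_ (contDiff_modelDisc K).contDiffOn
    fun y hy ↦ (ne_of_gt hy))
  exact ContDiff.contDiffOn (by fun_prop)

lemma modelMetric_symm (K : ℝ) (x : Coord 2) (i j : Fin 2) :
    modelMetric K x i j = modelMetric K x j i := by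
  simp only [modelMetric, Matrix.of_apply, eq_comm, mul_comm (x i)]

lemma modelMetric_posDef (hx : x ∈ modelSet K) : (modelMetric K x).PosDef := by
  have hD : 0 < modelDisc K x := hx
  refine Matrix.PosDef.of_dotProduct_mulVec_pos ?_ fun v hv ↦ ?_
  · ext i j
    simp only [Matrix.conjTranspose_apply, star_trivial]
    exact modelMetric_symm K x j i
  · have hv2 : 0 < v 0 ^ 2 + v 1 ^ 2 := by
      by_contra h
      refine hv (funext fun i ↦ ?_)
      have h0 : v 0 ^ 2 + v 1 ^ 2 = 0 := le_antisymm (not_lt.1 h) (by positivity)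
      have h1 : v 0 = 0 := by nlinarith [sq_nonneg (v 0), sq_nonneg (v 1)]
      have h2 : v 1 = 0 := by nlinarith [sq_nonneg (v 0), sq_nonneg (v 1)]
      fin_cases i
      · exact h1
      · exact h2
    have h1 : star v ⬝ᵥ (modelMetric K x).mulVec v
        = ((v 0 ^ 2 + v 1 ^ 2) * modelDisc K x + K * (x 0 * v 0 + x 1 * v 1) ^ 2)
          / modelDisc K x := by
      simp only [modelMetric, dotProduct, Matrix.mulVec, Fin.sum_univ_two, Matrix.of_apply,
        star_trivial]
      simp
      field_simp
      ring
    rw [h1]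
    refine div_pos ?_ hD
    rcases le_or_gt 0 K with hK | hK
    · have := mul_pos hv2 hD
      positivity
    · have h2 : (v 0 ^ 2 + v 1 ^ 2) * modelDisc K x + K * (x 0 * v 0 + x 1 * v 1) ^ 2
          = (v 0 ^ 2 + v 1 ^ 2) + (-K) * (x 0 * v 1 - x 1 * v 0) ^ 2 := by
        simp only [modelDisc]; ring
      rw [h2]
      have : 0 < -K := by linarith
      positivity

lemma isMetricOn_model (K : ℝ) : IsMetricOn (modelSet K) (modelMetric K) :=
  ⟨isOpen_modelSet K, smoothOn_modelMetric K, fun _ hx ↦ modelMetric_posDef hx⟩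

lemma modelMetric_apply_self (hx : x ∈ modelSet K) (i : Fin 2) :
    ∑ j, modelMetric K x i j * x j = x i / modelDisc K x := by
  have hD : modelDisc K x ≠ 0 := ne_of_gt hx
  have h2 : K * (x 0 ^ 2 + x 1 ^ 2) = 1 - modelDisc K x := by simp [modelDisc]
  simp only [modelMetric, Matrix.of_apply, Fin.sum_univ_two]
  fin_cases i <;> simp <;> field_simp <;> linear_combination (x _) * h2

lemma pd_modelDisc (i : Fin 2) : pd i (modelDisc K) x = -2 * K * x i := by
  have h : modelDisc K = fun y : Coord 2 ↦ 1 - K * (y 0 * y 0 + y 1 * y 1) := by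
    ext y; simp only [modelDisc]; ring
  have hc : ∀ j : Fin 2, DifferentiableAt ℝ (fun y : Coord 2 ↦ y j) x := fun j ↦ by fun_prop
  rw [h, pd_sub (by fun_prop) (by fun_prop), pd_const_mul (by fun_prop),
    pd_add (by fun_prop) (by fun_prop), pd_mul (hc 0) (hc 0), pd_mul (hc 1) (hc 1), pd_const,
    pd_coord, pd_coord]
  fin_cases i <;> simp <;> ring

lemma pd_modelMetric (hx : x ∈ modelSet K) (i j l : Fin 2) :
    pd i (fun y ↦ modelMetric K y l j) x
      = K / modelDisc K x * (modelMetric K x i j * x l + modelMetric K x i l * x j) := by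
  have hD : modelDisc K x ≠ 0 := ne_of_gt hx
  have hU := isOpen_modelSet K
  have hc : ∀ j : Fin 2, DifferentiableAt ℝ (fun y : Coord 2 ↦ y j) x := fun j ↦ by fun_prop
  have hlj : DifferentiableAt ℝ (fun y : Coord 2 ↦ y l * y j) x := by fun_prop
  have hDd : DifferentiableAt ℝ (modelDisc K) x :=
    (contDiff_modelDisc K).differentiable (by simp) x
  -- differentiate `D G = D + K x xᵀ`
  have h1 : pd i (fun y ↦ modelMetric K y l j * modelDisc K y) x
      = pd i (fun y ↦ (if l = j then 1 else 0) * modelDisc K y + K * (y l * y j)) x := by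
    refine pd_congr hU hx (fun y hy ↦ ?_) i
    have hDy : modelDisc K y ≠ 0 := ne_of_gt hy
    simp only [modelMetric, Matrix.of_apply]
    field_simp
  rw [pd_mul ((smoothOn_modelMetric K).diffAt hU hx l j) hDd,
    pd_add (hDd.const_mul _) (hlj.const_mul _), pd_const_mul hDd, pd_const_mul hlj, pd_mul (hc l) (hc j),
    pd_coord, pd_coord,
    pd_modelDisc] at h1
  have h2 : pd i (fun y ↦ modelMetric K y l j) x = (((if l = j then 1 else 0) * (-2 * K * x i)
      + K * ((if i = l then 1 else 0) * x j + x l * (if i = j then 1 else 0)))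
      - modelMetric K x l j * (-2 * K * x i)) / modelDisc K x := by
    rw [eq_div_iff hD]
    linarith
  rw [h2]
  simp only [modelMetric, Matrix.of_apply]
  field_simp
  ring

/-- The Christoffel symbols of the model surface are `Γᵏᵢⱼ = K xᵏ gᵢⱼ`. -/
lemma gam_modelMetric (hx : x ∈ modelSet K) (i : Fin 2) :
    gam (modelMetric K) i x = Matrix.of fun k j ↦ K * (x k * modelMetric K x i j) := by
  have h := isMetricOn_model K
  symm
  refine h.eq_gam hx (B := fun i ↦ Matrix.of fun k j ↦ K * (x k * modelMetric K x i j))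
    (fun i ↦ ?_) (fun i j k ↦ by simp only [Matrix.of_apply, modelMetric_symm K x i j]) i
  have h1 : ∀ l j, (modelMetric K x * Matrix.of fun k j ↦ K * (x k * modelMetric K x i j)) l j
      = K / modelDisc K x * (modelMetric K x i j * x l) := by
    intro l j
    have h2 := modelMetric_apply_self hx l
    calc _ = K * modelMetric K x i j * ∑ k, modelMetric K x l k * x k := by
          simp only [Matrix.mul_apply, Matrix.of_apply, Finset.mul_sum]
          exact Finset.sum_congr rfl fun k _ ↦ by ring
      _ = _ := by rw [h2]; ring
  ext l j
  have h3 : ((Matrix.of fun k j ↦ K * (x k * modelMetric K x i j)).transpose * modelMetric K x)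
      = (modelMetric K x * Matrix.of fun k j ↦ K * (x k * modelMetric K x i j)).transpose := by
    rw [Matrix.transpose_mul, h.transpose hx]
  rw [h3, Matrix.add_apply, Matrix.transpose_apply, h1, h1, pdM, Matrix.of_apply,
    pd_modelMetric hx]
  ring

lemma curvUp_modelMetric (hx : x ∈ modelSet K) (i j k m : Fin 2) :
    curvUp (modelMetric K) x i j k m
      = K * ((if i = m then 1 else 0) * modelMetric K x j k
        - (if j = m then 1 else 0) * modelMetric K x i k) := by
  have hU := isOpen_modelSet K
  have hc : ∀ a b c, ∀ y ∈ modelSet K, christoffel (modelMetric K) y a b c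
      = K * (y a * modelMetric K y b c) := fun a b c y hy ↦
    congrFun (congrFun (gam_modelMetric hy b) a) c
  have hp : ∀ i a b c, pd i (fun y ↦ christoffel (modelMetric K) y a b c) x
      = K * ((if i = a then 1 else 0) * modelMetric K x b c
        + x a * (K / modelDisc K x * (modelMetric K x i c * x b + modelMetric K x i b * x c))) := by
    intro i a b c
    have hd : DifferentiableAt ℝ (fun y : Coord 2 ↦ y a) x := by fun_prop
    have hG := (smoothOn_modelMetric K).diffAt hU hx b c
    have hdG : DifferentiableAt ℝ (fun y : Coord 2 ↦ y a * modelMetric K y b c) x := hd.mul hG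
    rw [pd_congr hU hx (hc a b c), pd_const_mul hdG, pd_mul hd hG, pd_coord,
      pd_modelMetric hx]
  have hs : ∀ i j, ∑ a, (christoffel (modelMetric K) x a j k * christoffel (modelMetric K) x m i a)
      = K ^ 2 / modelDisc K x * (modelMetric K x j k * x m * x i) := by
    intro i j
    have h2 := modelMetric_apply_self hx i
    calc _ = K ^ 2 * modelMetric K x j k * x m * ∑ a, modelMetric K x i a * x a := by
          rw [Finset.mul_sum]
          refine Finset.sum_congr rfl fun a _ ↦ ?_
          rw [hc _ _ _ x hx, hc _ _ _ x hx]
          ring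
      _ = _ := by rw [h2]; ring
  rw [curvUp, hp, hp, Finset.sum_sub_distrib, hs, hs, modelMetric_symm K x j i]
  ring

lemma gaussCurv_modelMetric (hx : x ∈ modelSet K) : gaussCurv (modelMetric K) x = K := by
  have hd := (modelMetric_posDef hx).det_pos.ne'
  rw [gaussCurv, div_eq_iff hd, Matrix.det_fin_two]
  simp only [curv, Fin.sum_univ_two, curvUp_modelMetric hx]
  simp
  ring

lemma det_modelMetric (hx : x ∈ modelSet K) : (modelMetric K x).det = (modelDisc K x)⁻¹ := by
  have hD : modelDisc K x ≠ 0 := ne_of_gt hx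
  rw [Matrix.det_fin_two]
  simp only [modelMetric, Matrix.of_apply]
  have h2 : K * (x 0 ^ 2 + x 1 ^ 2) = 1 - modelDisc K x := by simp [modelDisc]
  simp
  field_simp
  linear_combination modelDisc K x * h2

lemma modelComplex_eq (K : ℝ) (x : Coord 2) : modelComplex K x =
    !![-(√(modelDisc K x) * modelMetric K x 0 1), -(√(modelDisc K x) * modelMetric K x 1 1);
      √(modelDisc K x) * modelMetric K x 0 0, √(modelDisc K x) * modelMetric K x 0 1] := by
  have h2 := modelMetric_symm K x 1 0
  ext i j
  fin_cases i <;> fin_cases j <;>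
    simp [modelComplex, Matrix.vecMul, dotProduct, Fin.sum_univ_two, h2]

lemma isAlmostHermitianOn_model (K : ℝ) :
    IsAlmostHermitianOn (modelSet K) (modelMetric K) (modelComplex K) := by
  have key : ∀ y ∈ modelSet K, √(modelDisc K y) * √(modelDisc K y) * (modelMetric K y 0 0
      * modelMetric K y 1 1 - modelMetric K y 0 1 * modelMetric K y 0 1) = 1 := fun y hy ↦ by
    have hD : 0 < modelDisc K y := hy
    have h1 := det_modelMetric hy
    rw [Matrix.det_fin_two, modelMetric_symm K y 1 0] at h1
    rw [h1, Real.mul_self_sqrt hD.le, mul_inv_cancel₀ hD.ne']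
  refine ⟨isOpen_modelSet K, smoothOn_modelMetric K, ?_, fun y hy ↦ modelMetric_posDef hy,
    fun y hy ↦ ?_, fun y hy ↦ ?_⟩
  · have h1 : ContDiffOn ℝ ∞ (fun y ↦ -√(modelDisc K y)) (modelSet K) :=
      ((contDiff_modelDisc K).contDiffOn.sqrt fun y hy ↦ ne_of_gt hy).neg
    exact SmoothOn.smul h1 ((SmoothOn.const _).mul (smoothOn_modelMetric K))
  · have h1 := key y hy
    rw [modelComplex_eq]
    generalize √(modelDisc K y) = s at *
    ext i j
    fin_cases i <;> fin_cases j <;> simp [Matrix.mul_apply, Fin.sum_univ_two] <;>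
      first | ring1 | linear_combination -h1
  · have h1 := key y hy
    have h2 := modelMetric_symm K y 1 0
    rw [modelComplex_eq]
    generalize √(modelDisc K y) = s at *
    ext i j
    fin_cases i <;> fin_cases j <;> simp [Matrix.mul_apply, Fin.sum_univ_two, h2]
    · linear_combination (modelMetric K y 0 0) * h1
    · linear_combination (modelMetric K y 0 1) * h1
    · linear_combination (modelMetric K y 0 1) * h1
    · linear_combination (modelMetric K y 1 1) * h1

end Model

/-! ### The curvature of a Bochner flat Kähler surface -/

/-- On the open set `U`, the matrix fields `G` and `J` define a Bochner flat Kähler surface of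
constant scalar curvature `τ`. -/
structure IsBochnerFlatOn (U : Set (Coord 4)) (G J : MatField 4) (τ : ℝ) : Prop where
  hermitian : IsAlmostHermitianOn U G J
  parallel : ∀ y ∈ U, ∀ i k j, nablaJ G J y i k j = 0
  flat : ∀ y ∈ U, ∀ i j k l, bochner G J y i j k l = 0
  scal_eq : ∀ y ∈ U, scal G y = τ

section Kahler

variable {n : ℕ} {U : Set (Coord n)} {G J : MatField n} {x : Coord n}

lemma bar_eq (J a : Matrix (Fin n) (Fin n) ℝ) : bar J a = a * J := by
  ext i j
  simp only [bar, Matrix.mul_apply]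
  exact Finset.sum_congr rfl fun k _ ↦ mul_comm _ _

lemma twist_eq (J a : Matrix (Fin n) (Fin n) ℝ) : twist J a = J.transpose * a * J := by
  ext i j
  simp only [twist, Matrix.mul_apply, Matrix.transpose_apply, Finset.sum_mul]
  rw [Finset.sum_comm]
  exact Finset.sum_congr rfl fun k _ ↦ Finset.sum_congr rfl fun l _ ↦ by ring

lemma metricTrace_eq {g a : Matrix (Fin n) (Fin n) ℝ} (hg : g.transpose = g) :
    metricTrace g a = (g⁻¹ * a).trace := by
  have h : g⁻¹.transpose = g⁻¹ := by rw [Matrix.transpose_nonsing_inv, hg]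
  simp only [metricTrace, Matrix.trace, Matrix.diag_apply, Matrix.mul_apply]
  rw [Finset.sum_comm]
  exact Finset.sum_congr rfl fun i _ ↦ Finset.sum_congr rfl fun j _ ↦ by
    rw [← congrFun (congrFun h j) i, Matrix.transpose_apply]

lemma IsAlmostHermitianOn.transpose_complex_mul (h : IsAlmostHermitianOn U G J) (hx : x ∈ U) :
    (J x).transpose * G x = -(G x * J x) := by
  have h1 := h.orthogonal x hx
  have h2 := h.sq_eq x hx
  calc (J x).transpose * G x = -((J x).transpose * G x * (J x * J x)) := by rw [h2]; simp
    _ = -((J x).transpose * G x * J x * J x) := by simp only [Matrix.mul_assoc]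
    _ = _ := by rw [h1]

lemma IsAlmostHermitianOn.crv_mul_complex (h : IsAlmostHermitianOn U G J)
    (hp : ∀ y ∈ U, ∀ i k j, nablaJ G J y i k j = 0) (hx : x ∈ U) (i j : Fin n) :
    crv G i j x * J x = J x * crv G i j x :=
  h.isMetricOn.crv_commute h.contDiffOn_complex
    (fun y hy i ↦ pdM_of_nablaJ_eq_zero i (hp y hy i)) hx i j

/-- On a Kähler manifold, the Ricci `*`-tensor is the Ricci tensor. -/
lemma IsAlmostHermitianOn.ricciStar_eq (h : IsAlmostHermitianOn U G J)
    (hp : ∀ y ∈ U, ∀ i k j, nablaJ G J y i k j = 0) (hx : x ∈ U) :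
    ricciStar G J x = ricci G x := by
  have hJ : ∀ b d, ∑ a, J x b a * J x a d = if b = d then -1 else 0 := fun b d ↦ by
    have := congrFun (congrFun (h.sq_eq x hx) b) d
    rw [Matrix.mul_apply] at this
    rw [this, Matrix.neg_apply, Matrix.one_apply]
    split_ifs <;> simp
  ext i j
  have h1 : ∀ a b, ∑ c, curvUp G x i b c a * J x c j = ∑ d, J x a d * curvUp G x i b j d := by
    intro a b
    have := congrFun (congrFun (h.crv_mul_complex hp hx i b) a) j
    simpa only [Matrix.mul_apply, crv, Matrix.of_apply] using this
  calc ricciStar G J x i j = ∑ a, ∑ b, J x b a * ∑ c, curvUp G x i b c a * J x c j := by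
        simp only [ricciStar, Finset.mul_sum]
        exact Finset.sum_congr rfl fun a _ ↦ Finset.sum_congr rfl fun b _ ↦
          Finset.sum_congr rfl fun c _ ↦ by ring
    _ = ∑ b, ∑ d, (∑ a, J x b a * J x a d) * curvUp G x i b j d := by
        simp only [h1, Finset.mul_sum, Finset.sum_mul]
        rw [Finset.sum_comm]
        refine Finset.sum_congr rfl fun b _ ↦ ?_
        rw [Finset.sum_comm]
        exact Finset.sum_congr rfl fun d _ ↦ Finset.sum_congr rfl fun a _ ↦ by ring
    _ = ricci G x i j := by
        simp only [hJ, ricci]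
        refine Finset.sum_congr rfl fun b _ ↦ ?_
        have := congrFun (congrFun (crv_antisymm G i b x) b) j
        simp only [crv, Matrix.of_apply, Matrix.neg_apply] at this
        simp [this]

/-- The curvature operators of a Kähler manifold satisfy `R(X, JY) = -R(JX, Y)`. -/
lemma IsAlmostHermitianOn.sum_complex_smul_crv (h : IsAlmostHermitianOn U G J)
    (hp : ∀ y ∈ U, ∀ i k j, nablaJ G J y i k j = 0) (hx : x ∈ U) (a i : Fin n) :
    ∑ k, J x k i • crv G a k x = -∑ c, J x c a • crv G c i x := by
  have hm := h.isMetricOn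
  have h0 : G x * ∑ k, J x k i • crv G a k x = G x * -∑ c, J x c a • crv G c i x := by
    ext q p
    have h1 : ∀ b c, (G x * crv G b c x) q p = (G x * crv G p q x) c b := fun b c ↦ by
      rw [← curv_eq hm hx, hm.curv_pair hx, curv_eq hm hx]
    have h2 := congrFun (congrFun (show (J x).transpose * (G x * crv G p q x)
        = -(G x * crv G p q x * J x) by
      rw [← Matrix.mul_assoc, h.transpose_complex_mul hx, Matrix.mul_assoc (G x),
        h.crv_mul_complex hp hx, Matrix.neg_mul]
      simp only [Matrix.mul_assoc]) i) a
    rw [Matrix.neg_apply, Matrix.mul_apply, Matrix.mul_apply] at h2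
    simp only [Matrix.mul_neg, Matrix.mul_sum, Matrix.mul_smul, Matrix.neg_apply,
      Matrix.sum_apply, Matrix.smul_apply, smul_eq_mul, h1]
    simp only [Matrix.transpose_apply] at h2
    rw [h2]
    exact congrArg _ (Finset.sum_congr rfl fun c _ ↦ mul_comm _ _)
  have := congrArg ((G x)⁻¹ * ·) h0
  simpa only [← Matrix.mul_assoc, hm.inv_mul hx, Matrix.one_mul] using this

/-- The Ricci tensor of a Kähler manifold is `J`-invariant. -/
lemma IsAlmostHermitianOn.twist_ricci (h : IsAlmostHermitianOn U G J)
    (hp : ∀ y ∈ U, ∀ i k j, nablaJ G J y i k j = 0) (hx : x ∈ U) :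
    (J x).transpose * ricci G x * J x = ricci G x := by
  ext i j
  have h1 : ∀ a, ∑ k, J x k i • crv G a k x = -∑ c, J x c a • crv G c i x :=
    fun a ↦ h.sum_complex_smul_crv hp hx a i
  calc ((J x).transpose * ricci G x * J x) i j
      = ∑ a, ((∑ k, J x k i • crv G a k x) * J x) a j := by
        have : ((J x).transpose * ricci G x) i = fun l ↦ ∑ a, (∑ k, J x k i • crv G a k x) a l := by
          ext l
          simp only [Matrix.mul_apply, Matrix.transpose_apply, ricci_eq, Finset.mul_sum,
            Matrix.sum_apply, Matrix.smul_apply, smul_eq_mul]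
          exact Finset.sum_comm
        rw [Matrix.mul_apply]
        simp only [this]
        refine (Finset.sum_congr rfl fun l _ ↦ Finset.sum_mul ..).trans ?_
        rw [Finset.sum_comm]
        exact Finset.sum_congr rfl fun a _ ↦ (Matrix.mul_apply ..).symm
    _ = ∑ a, -∑ c, J x c a * (J x * crv G c i x) a j := by
        refine Finset.sum_congr rfl fun a _ ↦ ?_
        rw [h1, Matrix.neg_mul, Matrix.sum_mul, Matrix.neg_apply, Matrix.sum_apply]
        refine congrArg _ (Finset.sum_congr rfl fun c _ ↦ ?_)
        rw [Matrix.smul_mul, Matrix.smul_apply, smul_eq_mul, h.crv_mul_complex hp hx]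
    _ = -∑ c, (J x * J x * crv G c i x) c j := by
        rw [Finset.sum_neg_distrib, Finset.sum_comm]
        simp only [Matrix.mul_assoc]
        exact congrArg _ (Finset.sum_congr rfl fun c _ ↦ (Matrix.mul_apply ..).symm)
    _ = ricci G x i j := by
        simp [h.sq_eq x hx, ricci_eq]

/-- The Ricci tensor is symmetric, by the pair symmetry of the curvature tensor. -/
lemma IsMetricOn.ricci_symm (h : IsMetricOn U G) (hx : x ∈ U) :
    (ricci G x).transpose = ricci G x := by
  have h1 : ∀ i j, ricci G x i j = ∑ a, ∑ l, (G x)⁻¹ a l * curv G x a i j l := by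
    intro i j
    rw [ricci_eq]
    refine Finset.sum_congr rfl fun a _ ↦ ?_
    have : crv G a i x = (G x)⁻¹ * (G x * crv G a i x) := by
      rw [← Matrix.mul_assoc, h.inv_mul hx, Matrix.one_mul]
    rw [this, Matrix.mul_apply]
    exact Finset.sum_congr rfl fun l _ ↦ by rw [curv_eq h hx]
  ext i j
  rw [Matrix.transpose_apply, h1, h1, Finset.sum_comm]
  refine Finset.sum_congr rfl fun a _ ↦ Finset.sum_congr rfl fun l _ ↦ ?_
  rw [← congrFun (congrFun (h.inv_transpose hx) l) a, Matrix.transpose_apply,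
    h.curv_pair hx a i j l, curv_antisymm_left, h.curv_antisymm_right hx, neg_neg]

lemma IsMetricOn.smooth_ricci (h : IsMetricOn U G) : SmoothOn U (ricci G) := by
  intro i j
  simp only [ricci_eq]
  exact ContDiffOn.sum fun a _ ↦ h.smooth_crv a i a j

end Kahler

section BochnerFlat

variable {U : Set (Coord 4)} {G J : MatField 4} {τ : ℝ} {x : Coord 4}

/-- The curvature tensor of a Bochner flat Kähler surface is determined by its Ricci tensor, because
the Ricci `*`-tensor of a Kähler manifold is the `J`-invariant Ricci tensor. -/
lemma IsBochnerFlatOn.curv_eq (h : IsBochnerFlatOn U G J τ) (hx : x ∈ U) (i j k l : Fin 4) :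
    curv G x i j k l = -(1 / 2) * kn (G x) (ricci G x) i j k l
      - τ / 48 * tri (J x) (G x) (G x) i j k l + τ / 8 * kn (G x) (G x) i j k l := by
  have h1 := h.flat x hx i j k l
  have h2 : scalStar G J x = scal G x := by
    rw [scalStar, h.hermitian.ricciStar_eq h.parallel hx, scal]
  rw [bochner, h.hermitian.ricciStar_eq h.parallel hx, twist_eq,
    h.hermitian.twist_ricci h.parallel hx, h2, h.scal_eq x hx] at h1
  linear_combination h1

lemma IsBochnerFlatOn.trace_eq (h : IsBochnerFlatOn U G J τ) (hx : x ∈ U) :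
    ((G x)⁻¹ * ricci G x).trace = τ := by
  rw [← h.scal_eq x hx, scal, metricTrace_eq (h.hermitian.isMetricOn.transpose hx)]

end BochnerFlat

/-! ### Hermitian linear algebra in real dimension four -/

section Pointwise

/-- The standard complex structure of `ℝ⁴ = ℂ²`. -/
def stdComplex : Matrix (Fin 4) (Fin 4) ℝ :=
  !![0, -1, 0, 0; 1, 0, 0, 0; 0, 0, 0, -1; 0, 0, 1, 0]

/-- A symmetric matrix that is invariant under the standard complex structure. -/
lemma eq_of_stdComplex_invariant {r : Matrix (Fin 4) (Fin 4) ℝ} (hs : r.transpose = r)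
    (hJ : stdComplex.transpose * r * stdComplex = r) :
    r = !![r 0 0, 0, r 0 2, r 0 3; 0, r 0 0, -r 0 3, r 0 2;
      r 0 2, -r 0 3, r 2 2, 0; r 0 3, r 0 2, 0, r 2 2] := by
  have s : ∀ i j, r i j = r j i := fun i j ↦ by
    rw [← Matrix.transpose_apply r, hs]
  have e : ∀ i j, (stdComplex.transpose * r * stdComplex) i j = r i j := fun i j ↦ by rw [hJ]
  have h01 : r 0 1 = 0 := by
    have := e 0 1
    simp [stdComplex, Matrix.mul_apply, Fin.sum_univ_four] at this
    linarith [s 0 1]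
  have h23 : r 2 3 = 0 := by
    have := e 2 3
    simp [stdComplex, Matrix.mul_apply, Fin.sum_univ_four] at this
    linarith [s 2 3]
  have h11 : r 1 1 = r 0 0 := by
    have := e 0 0
    simpa [stdComplex, Matrix.mul_apply, Fin.sum_univ_four] using this
  have h33 : r 3 3 = r 2 2 := by
    have := e 2 2
    simpa [stdComplex, Matrix.mul_apply, Fin.sum_univ_four] using this
  have h13 : r 1 3 = r 0 2 := by
    have := e 0 2
    simpa [stdComplex, Matrix.mul_apply, Fin.sum_univ_four] using this
  have h12 : r 1 2 = -r 0 3 := by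
    have := e 0 3
    simp [stdComplex, Matrix.mul_apply, Fin.sum_univ_four] at this
    linarith
  ext i j
  fin_cases i <;> fin_cases j <;> simp [h01, h23, h11, h33, h13, h12, s 1 0, s 2 0, s 3 0, s 2 1,
    s 3 1, s 3 2]

/-- A `J`-invariant symmetric Codazzi tensor on a Kähler surface is parallel. Here `r m` is the
covariant derivative of the tensor in the direction `m`, in a unitary frame. -/
lemma eq_zero_of_codazzi {r : Fin 4 → Matrix (Fin 4) (Fin 4) ℝ}
    (hs : ∀ m, (r m).transpose = r m)
    (hJ : ∀ m, stdComplex.transpose * r m * stdComplex = r m)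
    (hc : ∀ i j l, r i j l = r j i l) (m : Fin 4) : r m = 0 := by
  have e : ∀ m i j, r m i j = !![r m 0 0, 0, r m 0 2, r m 0 3; 0, r m 0 0, -r m 0 3, r m 0 2;
      r m 0 2, -r m 0 3, r m 2 2, 0; r m 0 3, r m 0 2, 0, r m 2 2] i j := fun m i j ↦
    congrFun (congrFun (eq_of_stdComplex_invariant (hs m) (hJ m)) i) j
  have e11 : ∀ m, r m 1 1 = r m 0 0 := fun m ↦ by simpa using e m 1 1
  have e01 : ∀ m, r m 0 1 = 0 := fun m ↦ by simpa using e m 0 1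
  have e10 : ∀ m, r m 1 0 = 0 := fun m ↦ by simpa using e m 1 0
  have e23 : ∀ m, r m 2 3 = 0 := fun m ↦ by simpa using e m 2 3
  have e32 : ∀ m, r m 3 2 = 0 := fun m ↦ by simpa using e m 3 2
  have e33 : ∀ m, r m 3 3 = r m 2 2 := fun m ↦ by simpa using e m 3 3
  have e13 : ∀ m, r m 1 3 = r m 0 2 := fun m ↦ by simpa using e m 1 3
  have e12 : ∀ m, r m 1 2 = -r m 0 3 := fun m ↦ by simpa using e m 1 2
  have e20 : ∀ m, r m 2 0 = r m 0 2 := fun m ↦ by simpa using e m 2 0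
  have e30 : ∀ m, r m 3 0 = r m 0 3 := fun m ↦ by simpa using e m 3 0
  have e21 : ∀ m, r m 2 1 = -r m 0 3 := fun m ↦ by simpa using e m 2 1
  have e31 : ∀ m, r m 3 1 = r m 0 2 := fun m ↦ by simpa using e m 3 1
  have a : ∀ m, r m 0 0 = 0 ∧ r m 2 2 = 0 ∧ r m 0 2 = 0 ∧ r m 0 3 = 0 := by
    intro m
    fin_cases m <;> refine ⟨?_, ?_, ?_, ?_⟩ <;> simp only [Fin.zero_eta, Fin.mk_one,
      Fin.reduceFinMk] <;>
    linarith [hc 0 1 0, hc 0 1 1, hc 0 1 2, hc 0 1 3, hc 0 2 0, hc 0 2 1, hc 0 2 2, hc 0 2 3,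
      hc 0 3 0, hc 0 3 1, hc 0 3 2, hc 0 3 3, hc 1 2 0, hc 1 2 1, hc 1 2 2, hc 1 2 3,
      hc 1 3 0, hc 1 3 1, hc 1 3 2, hc 1 3 3, hc 2 3 0, hc 2 3 1, hc 2 3 2, hc 2 3 3,
      e11 0, e11 1, e11 2, e11 3, e01 0, e01 1, e01 2, e01 3, e10 0, e10 1, e10 2, e10 3,
      e23 0, e23 1, e23 2, e23 3, e32 0, e32 1, e32 2, e32 3, e33 0, e33 1, e33 2, e33 3,
      e13 0, e13 1, e13 2, e13 3, e12 0, e12 1, e12 2, e12 3, e20 0, e20 1, e20 2, e20 3,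
      e30 0, e30 1, e30 2, e30 3, e21 0, e21 1, e21 2, e21 3, e31 0, e31 1, e31 2, e31 3]
  ext i j
  obtain ⟨h1, h2, h3, h4⟩ := a m
  rw [e m i j, h1, h2, h3, h4]
  fin_cases i <;> fin_cases j <;> simp

/-- The contracted second Bianchi identity for a curvature tensor whose covariant derivative is
`-(1/2) g ∧ ∇ρ`. -/
lemma codazzi_of_bianchi {r : Fin 4 → Matrix (Fin 4) (Fin 4) ℝ}
    (hs : ∀ m, (r m).transpose = r m) (ht : ∀ m, (r m).trace = 0)
    (hb : ∀ m i j k l, kn 1 (r m) i j k l + kn 1 (r i) j m k l + kn 1 (r j) m i k l = 0)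
    (i j l : Fin 4) : r i j l = r j i l := by
  have s : ∀ m i j, r m i j = r m j i := fun m i j ↦ by
    rw [← Matrix.transpose_apply (r m), hs]
  have t : ∀ m, ∑ k, r m k k = 0 := ht
  -- the divergence of the tensor
  set d : Fin 4 → ℝ := fun j ↦ ∑ k, r k j k with hd
  have h1 : ∀ i j l, r i j l - r j i l
      = (if j = l then 1 else 0) * d i - (if i = l then 1 else 0) * d j := by
    intro i j l
    have h2 : ∑ k, (kn 1 (r k) i j k l + kn 1 (r i) j k k l + kn 1 (r j) k i k l) = 0 :=
      Finset.sum_eq_zero fun k _ ↦ hb k i j k l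
    simp only [kn, Matrix.one_apply, Finset.sum_add_distrib, Finset.sum_sub_distrib,
      ite_mul, mul_ite, one_mul, mul_one, zero_mul, mul_zero, Finset.sum_ite_eq,
      Finset.sum_ite_eq', Finset.mem_univ, if_true, Finset.sum_const, Finset.card_univ,
      Fintype.card_fin] at h2
    by_cases hjl : j = l <;> by_cases hil : i = l <;>
      simp only [hjl, hil, if_true, if_false, Finset.sum_const_zero, t, nsmul_eq_mul] at h2 ⊢ <;>
      push_cast at h2 <;> simp only [hd] <;> linarith
  have h4 : ∀ i, d i = 0 := by
    intro i
    have h5 : ∑ j, (r i j j - r j i j) = ∑ j : Fin 4, ((if j = j then 1 else 0) * d i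
        - (if i = j then 1 else 0) * d j) := Finset.sum_congr rfl fun j _ ↦ h1 i j j
    simp [Finset.sum_sub_distrib, t] at h5
    have : d i = ∑ k, r k i k := rfl
    linarith
  have := h1 i j l
  rw [h4, h4] at this
  linarith

/-- If the curvature operators of a Bochner flat Kähler surface of scalar curvature `τ` commute with
the Ricci operator `S`, then the square of the trace-free part `S - τ/4` is scalar, and `τ = 0`
unless `S - τ/4` vanishes. -/
lemma sq_traceFree_of_commute {S : Matrix (Fin 4) (Fin 4) ℝ} {τ : ℝ} (hs : S.transpose = S)
    (hJ : stdComplex.transpose * S * stdComplex = S) (ht : S.trace = τ)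
    (hF : ∀ i j, (Matrix.of fun l k ↦ -(1 / 2) * kn 1 S i j k l
      - τ / 48 * tri stdComplex 1 1 i j k l + τ / 8 * kn 1 1 i j k l) * S
      = S * Matrix.of fun l k ↦ -(1 / 2) * kn 1 S i j k l
      - τ / 48 * tri stdComplex 1 1 i j k l + τ / 8 * kn 1 1 i j k l) :
    (∃ c : ℝ, 0 ≤ c ∧ (c = 0 → S - (τ / 4) • 1 = 0) ∧
      (S - (τ / 4) • 1) * (S - (τ / 4) • 1) = c • 1) ∧ τ • (S - (τ / 4) • 1) = 0 := by
  have e := eq_of_stdComplex_invariant hs hJ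
  generalize S 0 0 = a at e
  generalize S 0 2 = b at e
  generalize S 0 3 = c at e
  generalize S 2 2 = d at e
  subst e
  simp [Matrix.trace, Fin.sum_univ_four] at ht
  obtain rfl : d = τ / 2 - a := by linarith
  -- three entries of the relations `[R(∂ᵢ,∂ⱼ), S] = 0`
  have key : τ * (a - τ / 4) = 0 ∧ τ * b = 0 ∧ τ * c = 0 := by
    have f1 := congrFun (congrFun (hF 0 2) 0) 2
    have f2 := congrFun (congrFun (hF 0 2) 0) 0
    have f5 := congrFun (congrFun (hF 0 1) 0) 2
    simp [Matrix.mul_apply, Fin.sum_univ_four, kn, tri, bar, stdComplex, Matrix.one_apply] at f1 f2 f5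
    ring_nf at f1 f2 f5
    exact ⟨by linarith, by linarith, by linarith⟩
  refine ⟨⟨(a - τ / 4) ^ 2 + b ^ 2 + c ^ 2, by positivity, fun h0 ↦ ?_, ?_⟩, ?_⟩
  · obtain rfl : b = 0 := by nlinarith [sq_nonneg (a - τ / 4), sq_nonneg b, sq_nonneg c]
    obtain rfl : c = 0 := by nlinarith [sq_nonneg (a - τ / 4), sq_nonneg c]
    obtain rfl : a = τ / 4 := by nlinarith [sq_nonneg (a - τ / 4)]
    ext i j
    fin_cases i <;> fin_cases j <;> simp <;> ring
  · ext i j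
    fin_cases i <;> fin_cases j <;> simp [Matrix.mul_apply, Fin.sum_univ_four] <;>
      ring
  · obtain ⟨h1, h2, h3⟩ := key
    rcases eq_or_ne τ 0 with h0 | h0
    · rw [h0, zero_smul]
    · obtain rfl : b = 0 := (mul_eq_zero.1 h2).resolve_left h0
      obtain rfl : c = 0 := (mul_eq_zero.1 h3).resolve_left h0
      obtain rfl : a = τ / 4 := sub_eq_zero.1 ((mul_eq_zero.1 h1).resolve_left h0)
      convert smul_zero τ
      ext i j
      fin_cases i <;> fin_cases j <;> simp <;> ring

/-- A unitary frame whose first and third vectors are given. -/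
lemma exists_frame {G J : Matrix (Fin 4) (Fin 4) ℝ} (hG : G.transpose = G) (hJ : J * J = -1)
    (hGJ : J.transpose * G * J = G) {v w : Fin 4 → ℝ} (hv : v ⬝ᵥ G.mulVec v = 1)
    (hw : w ⬝ᵥ G.mulVec w = 1) (h1 : v ⬝ᵥ G.mulVec w = 0) (h2 : J.mulVec v ⬝ᵥ G.mulVec w = 0)
    {E : Matrix (Fin 4) (Fin 4) ℝ}
    (hE : E = Matrix.transpose (Matrix.of ![v, J.mulVec v, w, J.mulVec w])) :
    E.transpose * G * E = 1 ∧ J * E = E * stdComplex := by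
  have hJJ : ∀ u, J.mulVec (J.mulVec u) = -u := fun u ↦ by
    rw [Matrix.mulVec_mulVec, hJ, Matrix.neg_mulVec, Matrix.one_mulVec]
  have hs : ∀ a b, a ⬝ᵥ G.mulVec b = b ⬝ᵥ G.mulVec a := fun a b ↦ by
    rw [Matrix.dotProduct_mulVec, ← Matrix.mulVec_transpose, hG, dotProduct_comm]
  have hi : ∀ a b, J.mulVec a ⬝ᵥ G.mulVec (J.mulVec b) = a ⬝ᵥ G.mulVec b := fun a b ↦ by
    conv_rhs => rw [← hGJ]
    rw [← Matrix.mulVec_mulVec, ← Matrix.mulVec_mulVec, Matrix.dotProduct_mulVec a,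
      Matrix.vecMul_transpose]
  have hi2 : ∀ a b, a ⬝ᵥ G.mulVec (J.mulVec b) = -(J.mulVec a ⬝ᵥ G.mulVec b) := fun a b ↦ by
    rw [← hi, hJJ, Matrix.mulVec_neg, dotProduct_neg]
  have hvv : v ⬝ᵥ G.mulVec (J.mulVec v) = 0 := by
    have := hi2 v v
    rw [hs (J.mulVec v) v] at this
    linarith
  have hww : w ⬝ᵥ G.mulVec (J.mulVec w) = 0 := by
    have := hi2 w w
    rw [hs (J.mulVec w) w] at this
    linarith
  constructor
  · have : ∀ i j, (E.transpose * G * E) i j = E.col i ⬝ᵥ G.mulVec (E.col j) := fun i j ↦ by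
      rw [Matrix.mul_assoc]
      rfl
    have hc : ∀ i, E.col i = ![v, J.mulVec v, w, J.mulVec w] i := fun i ↦ by
      rw [hE]; rfl
    ext i j
    rw [this, hc, hc]
    fin_cases i <;> fin_cases j <;>
      simp [-Matrix.mulVec_mulVec, hv, hw, h1, h2, hvv, hww, hi, hi2, hs (J.mulVec v) v, hs (J.mulVec w) w, hs w v,
        hs (J.mulVec w) v]
  · have hc : ∀ i, (J * E).col i = J.mulVec (E.col i) := fun i ↦ rfl
    have hJE : ∀ k j, (J * E) k j = J.mulVec (![v, J.mulVec v, w, J.mulVec w] j) k := fun k j ↦ by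
      rw [hE]; rfl
    have hEE : ∀ k j, E k j = ![v, J.mulVec v, w, J.mulVec w] j k := fun k j ↦ by rw [hE]; rfl
    ext k j
    rw [hJE, Matrix.mul_apply]
    simp only [hEE, Fin.sum_univ_four]
    fin_cases j <;> simp [stdComplex, hJJ]

/-- A nonzero vector can be scaled to unit length. -/
lemma exists_unit {G : Matrix (Fin 4) (Fin 4) ℝ} (hG : G.PosDef) {v : Fin 4 → ℝ} (hv : v ≠ 0) :
    ∃ c : ℝ, (c • v) ⬝ᵥ G.mulVec (c • v) = 1 := by
  have h := hG.dotProduct_mulVec_pos hv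
  rw [star_trivial] at h
  refine ⟨(√(v ⬝ᵥ G.mulVec v))⁻¹, ?_⟩
  rw [Matrix.mulVec_smul, smul_dotProduct, dotProduct_smul, smul_eq_mul, smul_eq_mul, ← mul_assoc,
    ← mul_inv, Real.mul_self_sqrt h.le, inv_mul_cancel₀ h.ne']

lemma exists_unitary_frame {G J : Matrix (Fin 4) (Fin 4) ℝ} (hG : G.PosDef) (hJ : J * J = -1)
    (hGJ : J.transpose * G * J = G) : ∃ E : Matrix (Fin 4) (Fin 4) ℝ,
    E.transpose * G * E = 1 ∧ J * E = E * stdComplex := by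
  obtain ⟨v, hc⟩ : ∃ v, v ⬝ᵥ G.mulVec v = 1 :=
    ⟨_, (exists_unit hG (v := Pi.single 0 1) (by simp)).choose_spec⟩
  -- a vector orthogonal to `v` and `J v`
  let L : (Fin 4 → ℝ) →ₗ[ℝ] (Fin 2 → ℝ) :=
    Matrix.mulVecLin (Matrix.of ![Matrix.vecMul v G, Matrix.vecMul (J.mulVec v) G])
  have hker : LinearMap.ker L ≠ ⊥ := LinearMap.ker_ne_bot_of_finrank_lt (by simp)
  obtain ⟨w, hw, hw0⟩ := (Submodule.ne_bot_iff _).1 hker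
  rw [LinearMap.mem_ker] at hw
  have hw1 : v ⬝ᵥ G.mulVec w = 0 := by
    rw [Matrix.dotProduct_mulVec]; exact congrFun hw 0
  have hw2 : J.mulVec v ⬝ᵥ G.mulVec w = 0 := by
    rw [Matrix.dotProduct_mulVec]; exact congrFun hw 1
  obtain ⟨b, hb⟩ := exists_unit hG hw0
  exact ⟨_, exists_frame (by simpa using hG.isHermitian.eq) hJ hGJ hc hb
    (by rw [Matrix.mulVec_smul, dotProduct_smul, hw1, smul_zero])
    (by rw [Matrix.mulVec_smul, dotProduct_smul, hw2, smul_zero]) rfl⟩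

end Pointwise

/-! ### The derivative of the Ricci tensor in a normal chart -/

section Normal

variable {n : ℕ} {U : Set (Coord n)} {G : MatField n} {x : Coord n}

lemma differentiableAt_kn {A B : MatField n} (hU : IsOpen U) (hx : x ∈ U) (hA : SmoothOn U A)
    (hB : SmoothOn U B) (i j k l : Fin n) :
    DifferentiableAt ℝ (fun y ↦ kn (A y) (B y) i j k l) x := by
  have key : ∀ a b c d e f p q : Coord n → ℝ, DifferentiableAt ℝ a x → DifferentiableAt ℝ b x →
      DifferentiableAt ℝ c x → DifferentiableAt ℝ d x → DifferentiableAt ℝ e x →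
      DifferentiableAt ℝ f x → DifferentiableAt ℝ p x → DifferentiableAt ℝ q x →
      DifferentiableAt ℝ (fun y ↦ a y * b y - c y * d y + e y * f y - p y * q y) x := by
    intros
    fun_prop
  have a := fun i j ↦ hA.diffAt hU hx i j
  have b := fun i j ↦ hB.diffAt hU hx i j
  exact key _ _ _ _ _ _ _ _ (a i k) (b j l) (a i l) (b j k) (b i k) (a j l) (b i l) (a j k)

lemma pd_kn {A B : MatField n} (hU : IsOpen U) (hx : x ∈ U) (hA : SmoothOn U A)
    (hB : SmoothOn U B) (m i j k l : Fin n) :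
    pd m (fun y ↦ kn (A y) (B y) i j k l) x
      = kn (pdM m A x) (B x) i j k l + kn (A x) (pdM m B x) i j k l := by
  have key : ∀ a b c d e f p q : Coord n → ℝ, DifferentiableAt ℝ a x → DifferentiableAt ℝ b x →
      DifferentiableAt ℝ c x → DifferentiableAt ℝ d x → DifferentiableAt ℝ e x →
      DifferentiableAt ℝ f x → DifferentiableAt ℝ p x → DifferentiableAt ℝ q x →
      pd m (fun y ↦ a y * b y - c y * d y + e y * f y - p y * q y) x
        = (pd m a x * b x + a x * pd m b x) - (pd m c x * d x + c x * pd m d x)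
          + (pd m e x * f x + e x * pd m f x) - (pd m p x * q x + p x * pd m q x) := by
    intro a b c d e f p q ha hb hc hd he hf hp hq
    rw [pd_sub (by fun_prop) (by fun_prop), pd_add (by fun_prop) (by fun_prop),
      pd_sub (by fun_prop) (by fun_prop), pd_mul ha hb, pd_mul hc hd, pd_mul he hf, pd_mul hp hq]
  have a := fun i j ↦ hA.diffAt hU hx i j
  have b := fun i j ↦ hB.diffAt hU hx i j
  refine (key _ _ _ _ _ _ _ _ (a i k) (b j l) (a i l) (b j k) (b i k) (a j l) (b i l)
    (a j k)).trans ?_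
  simp only [pdM, Matrix.of_apply, kn]
  ring

lemma kn_zero_left (B : Matrix (Fin n) (Fin n) ℝ) (i j k l : Fin n) : kn 0 B i j k l = 0 := by
  simp [kn]

lemma kn_zero_right (B : Matrix (Fin n) (Fin n) ℝ) (i j k l : Fin n) : kn B 0 i j k l = 0 := by
  simp [kn]

/-- The second Bianchi identity, at a point where the Christoffel symbols vanish. -/
lemma IsMetricOn.bianchi_second (h : IsMetricOn U G) (hx : x ∈ U) (h0 : ∀ i, gam G i x = 0)
    (m i j : Fin n) :
    pdM m (crv G i j) x + pdM i (crv G j m) x + pdM j (crv G m i) x = 0 := by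
  have hU := h.isOpen
  have hg := h.smooth_gam
  have key : ∀ m i j, pdM m (crv G i j) x
      = pdM m (fun y ↦ pdM i (gam G j) y) x - pdM m (fun y ↦ pdM j (gam G i) y) x := by
    intro m i j
    have s1 := (hg j).pdM hU i
    have s2 := (hg i).pdM hU j
    rw [pdM_congr hU hx fun y _ ↦ crv_eq G i j y,
      pdM_add hU hx (s1.sub s2) (((hg i).mul (hg j)).sub ((hg j).mul (hg i))),
      pdM_sub hU hx s1 s2, pdM_sub hU hx ((hg i).mul (hg j)) ((hg j).mul (hg i)),
      pdM_mul hU hx (hg i) (hg j), pdM_mul hU hx (hg j) (hg i)]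
    simp [h0]
  rw [key, key, key, pdM_comm hU hx (hg j) m i, pdM_comm hU hx (hg i) m j,
    pdM_comm hU hx (hg m) i j]
  abel

end Normal

section BochnerFlat

variable {U : Set (Coord 4)} {G J : MatField 4} {τ : ℝ} {x : Coord 4}

/-- At the centre of a normal chart all first derivatives of the metric and of the complex structure
vanish, so that the derivative of the curvature tensor is `-(1/2) g ∧ ∂ρ`; the second Bianchi
identity then makes `∂ρ` a `J`-invariant Codazzi tensor. -/
lemma IsBochnerFlatOn.pdM_ricci_eq_zero (h : IsBochnerFlatOn U G J τ) (hx : x ∈ U)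
    (h1 : G x = 1) (hJ : J x = stdComplex) (h0 : ∀ i, gam G i x = 0) (m : Fin 4) :
    pdM m (ricci G) x = 0 := by
  have hm := h.hermitian.isMetricOn
  have hU := hm.isOpen
  have sG := hm.smooth
  have sJ : SmoothOn U J := h.hermitian.contDiffOn_complex
  have sr := hm.smooth_ricci
  have dG : ∀ m, pdM m G x = 0 := fun m ↦ by simp [hm.pdM_metric hx, h0]
  have dJ : ∀ m, pdM m J x = 0 := fun m ↦ by
    simp [pdM_of_nablaJ_eq_zero m (h.parallel x hx m), h0]
  -- the derivative of the formula for the curvature tensor in terms of the Ricci tensor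
  have dF : ∀ m i j k l, pdM m (crv G i j) x l k = -(1 / 2) * kn 1 (pdM m (ricci G) x) i j k l := by
    intro m i j k l
    have e1 : pdM m (fun y ↦ G y * crv G i j y) x l k = pdM m (crv G i j) x l k := by
      rw [pdM_mul hU hx sG (hm.smooth_crv i j), dG, h1]
      simp
    have sGJ : SmoothOn U fun y ↦ G y * J y := sG.mul sJ
    have dGJ : pdM m (fun y ↦ G y * J y) x = 0 := by
      rw [pdM_mul hU hx sG sJ, dG, dJ]; simp
    have dGJ' : ∀ i j, pd m (fun y ↦ (G y * J y) i j) x = 0 := fun i j ↦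
      congrFun (congrFun dGJ i) j
    have d1 := sGJ.diffAt hU hx
    have key : ∀ a b c d e : Coord 4 → ℝ, DifferentiableAt ℝ a x → DifferentiableAt ℝ b x →
        DifferentiableAt ℝ c x → DifferentiableAt ℝ d x → DifferentiableAt ℝ e x →
        pd m (fun y ↦ -(1 / 2) * a y - τ / 48 * (b y + c y + 4 * (d y * e y)) + τ / 8 * b y) x
          = -(1 / 2) * pd m a x - τ / 48 * (pd m b x + pd m c x
            + 4 * (pd m d x * e x + d x * pd m e x)) + τ / 8 * pd m b x := by
      intro a b c d e ha hb hc hd he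
      rw [pd_add (by fun_prop) (by fun_prop), pd_sub (by fun_prop) (by fun_prop),
        pd_const_mul ha, pd_const_mul (by fun_prop), pd_const_mul hb,
        pd_add (by fun_prop) (by fun_prop), pd_add hb hc, pd_const_mul (by fun_prop),
        pd_mul hd he]
    have e2 : ∀ y ∈ U, (G y * crv G i j y) l k = -(1 / 2) * kn (G y) (ricci G y) i j k l
        - τ / 48 * (kn (G y) (G y) i j k l + kn (G y * J y) (G y * J y) i j k l
          + 4 * ((G y * J y) i j * (G y * J y) k l)) + τ / 8 * kn (G y) (G y) i j k l := by
      intro y hy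
      rw [← KahlerSurface.curv_eq hm hy, h.curv_eq hy, tri, bar_eq]
      ring
    rw [← e1]
    change pd m (fun y ↦ (G y * crv G i j y) l k) x = _
    rw [pd_congr hU hx e2]
    refine (key _ _ _ _ _ (differentiableAt_kn hU hx sG sr i j k l)
      (differentiableAt_kn hU hx sG sG i j k l) (differentiableAt_kn hU hx sGJ sGJ i j k l)
      (d1 i j) (d1 k l)).trans ?_
    rw [pd_kn hU hx sG sr, pd_kn hU hx sG sG, pd_kn hU hx sGJ sGJ, dGJ, dG, dGJ', dGJ', h1]
    simp only [kn_zero_left, kn_zero_right]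
    ring
  have hs : ∀ m, (pdM m (ricci G) x).transpose = pdM m (ricci G) x := fun m ↦ by
    rw [← pdM_transpose]
    exact pdM_congr hU hx (fun y hy ↦ hm.ricci_symm hy) m
  have hinv : ∀ m, stdComplex.transpose * pdM m (ricci G) x * stdComplex = pdM m (ricci G) x := by
    intro m
    have e := pdM_congr hU hx (fun y hy ↦ h.hermitian.twist_ricci h.parallel hy) m
    rw [pdM_mul hU hx (sJ.transpose.mul sr) sJ, pdM_mul hU hx sJ.transpose sr, pdM_transpose,
      dJ, hJ] at e
    simpa using e
  have ht : ∀ m, (pdM m (ricci G) x).trace = 0 := by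
    intro m
    have e : pd m (fun y ↦ ((G y)⁻¹ * ricci G y).trace) x = 0 := by
      rw [pd_congr hU hx fun y hy ↦ h.trace_eq hy, pd_const]
    rw [pd_trace hU hx (hm.smooth_inv.mul sr), pdM_mul hU hx hm.smooth_inv sr,
      pdM_inv hU hx sG fun y hy ↦ (hm.posDef y hy).det_pos.ne', dG, h1] at e
    simpa using e
  refine eq_zero_of_codazzi hs hinv (codazzi_of_bianchi hs ht fun m i j k l ↦ ?_) m
  have e := congrFun (congrFun (hm.bianchi_second hx h0 m i j) l) k
  simp only [Matrix.add_apply, dF, Matrix.zero_apply] at e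
  linarith

end BochnerFlat

/-! ### Normal charts -/

section NormalChart

lemma jac_congr {n : ℕ} {U : Set (Coord n)} (hU : IsOpen U) {h h' : Coord n → Coord n}
    (he : ∀ y ∈ U, h y = h' y) {y : Coord n} (hy : y ∈ U) : jac h y = jac h' y := by
  ext k i
  exact pd_congr hU hy (fun z hz ↦ by rw [he z hz]) i

/-- A quadratic change of coordinates that kills the connection matrices `Γ` at `y₀` and has the
Jacobian matrix `L` there. -/
def normalCoord {n : ℕ} (L : Matrix (Fin n) (Fin n) ℝ) (Γ : Fin n → Matrix (Fin n) (Fin n) ℝ)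
    (y₀ y : Coord n) : Coord n :=
  WithLp.toLp 2 fun k ↦ ∑ l, L k l *
    ((y l - y₀ l) + (1 / 2) * ∑ i, ∑ j, Γ i l j * ((y i - y₀ i) * (y j - y₀ j)))

lemma contDiff_normalCoord {n : ℕ} (L : Matrix (Fin n) (Fin n) ℝ)
    (Γ : Fin n → Matrix (Fin n) (Fin n) ℝ) (y₀ : Coord n) :
    ContDiff ℝ ∞ (normalCoord L Γ y₀) := by
  rw [contDiff_euclidean]
  intro k
  simp only [normalCoord]
  fun_prop

/-- At `y₀` the Jacobian matrix is `L`, and its derivative in the direction `j` is `L Γⱼ`; the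
transformation law of the connection then makes the new connection matrices vanish. -/
lemma jac_normalCoord {n : ℕ} (L : Matrix (Fin n) (Fin n) ℝ)
    {Γ : Fin n → Matrix (Fin n) (Fin n) ℝ} (hΓ : ∀ i j k, Γ i k j = Γ j k i) (y₀ y : Coord n) :
    jac (normalCoord L Γ y₀) y = L * (1 + ∑ j, (y j - y₀ j) • Γ j) := by
  ext k m
  have d1 : ∀ i, DifferentiableAt ℝ (fun y : Coord n ↦ y i - y₀ i) y := fun i ↦ by fun_prop
  have p1 : ∀ i, pd m (fun y : Coord n ↦ y i - y₀ i) y = if m = i then 1 else 0 := fun i ↦ by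
    rw [pd_sub (by fun_prop) (by fun_prop), pd_coord, pd_const, sub_zero]
  simp only [jac, Matrix.of_apply, normalCoord]
  rw [pd_sum _ (fun l _ ↦ by fun_prop), Matrix.mul_apply]
  refine Finset.sum_congr rfl fun l _ ↦ ?_
  rw [pd_const_mul (by fun_prop), pd_add (d1 l) (by fun_prop), p1, pd_const_mul (by fun_prop),
    pd_sum _ (fun i _ ↦ by fun_prop)]
  have p2 : ∀ i, pd m (fun y : Coord n ↦ ∑ j, Γ i l j * ((y i - y₀ i) * (y j - y₀ j))) y
      = (if m = i then ∑ j, Γ i l j * (y j - y₀ j) else 0) + Γ i l m * (y i - y₀ i) := by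
    intro i
    rw [pd_sum _ (fun j _ ↦ by fun_prop)]
    have : ∀ j, pd m (fun y : Coord n ↦ Γ i l j * ((y i - y₀ i) * (y j - y₀ j))) y
        = (if m = i then Γ i l j * (y j - y₀ j) else 0)
          + (if m = j then Γ i l j * (y i - y₀ i) else 0) := fun j ↦ by
      rw [pd_const_mul (by fun_prop), pd_mul (d1 i) (d1 j), p1, p1]
      split_ifs <;> ring
    simp only [this, Finset.sum_add_distrib, Finset.sum_ite_eq, Finset.mem_univ, if_true]
    congr 1
    split_ifs <;> simp
  simp only [p2, Finset.sum_add_distrib, Finset.sum_ite_eq, Finset.mem_univ, if_true,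
    Matrix.add_apply, Matrix.sum_apply, Matrix.smul_apply, smul_eq_mul, Matrix.one_apply]
  have p3 : ∀ j, Γ m l j * (y j - y₀ j) = (y j - y₀ j) * Γ j l m := fun j ↦ by
    rw [hΓ m j l, mul_comm]
  have p4 : ∀ j, Γ j l m * (y j - y₀ j) = (y j - y₀ j) * Γ j l m := fun j ↦ mul_comm _ _
  simp only [p3, p4, eq_comm (a := l)]
  ring

variable {M : Type*} [TopologicalSpace M] [ChartedSpace (Coord 4) M] [IsManifold (𝓡 4) ∞ M]
  {g : Metric M} {J : EndField M} {φ ψ : OpenPartialHomeomorph M (Coord 4)}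

/-- A map with invertible Jacobian matrix is locally a change of coordinates. -/
lemma exists_isometric_chart (g : Metric M) (J : EndField M)
    (hφ : φ ∈ IsManifold.maximalAtlas (𝓡 4) ∞ M) {U : Set (Coord 4)}
    (hU : IsOpen U) (hUφ : U ⊆ φ.target) {h : Coord 4 → Coord 4} (hh : ContDiffOn ℝ ∞ h U)
    (hd : ∀ y ∈ U, (jac h y).det ≠ 0) {y₀ : Coord 4} (hy₀ : y₀ ∈ U) :
    ∃ ψ ∈ IsManifold.maximalAtlas (𝓡 4) ∞ M, ∃ W ⊆ U, y₀ ∈ W ∧ φ.symm y₀ ∈ ψ.source ∧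
      ψ (φ.symm y₀) = h y₀ ∧
      IsIsometricOn W ψ.target (g.inChart φ) (g.inChart ψ) h ∧
      (∀ y ∈ W, jac h y * J.inChart φ y = J.inChart ψ (h y) * jac h y) ∧
      ∀ z ∈ ψ.target, ∃ y ∈ W, h y = z := by
  obtain ⟨ψ, hψ, hp, hs, hc⟩ := exists_chart_comp hφ hU hUφ hh hd hy₀
  have hWU : overlap φ ψ ⊆ U := fun y hy ↦ by
    have := (hc _ hy.2).1
    rwa [φ.right_inv hy.1] at this
  have he : ∀ y ∈ overlap φ ψ, transition φ ψ y = h y := fun y hy ↦ by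
    have := (hc _ hy.2).2
    rwa [φ.right_inv hy.1] at this
  have ho := isOpen_overlap φ ψ
  have H := isIsometricOn_transition g hφ hψ
  have hy₀' : y₀ ∈ overlap φ ψ := ⟨hUφ hy₀, hp⟩
  refine ⟨ψ, hψ, overlap φ ψ, hWU, hy₀', hp, he _ hy₀', ⟨H.source, H.target, hh.mono hWU,
    fun y hy ↦ he y hy ▸ H.mapsTo y hy, fun y hy ↦ ?_⟩, fun y hy ↦ ?_, fun z hz ↦ ?_⟩
  · rw [← he y hy, ← jac_congr ho he hy]
    exact H.metric_eq y hy
  · rw [← he y hy, ← jac_congr ho he hy]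
    exact jac_mul_complex_inChart J hφ hψ hy
  · have h1 := hc _ (ψ.map_target hz)
    have h2 : φ.symm (φ (ψ.symm z)) = ψ.symm z := φ.left_inv (hs (ψ.map_target hz))
    refine ⟨φ (ψ.symm z), ⟨hUφ h1.1, ?_⟩, ?_⟩
    · rw [Set.mem_preimage, h2]; exact ψ.map_target hz
    · rw [← h1.2, ψ.right_inv hz]

/-- Around every point there is a chart for which, at that point, the metric and the complex
structure are the standard ones and the Christoffel symbols vanish. -/
lemma exists_normal_chart (hK : IsKahler g J) (hφ : φ ∈ IsManifold.maximalAtlas (𝓡 4) ∞ M)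
    {y₀ : Coord 4} (hy₀ : y₀ ∈ φ.target) :
    ∃ ψ ∈ IsManifold.maximalAtlas (𝓡 4) ∞ M, ∃ (W : Set (Coord 4)) (h : Coord 4 → Coord 4),
      y₀ ∈ W ∧ IsIsometricOn W ψ.target (g.inChart φ) (g.inChart ψ) h ∧
      g.inChart ψ (h y₀) = 1 ∧ J.inChart ψ (h y₀) = stdComplex ∧
      ∀ i, gam (g.inChart ψ) i (h y₀) = 0 := by
  have hH := isAlmostHermitianOn_inChart hK hφ
  have hm := hH.isMetricOn
  obtain ⟨E, hE1, hE2⟩ := exists_unitary_frame (hH.posDef _ hy₀) (hH.sq_eq _ hy₀)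
    (hH.orthogonal _ hy₀)
  have hEdet : IsUnit E.det := by
    refine isUnit_iff_ne_zero.2 fun h0 ↦ ?_
    have := congrArg Matrix.det hE1
    simp [Matrix.det_mul, h0] at this
  set Γ : Fin 4 → Matrix (Fin 4) (Fin 4) ℝ := fun i ↦ gam (g.inChart φ) i y₀ with hΓ
  set h := normalCoord E⁻¹ Γ y₀ with hh
  have hj : ∀ y, jac h y = E⁻¹ * (1 + ∑ j, (y j - y₀ j) • Γ j) :=
    jac_normalCoord _ (fun i j k ↦ hm.gam_symm hy₀ i j k) y₀
  have hj0 : jac h y₀ = E⁻¹ := by simp [hj]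
  have hs : SmoothOn φ.target (jac h) :=
    SmoothOn.jac φ.open_target (contDiff_normalCoord _ _ _).contDiffOn
  set U : Set (Coord 4) := φ.target ∩ (fun y ↦ (jac h y).det) ⁻¹' {0}ᶜ
  have hU : IsOpen U := hs.det.continuousOn.isOpen_inter_preimage φ.open_target isOpen_compl_singleton
  have hE' : E⁻¹.det ≠ 0 := (Matrix.isUnit_nonsing_inv_det E hEdet).ne_zero
  obtain ⟨ψ, hψ, W, hWU, hyW, -, -, H, HJ, -⟩ := exists_isometric_chart g J hφ hU
    Set.inter_subset_left (contDiff_normalCoord E⁻¹ Γ y₀).contDiffOn (fun y hy ↦ hy.2)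
    (y₀ := y₀) ⟨hy₀, by simpa [hj0] using hE'⟩
  have e1 : E * E⁻¹ = 1 := Matrix.mul_nonsing_inv _ hEdet
  have e2 : E⁻¹ * E = 1 := Matrix.nonsing_inv_mul _ hEdet
  refine ⟨ψ, hψ, W, h, hyW, H, ?_, ?_, ?_⟩
  · have := H.metric_eq y₀ hyW
    rw [← hh, hj0] at this
    rw [this] at hE1
    calc g.inChart ψ (h y₀) = (E⁻¹ * E).transpose * g.inChart ψ (h y₀) * (E⁻¹ * E) := by
          rw [e2]; simp
      _ = 1 := by rw [← hE1, Matrix.transpose_mul]; simp only [Matrix.mul_assoc]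
  · have := HJ y₀ hyW
    rw [← hh, hj0] at this
    calc J.inChart ψ (h y₀) = J.inChart ψ (h y₀) * (E⁻¹ * E) := by rw [e2]; simp
      _ = E⁻¹ * (J.inChart φ y₀ * E) := by rw [← Matrix.mul_assoc, ← this, Matrix.mul_assoc]
      _ = stdComplex := by rw [hE2, ← Matrix.mul_assoc, e2, Matrix.one_mul]
  · -- the transformation law of the connection becomes `∑ₖ Aₖᵢ Γ'ₖ = 0`
    have hp : ∀ i, pullGam (g.inChart ψ) h i y₀ = 0 := by
      intro i
      have h1 := H.jac_mul_gam hyW i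
      have h2 : pdM i (jac h) y₀ = E⁻¹ * Γ i := by
        have hc : ∀ y ∈ (Set.univ : Set (Coord 4)), jac h y
            = E⁻¹ * (1 + ∑ j, (y j - y₀ j) • Γ j) := fun y _ ↦ hj y
        have s1 : ∀ j, ContDiffOn ℝ ∞ (fun y : Coord 4 ↦ y j - y₀ j) Set.univ := fun j ↦
          ContDiff.contDiffOn (by fun_prop)
        have s2 : ∀ j, SmoothOn Set.univ fun y : Coord 4 ↦ (y j - y₀ j) • Γ j := fun j ↦
          SmoothOn.smul (s1 j) (SmoothOn.const _)
        have s3 := SmoothOn.sum Finset.univ fun j _ ↦ s2 j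
        rw [pdM_congr isOpen_univ (Set.mem_univ _) hc, pdM_mul isOpen_univ (Set.mem_univ _)
          (SmoothOn.const _) ((SmoothOn.const _).add s3), pdM_const,
          pdM_add isOpen_univ (Set.mem_univ _) (SmoothOn.const _) s3, pdM_const,
          pdM_sum _ isOpen_univ (Set.mem_univ _) fun j _ ↦ s2 j]
        have p : ∀ j, pdM i (fun y : Coord 4 ↦ (y j - y₀ j) • Γ j) y₀
            = if i = j then Γ j else 0 := by
          intro j
          rw [pdM_smul isOpen_univ (Set.mem_univ _) (s1 j) (SmoothOn.const _), pdM_const,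
            pd_sub (by fun_prop) (by fun_prop), pd_coord, pd_const]
          split_ifs <;> simp
        simp [p]
      rw [← hh, h2, hj0, right_eq_add] at h1
      calc _ = pullGam (g.inChart ψ) h i y₀ * (E⁻¹ * E) := by rw [e2]; simp
        _ = 0 := by rw [← Matrix.mul_assoc, h1, Matrix.zero_mul]
    intro i
    have h3 : ∑ m, E m i • pullGam (g.inChart ψ) h m y₀ = gam (g.inChart ψ) i (h y₀) := by
      simp only [pullGam, hj0, Finset.smul_sum, smul_smul]
      rw [Finset.sum_comm]
      simp only [← Finset.sum_smul]
      have : ∀ k, ∑ m, E m i * E⁻¹ k m = if k = i then 1 else 0 := fun k ↦ by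
        rw [← Matrix.one_apply, ← e2, Matrix.mul_apply]
        exact Finset.sum_congr rfl fun _ _ ↦ mul_comm _ _
      simp [this]
    rw [← h3]
    simp [hp]

end NormalChart

/-! ### The Ricci operator -/

section RicciEnd

/-- The Ricci operator, that is, the endomorphism field `S` with `ρ(X,Y) = g(SX,Y)`. -/
def ricciEnd {n : ℕ} (G : MatField n) : MatField n := fun y ↦ (G y)⁻¹ * ricci G y

/-- The transformation law of the Ricci operator. -/
lemma IsIsometricOn.jac_mul_ricciEnd {n : ℕ} {U V : Set (Coord n)} {G G' : MatField n}
    {h : Coord n → Coord n} {x : Coord n} (H : IsIsometricOn U V G G' h) (hx : x ∈ U) :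
    jac h x * ricciEnd G x = ricciEnd G' (h x) * jac h x := by
  have hA : IsUnit (jac h x).det := isUnit_iff_ne_zero.2 (H.det_ne_zero hx)
  have hA' : IsUnit (jac h x).transpose.det := by rwa [Matrix.det_transpose]
  rw [ricciEnd, ricciEnd, H.ricci_eq hx, H.metric_eq x hx, Matrix.mul_inv_rev, Matrix.mul_inv_rev]
  simp only [← Matrix.mul_assoc]
  rw [Matrix.mul_nonsing_inv _ hA, Matrix.one_mul, Matrix.mul_assoc (G' (h x))⁻¹,
    Matrix.nonsing_inv_mul _ hA', Matrix.mul_one]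

lemma IsMetricOn.smooth_ricciEnd {n : ℕ} {U : Set (Coord n)} {G : MatField n}
    (h : IsMetricOn U G) : SmoothOn U (ricciEnd G) :=
  h.smooth_inv.mul h.smooth_ricci

variable {M : Type*} [TopologicalSpace M] [ChartedSpace (Coord 4) M] [IsManifold (𝓡 4) ∞ M]
  {g : Metric M} {J : EndField M} {φ : OpenPartialHomeomorph M (Coord 4)} {τ : ℝ}
  {y : Coord 4}

lemma isBochnerFlatOn_inChart (hK : IsKahler g J) (hB : IsBochnerFlat g J)
    (hτ : ∀ φ ∈ IsManifold.maximalAtlas (𝓡 4) ∞ M, ∀ y ∈ φ.target, scal (g.inChart φ) y = τ)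
    (hφ : φ ∈ IsManifold.maximalAtlas (𝓡 4) ∞ M) :
    IsBochnerFlatOn φ.target (g.inChart φ) (J.inChart φ) τ :=
  ⟨isAlmostHermitianOn_inChart hK hφ, hK.parallel φ hφ, hB φ hφ, hτ φ hφ⟩

/-- The Ricci tensor of a Bochner flat Kähler surface of constant scalar curvature is parallel. -/
lemma pdM_ricci_inChart (hK : IsKahler g J) (hB : IsBochnerFlat g J)
    (hτ : ∀ φ ∈ IsManifold.maximalAtlas (𝓡 4) ∞ M, ∀ y ∈ φ.target, scal (g.inChart φ) y = τ)
    (hφ : φ ∈ IsManifold.maximalAtlas (𝓡 4) ∞ M) (hy : y ∈ φ.target) (m : Fin 4) :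
    pdM m (ricci (g.inChart φ)) y = (gam (g.inChart φ) m y).transpose * ricci (g.inChart φ) y
      + ricci (g.inChart φ) y * gam (g.inChart φ) m y := by
  obtain ⟨ψ, hψ, W, h, hyW, H, h1, h2, h3⟩ := exists_normal_chart hK hφ hy
  have hF := isBochnerFlatOn_inChart hK hB hτ hψ
  have hz := H.mapsTo y hyW
  have hW := H.source.isOpen
  have d0 := hF.pdM_ricci_eq_zero hz h1 h2 h3
  have s1 : SmoothOn W fun y ↦ ricci (g.inChart ψ) (h y) :=
    H.target.smooth_ricci.comp H.smooth H.mapsTo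
  have s2 : SmoothOn W fun y ↦ (jac h y).transpose := H.smooth_jac.transpose
  have d1 : pdM m (fun y ↦ ricci (g.inChart ψ) (h y)) y = 0 := by
    rw [pdM_comp H.target.isOpen hz H.target.smooth_ricci (H.diffAt hyW)]
    simp [d0]
  have d2 : pdM m (jac h) y = jac h y * gam (g.inChart φ) m y := by
    rw [H.jac_mul_gam hyW, pullGam]
    simp [h3]
  rw [pdM_congr hW hyW (fun z hz ↦ H.ricci_eq hz), pdM_mul hW hyW (s2.mul s1) H.smooth_jac,
    pdM_mul hW hyW s2 s1, d1, pdM_transpose, d2, H.ricci_eq hyW]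
  simp only [Matrix.transpose_mul, Matrix.mul_zero, add_zero, Matrix.mul_assoc]

/-- The Ricci operator of a Bochner flat Kähler surface of constant scalar curvature is parallel. -/
lemma pdM_ricciEnd_inChart (hK : IsKahler g J) (hB : IsBochnerFlat g J)
    (hτ : ∀ φ ∈ IsManifold.maximalAtlas (𝓡 4) ∞ M, ∀ y ∈ φ.target, scal (g.inChart φ) y = τ)
    (hφ : φ ∈ IsManifold.maximalAtlas (𝓡 4) ∞ M) (hy : y ∈ φ.target) (m : Fin 4) :
    pdM m (ricciEnd (g.inChart φ)) y = ricciEnd (g.inChart φ) y * gam (g.inChart φ) m y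
      - gam (g.inChart φ) m y * ricciEnd (g.inChart φ) y := by
  have hm := (isAlmostHermitianOn_inChart hK hφ).isMetricOn
  have hU := hm.isOpen
  unfold ricciEnd
  rw [pdM_mul hU hy hm.smooth_inv hm.smooth_ricci, pdM_ricci_inChart hK hB hτ hφ hy,
    pdM_inv hU hy hm.smooth fun y hy ↦ (hm.posDef y hy).det_pos.ne', hm.pdM_metric hy]
  simp only [Matrix.mul_add, Matrix.add_mul, Matrix.mul_assoc, hm.mul_inv hy, Matrix.neg_mul]
  rw [← Matrix.mul_assoc (g.inChart φ y)⁻¹ (g.inChart φ y), hm.inv_mul hy]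
  simp only [Matrix.one_mul]
  abel

/-- The square of the trace-free Ricci operator is a nonnegative multiple of the identity, and the
scalar curvature vanishes where the trace-free Ricci operator does not. -/
lemma sq_traceFree_ricciEnd_inChart (hK : IsKahler g J) (hB : IsBochnerFlat g J)
    (hτ : ∀ φ ∈ IsManifold.maximalAtlas (𝓡 4) ∞ M, ∀ y ∈ φ.target, scal (g.inChart φ) y = τ)
    (hφ : φ ∈ IsManifold.maximalAtlas (𝓡 4) ∞ M) (hy : y ∈ φ.target) :
    (∃ c : ℝ, 0 ≤ c ∧ (c = 0 → ricciEnd (g.inChart φ) y - (τ / 4) • 1 = 0) ∧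
      (ricciEnd (g.inChart φ) y - (τ / 4) • 1) * (ricciEnd (g.inChart φ) y - (τ / 4) • 1) = c • 1) ∧
      τ • (ricciEnd (g.inChart φ) y - (τ / 4) • 1) = 0 := by
  obtain ⟨ψ, hψ, W, h, hyW, H, h1, h2, -⟩ := exists_normal_chart hK hφ hy
  have hF := isBochnerFlatOn_inChart hK hB hτ hψ
  have hz := H.mapsTo y hyW
  have hm := H.target
  have hS : ricciEnd (g.inChart ψ) (h y) = ricci (g.inChart ψ) (h y) := by
    rw [ricciEnd, h1]; simp
  have hc : ∀ i j, crv (g.inChart ψ) i j (h y) = Matrix.of fun l k ↦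
      -(1 / 2) * kn 1 (ricciEnd (g.inChart ψ) (h y)) i j k l
      - τ / 48 * tri stdComplex 1 1 i j k l + τ / 8 * kn 1 1 i j k l := by
    intro i j
    ext l k
    have := hF.curv_eq hz i j k l
    rw [KahlerSurface.curv_eq hm hz, h1, h2, Matrix.one_mul] at this
    rw [this, hS]
    rfl
  have key := sq_traceFree_of_commute (S := ricciEnd (g.inChart ψ) (h y)) (τ := τ)
    (by rw [hS, hm.ricci_symm hz])
    (by rw [hS, ← h2, hF.hermitian.twist_ricci hF.parallel hz])
    (hF.trace_eq hz)
    (fun i j ↦ by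
      rw [← hc]
      exact hm.crv_commute hm.smooth_ricciEnd
        (fun z hz i ↦ pdM_ricciEnd_inChart hK hB hτ hψ hz i) hz i j)
  have hA : IsUnit (jac h y).det := isUnit_iff_ne_zero.2 (H.det_ne_zero hyW)
  have e : jac h y * (ricciEnd (g.inChart φ) y - (τ / 4) • 1)
      = (ricciEnd (g.inChart ψ) (h y) - (τ / 4) • 1) * jac h y := by
    rw [Matrix.mul_sub, Matrix.sub_mul, H.jac_mul_ricciEnd hyW]
    simp
  have e2 : ricciEnd (g.inChart φ) y - (τ / 4) • 1
      = (jac h y)⁻¹ * ((ricciEnd (g.inChart ψ) (h y) - (τ / 4) • 1) * jac h y) := by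
    rw [← e, ← Matrix.mul_assoc, Matrix.nonsing_inv_mul _ hA, Matrix.one_mul]
  obtain ⟨⟨c, hc0, hc1, hc2⟩, hc3⟩ := key
  refine ⟨⟨c, hc0, fun h0 ↦ ?_, ?_⟩, ?_⟩
  · rw [e2, hc1 h0]; simp
  · generalize ricciEnd (g.inChart φ) y - (τ / 4) • 1 = X at *
    generalize ricciEnd (g.inChart ψ) (h y) - (τ / 4) • 1 = Y at *
    calc X * X = (jac h y)⁻¹ * (Y * (jac h y * X)) := by
          conv_lhs => rw [e2]
          rw [Matrix.mul_assoc, Matrix.mul_assoc, e2]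
      _ = c • 1 := by
          rw [e, ← Matrix.mul_assoc Y, hc2, Matrix.smul_mul, Matrix.one_mul, Matrix.mul_smul,
            Matrix.nonsing_inv_mul _ hA]
  · rw [e2, ← Matrix.mul_smul, ← Matrix.smul_mul, hc3]; simp

/-- The square of the trace-free Ricci operator is a constant multiple of the identity. -/
lemma exists_sq_traceFree_ricciEnd [ConnectedSpace M] (hK : IsKahler g J) (hB : IsBochnerFlat g J)
    (hτ : ∀ φ ∈ IsManifold.maximalAtlas (𝓡 4) ∞ M, ∀ y ∈ φ.target, scal (g.inChart φ) y = τ) :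
    ∃ c : ℝ, 0 ≤ c ∧ ∀ φ ∈ IsManifold.maximalAtlas (𝓡 4) ∞ M, ∀ y ∈ φ.target,
      (c = 0 → ricciEnd (g.inChart φ) y - (τ / 4) • 1 = 0) ∧
      (ricciEnd (g.inChart φ) y - (τ / 4) • 1) * (ricciEnd (g.inChart φ) y - (τ / 4) • 1)
        = c • 1 := by
  -- the trace of the square, in an arbitrary chart
  set q : OpenPartialHomeomorph M (Coord 4) → Coord 4 → ℝ := fun φ y ↦
    ((ricciEnd (g.inChart φ) y - (τ / 4) • 1)
      * (ricciEnd (g.inChart φ) y - (τ / 4) • 1)).trace with hq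
  -- this trace does not depend on the chart
  have q_inv : ∀ φ ∈ IsManifold.maximalAtlas (𝓡 4) ∞ M, ∀ ψ ∈ IsManifold.maximalAtlas (𝓡 4) ∞ M,
      ∀ p ∈ φ.source, p ∈ ψ.source → q φ (φ p) = q ψ (ψ p) := by
    intro φ hφ ψ hψ p hp hp'
    have H := isIsometricOn_transition g hφ hψ
    have hy : φ p ∈ overlap φ ψ := ⟨φ.map_source hp, by rwa [Set.mem_preimage, φ.left_inv hp]⟩
    have ht : transition φ ψ (φ p) = ψ p := by rw [transition, φ.left_inv hp]
    have hA : IsUnit (jac (transition φ ψ) (φ p)).det := isUnit_iff_ne_zero.2 (H.det_ne_zero hy)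
    have e := H.jac_mul_ricciEnd hy
    rw [ht] at e
    generalize jac (transition φ ψ) (φ p) = A at *
    simp only [hq]
    generalize ricciEnd (g.inChart φ) (φ p) = X at *
    generalize ricciEnd (g.inChart ψ) (ψ p) = Y at *
    have e1 : A * (X - (τ / 4) • 1) = (Y - (τ / 4) • 1) * A := by
      rw [Matrix.mul_sub, Matrix.sub_mul, e]; simp
    generalize X - (τ / 4) • 1 = X at *
    generalize Y - (τ / 4) • 1 = Y at *
    calc (X * X).trace = (A⁻¹ * (A * X * X)).trace := by
          rw [Matrix.mul_assoc A, ← Matrix.mul_assoc, Matrix.nonsing_inv_mul _ hA, Matrix.one_mul]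
      _ = (A⁻¹ * (Y * Y * A)).trace := by
          rw [e1, Matrix.mul_assoc Y, e1, Matrix.mul_assoc]
      _ = (Y * Y).trace := by
          rw [Matrix.trace_mul_comm, Matrix.mul_assoc, Matrix.mul_nonsing_inv _ hA, Matrix.mul_one]
  -- the trace of the square of a parallel endomorphism field has derivative zero
  have q_pd : ∀ φ ∈ IsManifold.maximalAtlas (𝓡 4) ∞ M, DifferentiableOn ℝ (q φ) φ.target ∧
      ∀ y ∈ φ.target, fderiv ℝ (q φ) y = 0 := by
    intro φ hφ
    have hm := (isAlmostHermitianOn_inChart hK hφ).isMetricOn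
    have hU := hm.isOpen
    have s0 : SmoothOn φ.target fun y ↦ ricciEnd (g.inChart φ) y - (τ / 4) • 1 :=
      hm.smooth_ricciEnd.sub (SmoothOn.const ((τ / 4) • 1))
    refine ⟨(s0.mul s0).trace.differentiableOn (by simp), fun y hy ↦ ?_⟩
    have hpd : ∀ i, pd i (q φ) y = 0 := by
      intro i
      have e : pdM i (fun y ↦ ricciEnd (g.inChart φ) y - (τ / 4) • 1) y
          = (ricciEnd (g.inChart φ) y - (τ / 4) • 1) * gam (g.inChart φ) i y
            - gam (g.inChart φ) i y * (ricciEnd (g.inChart φ) y - (τ / 4) • 1) := by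
        rw [pdM_sub hU hy hm.smooth_ricciEnd (SmoothOn.const ((τ / 4) • 1)), pdM_const,
          pdM_ricciEnd_inChart hK hB hτ hφ hy, Matrix.sub_mul, Matrix.mul_sub, Matrix.smul_mul,
          Matrix.mul_smul, Matrix.one_mul, Matrix.mul_one]
        abel
      rw [hq, pd_trace hU hy (s0.mul s0), pdM_mul hU hy s0 s0, e]
      generalize ricciEnd (g.inChart φ) y - (τ / 4) • 1 = X
      rw [Matrix.sub_mul, Matrix.mul_sub, Matrix.trace_add, Matrix.trace_sub, Matrix.trace_sub,
        Matrix.trace_mul_comm X (X * _), Matrix.trace_mul_comm X (_ * X)]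
      have e2 := Matrix.trace_mul_comm X (gam (g.inChart φ) i y * X)
      rw [← Matrix.mul_assoc] at e2
      linarith
    ext v
    rw [fderiv_apply_eq_sum_pd]
    simp [hpd]
  have hloc : IsLocallyConstant fun p : M ↦ q (chartAt (Coord 4) p) (chartAt (Coord 4) p p) := by
    rw [IsLocallyConstant.iff_eventually_eq]
    intro p
    set φ := chartAt (Coord 4) p
    have hφ : φ ∈ IsManifold.maximalAtlas (𝓡 4) ∞ M :=
      IsManifold.chart_mem_maximalAtlas p
    have hp : p ∈ φ.source := mem_chart_source (Coord 4) p
    obtain ⟨r, hr, hb⟩ := Metric.isOpen_iff.1 φ.open_target (φ p) (φ.map_source hp)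
    have hb' : IsOpen (φ.source ∩ φ ⁻¹' Metric.ball (φ p) r) :=
      φ.isOpen_inter_preimage Metric.isOpen_ball
    filter_upwards [hb'.mem_nhds ⟨hp, Metric.mem_ball_self hr⟩] with p' hp'
    have hφ' : chartAt (Coord 4) p' ∈ IsManifold.maximalAtlas (𝓡 4) ∞ M :=
      IsManifold.chart_mem_maximalAtlas p'
    rw [q_inv _ hφ' φ hφ p' (mem_chart_source (Coord 4) p') hp'.1]
    obtain ⟨h1, h2⟩ := q_pd φ hφ
    exact (Metric.isOpen_ball.is_const_of_fderiv_eq_zero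
      (convex_ball (φ p) r).isPreconnected (h1.mono hb) (fun y hy ↦ h2 y (hb hy)) hp'.2
      (Metric.mem_ball_self hr))
  obtain ⟨p₀⟩ : Nonempty M := inferInstance
  set c₀ := q (chartAt (Coord 4) p₀) (chartAt (Coord 4) p₀ p₀)
  have hconst : ∀ φ ∈ IsManifold.maximalAtlas (𝓡 4) ∞ M, ∀ y ∈ φ.target, q φ y = c₀ := by
    intro φ hφ y hy
    have h1 := q_inv φ hφ _ (IsManifold.chart_mem_maximalAtlas (φ.symm y)) (φ.symm y)
      (φ.map_target hy) (mem_chart_source (Coord 4) _)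
    rw [φ.right_inv hy] at h1
    rw [h1]
    exact hloc.apply_eq_of_preconnectedSpace _ _
  have key : ∀ φ ∈ IsManifold.maximalAtlas (𝓡 4) ∞ M, ∀ y ∈ φ.target, 0 ≤ c₀ / 4 ∧
      (c₀ / 4 = 0 → ricciEnd (g.inChart φ) y - (τ / 4) • 1 = 0) ∧
      (ricciEnd (g.inChart φ) y - (τ / 4) • 1) * (ricciEnd (g.inChart φ) y - (τ / 4) • 1)
        = (c₀ / 4) • 1 := by
    intro φ hφ y hy
    obtain ⟨⟨c, h1, h2, h3⟩, -⟩ := sq_traceFree_ricciEnd_inChart hK hB hτ hφ hy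
    have h4 : c = c₀ / 4 := by
      rw [← hconst φ hφ y hy, hq]
      simp only [h3, Matrix.trace_smul, Matrix.trace_one, Fintype.card_fin, smul_eq_mul]
      norm_num
    rw [← h4]
    exact ⟨h1, h2, h3⟩
  exact ⟨c₀ / 4, (key _ (IsManifold.chart_mem_maximalAtlas p₀) _ (mem_chart_target (Coord 4) p₀)).1,
    fun φ hφ y hy ↦ (key φ hφ y hy).2⟩

end RicciEnd

/-! ### The Einstein case: constant holomorphic sectional curvature -/

section Einstein

lemma sum_mul_form {n : ℕ} (A B : Matrix (Fin n) (Fin n) ℝ) (a b c d : Fin n → ℝ) :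
    ∑ i, ∑ j, ∑ k, ∑ l, A i k * B j l * a i * b j * c k * d l
      = (a ⬝ᵥ A.mulVec c) * (b ⬝ᵥ B.mulVec d) := by
  have h : ∀ (A : Matrix (Fin n) (Fin n) ℝ) (a c : Fin n → ℝ),
      a ⬝ᵥ A.mulVec c = ∑ i, ∑ k, a i * (A i k * c k) := fun A a c ↦ by
    simp only [dotProduct, Matrix.mulVec, Finset.mul_sum]
  rw [h, h, Finset.sum_mul_sum]
  refine Finset.sum_congr rfl fun i _ ↦ Finset.sum_congr rfl fun j _ ↦ ?_
  rw [Finset.sum_mul_sum]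
  exact Finset.sum_congr rfl fun k _ ↦ Finset.sum_congr rfl fun l _ ↦ by ring

/-- The value of a Kulkarni–Nomizu product on `(v, w, w, v)`. -/
lemma sum_kn {n : ℕ} (A B : Matrix (Fin n) (Fin n) ℝ) (v w : Fin n → ℝ) :
    ∑ i, ∑ j, ∑ k, ∑ l, kn A B i j k l * v i * w j * w k * v l
      = (v ⬝ᵥ A.mulVec w) * (w ⬝ᵥ B.mulVec v) - (v ⬝ᵥ A.mulVec v) * (w ⬝ᵥ B.mulVec w)
        + (v ⬝ᵥ B.mulVec w) * (w ⬝ᵥ A.mulVec v) - (v ⬝ᵥ B.mulVec v) * (w ⬝ᵥ A.mulVec w) := by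
  have h2 : ∀ (A B : Matrix (Fin n) (Fin n) ℝ), ∑ i, ∑ j, ∑ k, ∑ l,
      A i l * B j k * v i * w j * w k * v l = (v ⬝ᵥ A.mulVec v) * (w ⬝ᵥ B.mulVec w) := by
    intro A B
    rw [← sum_mul_form A B v w v w]
    refine Finset.sum_congr rfl fun i _ ↦ Finset.sum_congr rfl fun j _ ↦ ?_
    rw [Finset.sum_comm]
    exact Finset.sum_congr rfl fun k _ ↦ Finset.sum_congr rfl fun l _ ↦ by ring
  rw [← sum_mul_form A B v w w v, ← sum_mul_form B A v w w v, ← h2 A B, ← h2 B A]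
  simp only [← Finset.sum_sub_distrib, ← Finset.sum_add_distrib]
  refine Finset.sum_congr rfl fun i _ ↦ Finset.sum_congr rfl fun j _ ↦
    Finset.sum_congr rfl fun k _ ↦ Finset.sum_congr rfl fun l _ ↦ ?_
  rw [kn]
  ring

/-- If the Ricci operator is `τ/4`, then the curvature tensor is `-(τ/48) g △ g`, the curvature
tensor of constant holomorphic sectional curvature `τ/6`. -/
lemma IsBochnerFlatOn.holSectCurv_eq {U : Set (Coord 4)} {G J : MatField 4} {τ : ℝ} {x : Coord 4}
    (h : IsBochnerFlatOn U G J τ) (hx : x ∈ U) (hS : ricciEnd G x - (τ / 4) • 1 = 0)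
    {v : Fin 4 → ℝ} (hv : v ≠ 0) : holSectCurv G J x v = τ / 6 := by
  have hm := h.hermitian.isMetricOn
  have hr : ricci G x = (τ / 4) • G x := by
    calc ricci G x = G x * ricciEnd G x := by
          rw [ricciEnd, ← Matrix.mul_assoc, hm.mul_inv hx, Matrix.one_mul]
      _ = _ := by rw [sub_eq_zero.1 hS, Matrix.mul_smul, Matrix.mul_one]
  have hc : ∀ i j k l, curv G x i j k l = -(τ / 48) * (kn (G x) (G x) i j k l
      + kn (G x * J x) (G x * J x) i j k l + 4 * ((G x * J x) i j * (G x * J x) k l)) := by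
    intro i j k l
    rw [h.curv_eq hx, hr, tri, bar_eq]
    simp only [kn, Matrix.smul_apply, smul_eq_mul]
    ring
  set w := (J x).mulVec v with hw
  set N := v ⬝ᵥ (G x).mulVec v with hN
  have hNpos : 0 < N := by simpa using (hm.posDef x hx).dotProduct_mulVec_pos hv
  have hJJ : (J x).mulVec w = -v := by
    rw [hw, Matrix.mulVec_mulVec, h.hermitian.sq_eq x hx, Matrix.neg_mulVec, Matrix.one_mulVec]
  have hs : ∀ a b, a ⬝ᵥ (G x).mulVec b = b ⬝ᵥ (G x).mulVec a := fun a b ↦ by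
    rw [Matrix.dotProduct_mulVec, ← Matrix.mulVec_transpose, hm.transpose hx, dotProduct_comm]
  have hi : ∀ a b, (J x).mulVec a ⬝ᵥ (G x).mulVec ((J x).mulVec b) = a ⬝ᵥ (G x).mulVec b := by
    intro a b
    conv_rhs => rw [← h.hermitian.orthogonal x hx]
    rw [← Matrix.mulVec_mulVec, ← Matrix.mulVec_mulVec, Matrix.dotProduct_mulVec a,
      Matrix.vecMul_transpose]
  have hww : w ⬝ᵥ (G x).mulVec w = N := hi v v
  have hvw : v ⬝ᵥ (G x).mulVec w = 0 := by
    have := hi v w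
    rw [hJJ, ← hw, Matrix.mulVec_neg, dotProduct_neg, hs w v] at this
    linarith
  have hwv : w ⬝ᵥ (G x).mulVec v = 0 := by rw [hs, hvw]
  have b1 : v ⬝ᵥ (G x * J x).mulVec v = 0 := by rw [← Matrix.mulVec_mulVec, ← hw, hvw]
  have b2 : v ⬝ᵥ (G x * J x).mulVec w = -N := by
    rw [← Matrix.mulVec_mulVec, hJJ, Matrix.mulVec_neg, dotProduct_neg]
  have b3 : w ⬝ᵥ (G x * J x).mulVec v = N := by rw [← Matrix.mulVec_mulVec, ← hw, hww]
  have s1 := sum_kn (G x) (G x) v w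
  have s2 := sum_kn (G x * J x) (G x * J x) v w
  have s3 : ∑ i, ∑ j, ∑ k, ∑ l, (G x * J x) i j * (G x * J x) k l * v i * w j * w k * v l
      = (v ⬝ᵥ (G x * J x).mulVec w) * (w ⬝ᵥ (G x * J x).mulVec v) := by
    rw [← sum_mul_form (G x * J x) (G x * J x) v w w v]
    refine Finset.sum_congr rfl fun i _ ↦ ?_
    rw [Finset.sum_comm]
    exact Finset.sum_congr rfl fun k _ ↦ Finset.sum_congr rfl fun j _ ↦
      Finset.sum_congr rfl fun l _ ↦ by ring
  rw [hvw, hwv, hww, ← hN] at s1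
  rw [b1, b2, b3] at s2
  rw [b2, b3] at s3
  have hden : ∑ i, ∑ j, G x i j * v i * v j = N := by
    simp only [hN, dotProduct, Matrix.mulVec, Finset.mul_sum]
    exact Finset.sum_congr rfl fun i _ ↦ Finset.sum_congr rfl fun j _ ↦ by ring
  have hnum : ∑ i, ∑ j, ∑ k, ∑ l, curv G x i j k l * v i * w j * w k * v l = τ / 6 * N ^ 2 := by
    have : ∀ i j k l, curv G x i j k l * v i * w j * w k * v l
        = -(τ / 48) * (kn (G x) (G x) i j k l * v i * w j * w k * v l)
          + -(τ / 48) * (kn (G x * J x) (G x * J x) i j k l * v i * w j * w k * v l)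
          + -(τ / 12) * ((G x * J x) i j * (G x * J x) k l * v i * w j * w k * v l) := by
      intro i j k l
      rw [hc]
      ring
    simp only [this, Finset.sum_add_distrib, ← Finset.mul_sum, s1, s2, s3]
    ring
  rw [holSectCurv, hden, ← hw, hnum]
  field_simp

end Einstein

/-! ### Splittings of the tangent bundle -/

section Splitting

variable {n : ℕ} {U : Set (Coord n)} {G : MatField n} {T : Fin 2 → MatField n} {κ : Fin 2 → ℝ}
  {y : Coord n}

/-- The parallel orthogonal projections `T 0` and `T 1` split the tangent bundle of `(U, G)`, and
the curvature tensor is the sum of curvature tensors of constant curvatures `κ 0` and `κ 1` on the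
two summands. -/
structure IsSplittingOn (U : Set (Coord n)) (G : MatField n) (T : Fin 2 → MatField n)
    (κ : Fin 2 → ℝ) : Prop where
  metric : IsMetricOn U G
  smooth : ∀ s, SmoothOn U (T s)
  mul_self : ∀ y ∈ U, ∀ s, T s y * T s y = T s y
  mul_of_ne : ∀ y ∈ U, ∀ s t, s ≠ t → T s y * T t y = 0
  symm : ∀ y ∈ U, ∀ s, (T s y).transpose * G y = G y * T s y
  parallel : ∀ y ∈ U, ∀ s m, pdM m (T s) y = T s y * gam G m y - gam G m y * T s y
  crv_eq : ∀ y ∈ U, ∀ i j a b, crv G i j y a b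
    = ∑ s, κ s * (T s y a i * (G y * T s y) j b - T s y a j * (G y * T s y) i b)

/-- The coefficients of the linear system `∂ᵢ v = -Γᵢ v - ∑ₛ κₛ fₛ Tₛ ∂ᵢ`,
`∂ᵢ fₛ = g(∂ᵢ, Tₛ v)` for a vector field `v` and two functions `f₀`, `f₁`. -/
def splitSystem (G : MatField n) (T : Fin 2 → MatField n) (κ : Fin 2 → ℝ) (i : Fin n)
    (y : Coord n) : Matrix (Fin n ⊕ Fin 2) (Fin n ⊕ Fin 2) ℝ :=
  Matrix.fromBlocks (-gam G i y) (Matrix.of fun a s ↦ -κ s * T s y a i)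
    (Matrix.of fun s b ↦ (G y * T s y) i b) 0

lemma IsSplittingOn.smooth_metric_mul (h : IsSplittingOn U G T κ) (s : Fin 2) :
    SmoothOn U fun y ↦ G y * T s y :=
  h.metric.smooth.mul (h.smooth s)

lemma IsSplittingOn.pdM_metric_mul (h : IsSplittingOn U G T κ) (hy : y ∈ U) (s : Fin 2)
    (m : Fin n) : pdM m (fun y ↦ G y * T s y) y
      = (gam G m y).transpose * (G y * T s y) + G y * T s y * gam G m y := by
  rw [pdM_mul h.metric.isOpen hy h.metric.smooth (h.smooth s), h.metric.pdM_metric hy,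
    h.parallel y hy]
  simp only [Matrix.add_mul, Matrix.mul_sub, Matrix.mul_assoc]
  abel

lemma IsSplittingOn.smooth_splitSystem (h : IsSplittingOn U G T κ) (i : Fin n)
    (a b : Fin n ⊕ Fin 2) : ContDiffOn ℝ ∞ (fun y ↦ splitSystem G T κ i y a b) U := by
  rcases a with a | s <;> rcases b with b | t
  · exact (h.metric.smooth_gam i a b).neg
  · exact contDiffOn_const.mul (h.smooth t a i)
  · exact h.smooth_metric_mul s i b
  · exact contDiffOn_const

/-- The integrability condition of `splitSystem`. Its four blocks are, in order, the curvature
formula `crv_eq`, the parallelism of `T` together with the symmetry of the Christoffel symbols (twice), and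
the symmetry of `g(T·, ·)` together with `T₀ T₁ = 0`. -/
lemma IsSplittingOn.flat_splitSystem (h : IsSplittingOn U G T κ) (hy : y ∈ U) (i j : Fin n)
    (a b : Fin n ⊕ Fin 2) :
    pd j (fun z ↦ splitSystem G T κ i z a b) y
        + (splitSystem G T κ i y * splitSystem G T κ j y) a b
      = pd i (fun z ↦ splitSystem G T κ j z a b) y
        + (splitSystem G T κ j y * splitSystem G T κ i y) a b := by
  have hU := h.metric.isOpen
  have hsymm : ∀ i j k, gam G i y k j = gam G j y k i := h.metric.gam_symm hy
  simp only [splitSystem, Matrix.fromBlocks_multiply]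
  rcases a with a | s <;> rcases b with b | t
  · simp only [Matrix.fromBlocks_apply₁₁, Matrix.add_apply, Matrix.neg_apply, pd_neg]
    have h1 := h.crv_eq y hy i j a b
    rw [KahlerSurface.crv_eq] at h1
    simp only [Matrix.add_apply, Matrix.sub_apply, pdM, Matrix.of_apply] at h1
    simp only [neg_mul_neg]
    have h2 : ∀ i j, (Matrix.of (fun a s ↦ -κ s * T s y a i)
        * Matrix.of (fun s b ↦ (G y * T s y) j b) : Matrix (Fin n) (Fin n) ℝ) a b
        = ∑ s, -κ s * T s y a i * (G y * T s y) j b := fun i j ↦ rfl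
    rw [h2, h2]
    have h3 : ∑ s, κ s * (T s y a i * (G y * T s y) j b - T s y a j * (G y * T s y) i b)
        = ∑ s, -κ s * T s y a j * (G y * T s y) i b
          - ∑ s, -κ s * T s y a i * (G y * T s y) j b := by
      rw [← Finset.sum_sub_distrib]
      exact Finset.sum_congr rfl fun s _ ↦ by ring
    rw [h3] at h1
    linarith
  · simp only [Matrix.fromBlocks_apply₁₂, Matrix.mul_zero, Matrix.of_apply,
      add_zero]
    have hp : ∀ i j, pd j (fun z ↦ -κ t * T t z a i) y
        = -κ t * ((T t y * gam G j y) a i - (gam G j y * T t y) a i) := fun i j ↦ by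
      rw [pd_const_mul ((h.smooth t).diffAt hU hy a i)]
      congr 1
      exact congrFun (congrFun (h.parallel y hy t j) a) i
    have h1 : (T t y * gam G j y) a i = (T t y * gam G i y) a j := by
      simp only [Matrix.mul_apply, hsymm j i]
    have h2 : ∀ i j, (-gam G i y * Matrix.of fun a s ↦ -κ s * T s y a j) a t
        = κ t * (gam G i y * T t y) a j := fun i j ↦ by
      simp only [Matrix.mul_apply, Matrix.of_apply, Matrix.neg_apply, Finset.mul_sum]
      exact Finset.sum_congr rfl fun c _ ↦ by ring
    rw [hp, hp, h2, h2, h1]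
    ring
  · simp only [Matrix.fromBlocks_apply₂₁, Matrix.zero_mul, Matrix.of_apply, add_zero]
    have hp : ∀ i j, pd j (fun z ↦ (G z * T s z) i b) y
        = ((gam G j y).transpose * (G y * T s y)) i b + (G y * T s y * gam G j y) i b :=
      fun i j ↦ congrFun (congrFun (h.pdM_metric_mul hy s j) i) b
    have h1 : ((gam G j y).transpose * (G y * T s y)) i b
        = ((gam G i y).transpose * (G y * T s y)) j b := by
      rw [Matrix.mul_apply, Matrix.mul_apply]
      simp only [Matrix.transpose_apply, hsymm j i]
    have h2 : ∀ i j, ((Matrix.of fun s b ↦ (G y * T s y) i b) * -gam G j y) s b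
        = -(G y * T s y * gam G j y) i b := fun i j ↦ by
      rw [Matrix.mul_neg, Matrix.neg_apply]
      rfl
    rw [hp, hp, h2, h2, h1]
    ring
  · simp only [Matrix.fromBlocks_apply₂₂, Matrix.zero_mul, Matrix.zero_apply, add_zero]
    have h2 : ∀ i j, ((Matrix.of fun s b ↦ (G y * T s y) i b)
        * Matrix.of fun a s ↦ -κ s * T s y a j) s t = -κ t * (G y * (T s y * T t y)) i j := by
      intro i j
      rw [← Matrix.mul_assoc, Matrix.mul_apply (M := G y * T s y), Finset.mul_sum]
      rw [Matrix.mul_apply]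
      exact Finset.sum_congr rfl fun c _ ↦ by simp only [Matrix.of_apply]; ring
    rw [h2, h2]
    rcases eq_or_ne s t with rfl | hst
    · have h3 : (G y * T s y) i j = (G y * T s y) j i := by
        rw [← Matrix.transpose_apply (G y * T s y), Matrix.transpose_mul,
          h.metric.transpose hy, h.symm y hy]
      rw [h.mul_self y hy, h3]
      simp [pd_const]
    · rw [h.mul_of_ne y hy s t hst]
      simp [pd_const]

/-- A function `f` and a vector field `u` on one of the two factors with `grad f = u` and
`∇u = -κ f`, of prescribed value `u(y₀) = v₀` and with `f(y₀) = 0`. -/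
lemma IsSplittingOn.exists_coord (h : IsSplittingOn U G T κ) {y₀ : Coord n} (hy₀ : y₀ ∈ U)
    {s : Fin 2} {v₀ : Fin n → ℝ} (hv₀ : (T s y₀).mulVec v₀ = v₀) :
    ∃ (W : Set (Coord n)) (f : Coord n → ℝ) (u : Coord n → Fin n → ℝ), IsOpen W ∧ y₀ ∈ W ∧ W ⊆ U ∧
      ContDiffOn ℝ ∞ f W ∧ (∀ a, ContDiffOn ℝ ∞ (fun y ↦ u y a) W) ∧ f y₀ = 0 ∧ u y₀ = v₀ ∧
      (∀ y ∈ W, (T s y).mulVec (u y) = u y) ∧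
      (∀ y ∈ W, ∀ i, pd i f y = (G y).mulVec (u y) i) ∧
      ∀ y ∈ W, ∀ i a, pd i (fun z ↦ u z a) y
        = -(gam G i y).mulVec (u y) a - κ s * f y * T s y a i := by
  obtain ⟨W, σ, hW, hyW, hWU, h0, hσ, hpd⟩ := exists_flat_solution h.metric.isOpen hy₀
    h.smooth_splitSystem (fun y hy i j a b ↦ h.flat_splitSystem hy i j a b) (Sum.elim v₀ 0)
  have hpv : ∀ y ∈ W, ∀ i a, pd i (σ (Sum.inl a)) y = -(∑ b, gam G i y a b * σ (Sum.inl b) y)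
      - ∑ t, κ t * T t y a i * σ (Sum.inr t) y := by
    intro y hy i a
    rw [hpd y hy, Fintype.sum_sum_type]
    simp [splitSystem, Finset.sum_neg_distrib]
    ring
  have hpf : ∀ y ∈ W, ∀ i, pd i (σ (Sum.inr s)) y = ∑ b, (G y * T s y) i b * σ (Sum.inl b) y := by
    intro y hy i
    rw [hpd y hy, Fintype.sum_sum_type]
    simp [splitSystem]
  refine ⟨W, σ (Sum.inr s), fun y ↦ (T s y).mulVec fun b ↦ σ (Sum.inl b) y, hW, hyW, hWU, hσ _,
    fun a ↦ ?_, by simp [h0], ?_, fun y hy ↦ ?_, fun y hy i ↦ ?_, fun y hy i a ↦ ?_⟩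
  · simp only [Matrix.mulVec, dotProduct]
    exact ContDiffOn.sum fun b _ ↦ ((h.smooth s a b).mono hWU).mul (hσ _)
  · simp only [h0, Sum.elim_inl]
    exact hv₀
  · rw [Matrix.mulVec_mulVec, h.mul_self y (hWU hy)]
  · rw [hpf y hy, Matrix.mulVec_mulVec]
    rfl
  · have hT : SmoothOn W (T s) := (h.smooth s).mono hWU
    have hd : ∀ b, DifferentiableAt ℝ (σ (Sum.inl b)) y := fun b ↦
      ContDiffOn.differentiableAt_of_isOpen (hσ _) hW hy
    simp only [Matrix.mulVec, dotProduct]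
    have e1 : ∀ b, pd i (fun z ↦ T s z a b * σ (Sum.inl b) z) y
        = (T s y * gam G i y - gam G i y * T s y) a b * σ (Sum.inl b) y
          + T s y a b * (-(∑ c, gam G i y b c * σ (Sum.inl c) y)
            - ∑ t, κ t * T t y b i * σ (Sum.inr t) y) := fun b ↦ by
      rw [pd_mul (hT.diffAt hW hy a b) (hd b), hpv y hy, ← h.parallel y (hWU hy)]
      rfl
    rw [pd_sum (f := fun b z ↦ T s z a b * σ (Sum.inl b) z) _
      fun b _ ↦ (hT.diffAt hW hy a b).mul (hd b)]
    simp only [e1]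
    set v : Fin n → ℝ := fun b ↦ σ (Sum.inl b) y with hv
    have e2 : ∀ t, ∑ b, T s y a b * (κ t * T t y b i * σ (Sum.inr t) y)
        = κ t * σ (Sum.inr t) y * (T s y * T t y) a i := fun t ↦ by
      rw [Matrix.mul_apply, Finset.mul_sum]
      exact Finset.sum_congr rfl fun b _ ↦ by ring
    have e3 : ∑ b, T s y a b * ∑ t, κ t * T t y b i * σ (Sum.inr t) y
        = κ s * σ (Sum.inr s) y * T s y a i := by
      simp only [Finset.mul_sum]
      rw [Finset.sum_comm]
      simp only [e2]
      rw [Finset.sum_eq_single s, h.mul_self y (hWU hy)]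
      · intro t _ hts
        rw [h.mul_of_ne y (hWU hy) s t hts.symm]
        simp
      · simp
    have e4 : ∑ b, (T s y * gam G i y - gam G i y * T s y) a b * v b
        = (T s y * gam G i y).mulVec v a - (gam G i y * T s y).mulVec v a := by
      rw [← Pi.sub_apply, ← Matrix.sub_mulVec]
      rfl
    have e5 : ∑ b, T s y a b * ∑ c, gam G i y b c * v c = (T s y * gam G i y).mulVec v a := by
      rw [← Matrix.mulVec_mulVec]
      rfl
    have e6 : ∑ b, gam G i y a b * ∑ c, T s y b c * v c = (gam G i y * T s y).mulVec v a := by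
      rw [← Matrix.mulVec_mulVec]
      rfl
    simp only [Finset.sum_add_distrib, mul_sub, mul_neg, Finset.sum_sub_distrib,
      Finset.sum_neg_distrib, e3]
    rw [e6]
    simp only [hv] at e4 e5
    rw [e4, e5]
    ring

end Splitting

/-! ### Product coordinates -/

section Gram

variable {n : ℕ} {U : Set (Coord n)} {G : MatField n} {T : Fin 2 → MatField n} {κ : Fin 2 → ℝ}
  {y : Coord n}

lemma pd_dotProduct {u w : Coord n → Fin n → ℝ} (hu : ∀ a, DifferentiableAt ℝ (fun z ↦ u z a) y)
    (hw : ∀ a, DifferentiableAt ℝ (fun z ↦ w z a) y) (i : Fin n) :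
    pd i (fun z ↦ u z ⬝ᵥ w z) y = (fun a ↦ pd i (fun z ↦ u z a) y) ⬝ᵥ w y
      + u y ⬝ᵥ fun a ↦ pd i (fun z ↦ w z a) y := by
  simp only [dotProduct]
  rw [pd_sum (f := fun a z ↦ u z a * w z a) _ fun a _ ↦ (hu a).mul (hw a),
    ← Finset.sum_add_distrib]
  exact Finset.sum_congr rfl fun a _ ↦ pd_mul (hu a) (hw a) i

lemma pd_mulVec {A : MatField n} {u : Coord n → Fin n → ℝ}
    (hA : ∀ a b, DifferentiableAt ℝ (fun z ↦ A z a b) y)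
    (hu : ∀ a, DifferentiableAt ℝ (fun z ↦ u z a) y) (i a : Fin n) :
    pd i (fun z ↦ (A z).mulVec (u z) a) y = (pdM i A y).mulVec (u y) a
      + (A y).mulVec (fun b ↦ pd i (fun z ↦ u z b) y) a :=
  pd_dotProduct (u := fun z ↦ A z a) (hA a) hu i

/-- The functions `g(u, u') + κ f f'` are constant. -/
lemma IsSplittingOn.gram_eq (h : IsSplittingOn U G T κ) {W : Set (Coord n)} (hW : IsOpen W)
    (hWU : W ⊆ U) (hWc : IsPreconnected W) {s : Fin 2} {f f' : Coord n → ℝ}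
    {u u' : Coord n → Fin n → ℝ} (hf : ContDiffOn ℝ ∞ f W) (hf' : ContDiffOn ℝ ∞ f' W)
    (hu : ∀ a, ContDiffOn ℝ ∞ (fun y ↦ u y a) W) (hu' : ∀ a, ContDiffOn ℝ ∞ (fun y ↦ u' y a) W)
    (hTu : ∀ y ∈ W, (T s y).mulVec (u y) = u y) (hTu' : ∀ y ∈ W, (T s y).mulVec (u' y) = u' y)
    (hpf : ∀ y ∈ W, ∀ i, pd i f y = (G y).mulVec (u y) i)
    (hpf' : ∀ y ∈ W, ∀ i, pd i f' y = (G y).mulVec (u' y) i)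
    (hpu : ∀ y ∈ W, ∀ i a, pd i (fun z ↦ u z a) y
        = -(gam G i y).mulVec (u y) a - κ s * f y * T s y a i)
    (hpu' : ∀ y ∈ W, ∀ i a, pd i (fun z ↦ u' z a) y
        = -(gam G i y).mulVec (u' y) a - κ s * f' y * T s y a i)
    {y₀ : Coord n} (hy₀ : y₀ ∈ W) (hy : y ∈ W) :
    u y ⬝ᵥ (G y).mulVec (u' y) + κ s * (f y * f' y)
      = u y₀ ⬝ᵥ (G y₀).mulVec (u' y₀) + κ s * (f y₀ * f' y₀) := by
  have hG : SmoothOn W G := h.metric.smooth.mono hWU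
  have hGu : ∀ a, ContDiffOn ℝ ∞ (fun y ↦ (G y).mulVec (u' y) a) W := fun a ↦ by
    simp only [Matrix.mulVec, dotProduct]
    exact ContDiffOn.sum fun b _ ↦ (hG a b).mul (hu' b)
  have hsm : ContDiffOn ℝ ∞ (fun y ↦ u y ⬝ᵥ (G y).mulVec (u' y) + κ s * (f y * f' y)) W := by
    refine ContDiffOn.add ?_ (contDiffOn_const.mul (hf.mul hf'))
    simp only [dotProduct]
    exact ContDiffOn.sum fun a _ ↦ (hu a).mul (hGu a)
  have key : ∀ y ∈ W, ∀ i,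
      pd i (fun y ↦ u y ⬝ᵥ (G y).mulVec (u' y) + κ s * (f y * f' y)) y = 0 := by
    intro y hy i
    have df := ContDiffOn.differentiableAt_of_isOpen hf hW hy
    have df' := ContDiffOn.differentiableAt_of_isOpen hf' hW hy
    have du := fun a ↦ ContDiffOn.differentiableAt_of_isOpen (hu a) hW hy
    have du' := fun a ↦ ContDiffOn.differentiableAt_of_isOpen (hu' a) hW hy
    have dGu := fun a ↦ ContDiffOn.differentiableAt_of_isOpen (hGu a) hW hy
    have d1 : DifferentiableAt ℝ (fun y ↦ u y ⬝ᵥ (G y).mulVec (u' y)) y := by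
      simp only [dotProduct]
      exact DifferentiableAt.fun_sum fun a _ ↦ (du a).mul (dGu a)
    have d2 : DifferentiableAt ℝ (fun y ↦ f y * f' y) y := df.mul df'
    rw [pd_add d1 (d2.const_mul _), pd_const_mul d2, pd_mul df df',
      pd_dotProduct du dGu, hpf y hy, hpf' y hy]
    have e1 : (fun a ↦ pd i (fun z ↦ u z a) y)
        = -(gam G i y).mulVec (u y) - (κ s * f y) • (T s y).transpose i := by
      ext a
      rw [hpu y hy]
      rfl
    have e1' : (fun a ↦ pd i (fun z ↦ u' z a) y)
        = -(gam G i y).mulVec (u' y) - (κ s * f' y) • (T s y).transpose i := by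
      ext a
      rw [hpu' y hy]
      rfl
    have e2 : (fun a ↦ pd i (fun z ↦ (G z).mulVec (u' z) a) y)
        = (gam G i y).transpose.mulVec ((G y).mulVec (u' y))
          - (κ s * f' y) • (G y).mulVec ((T s y).transpose i) := by
      ext a
      rw [pd_mulVec (fun a b ↦ hG.diffAt hW hy a b) du', e1', h.metric.pdM_metric (hWU hy),
        Matrix.add_mulVec, Matrix.mulVec_sub, Matrix.mulVec_neg, Matrix.mulVec_smul,
        Matrix.mulVec_mulVec, Matrix.mulVec_mulVec]
      simp only [Pi.add_apply, Pi.sub_apply, Pi.neg_apply]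
      ring
    have hs : ∀ a b, a ⬝ᵥ (G y).mulVec b = b ⬝ᵥ (G y).mulVec a := fun a b ↦ by
      rw [Matrix.dotProduct_mulVec, ← Matrix.mulVec_transpose, h.metric.transpose (hWU hy),
        dotProduct_comm]
    have e3 : ∀ v, (T s y).mulVec v = v →
        (T s y).transpose i ⬝ᵥ (G y).mulVec v = (G y).mulVec v i := fun v hv ↦ by
      calc (T s y).transpose i ⬝ᵥ (G y).mulVec v
          = (T s y).transpose.mulVec ((G y).mulVec v) i := rfl
        _ = (G y).mulVec ((T s y).mulVec v) i := by
            rw [Matrix.mulVec_mulVec, h.symm y (hWU hy), Matrix.mulVec_mulVec]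
        _ = _ := by rw [hv]
    rw [e1, e2, sub_dotProduct, dotProduct_sub, smul_dotProduct, dotProduct_smul, neg_dotProduct,
      hs (u y), e3 _ (hTu y hy), e3 _ (hTu' y hy), Matrix.dotProduct_mulVec (u y),
      Matrix.vecMul_transpose]
    simp only [smul_eq_mul]
    ring
  refine hW.is_const_of_fderiv_eq_zero hWc (hsm.differentiableOn (by simp)) (fun y hy ↦ ?_) hy hy₀
  ext v
  rw [fderiv_apply_eq_sum_pd]
  simp [key y hy]

/-- The two factors of a splitting are orthogonal. -/
lemma IsSplittingOn.gram_eq_zero (h : IsSplittingOn U G T κ) (hy : y ∈ U) {s t : Fin 2}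
    (hst : s ≠ t) {v w : Fin n → ℝ} (hv : (T s y).mulVec v = v) (hw : (T t y).mulVec w = w) :
    v ⬝ᵥ (G y).mulVec w = 0 := by
  calc v ⬝ᵥ (G y).mulVec w = (T s y).mulVec v ⬝ᵥ (G y).mulVec ((T t y).mulVec w) := by rw [hv, hw]
    _ = v ⬝ᵥ (G y).mulVec ((T s y * T t y).mulVec w) := by
        rw [← Matrix.vecMul_transpose, ← Matrix.dotProduct_mulVec, Matrix.mulVec_mulVec,
          Matrix.mulVec_mulVec, Matrix.mulVec_mulVec, ← Matrix.mul_assoc, h.symm y hy,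
          Matrix.mul_assoc]
    _ = 0 := by rw [h.mul_of_ne y hy s t hst]; simp

end Gram

section BlockDiag

lemma blockDiag_mul (A D A' D' : Matrix (Fin 2) (Fin 2) ℝ) :
    blockDiag A D * blockDiag A' D' = blockDiag (A * A') (D * D') := by
  ext i j
  fin_cases i <;> fin_cases j <;>
    simp [blockDiag, Matrix.mul_apply, Fin.sum_univ_four, Fin.sum_univ_two]

lemma blockDiag_one : blockDiag 1 1 = 1 := by
  ext i j
  fin_cases i <;> fin_cases j <;> simp [blockDiag]

/-- The matrix `1 - K x xᵀ`, the inverse of `modelMetric K x`. -/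
def modelGram (K : ℝ) (x : Coord 2) : Matrix (Fin 2) (Fin 2) ℝ :=
  Matrix.of fun i j ↦ (if i = j then 1 else 0) - K * (x i * x j)

lemma modelGram_mul_modelMetric {K : ℝ} {x : Coord 2} (hx : x ∈ modelSet K) :
    modelGram K x * modelMetric K x = 1 := by
  have hD : modelDisc K x ≠ 0 := ne_of_gt hx
  have h2 : K * (x 0 ^ 2 + x 1 ^ 2) = 1 - modelDisc K x := by simp [modelDisc]
  ext i j
  simp only [modelGram, modelMetric, Matrix.mul_apply, Matrix.of_apply, Fin.sum_univ_two]
  fin_cases i <;> fin_cases j <;> simp <;> field_simp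
  · linear_combination (-K * x 0 * x 0) * h2
  · linear_combination (-K * x 0 * x 1) * h2
  · linear_combination (-K * x 0 * x 1) * h2
  · linear_combination (-K * x 1 * x 1) * h2

/-- A rotation by a right angle for `modelMetric K` is determined by its orientation. -/
lemma eq_neg_sqrt_modelDisc {K θ : ℝ} {x : Coord 2} (hx : x ∈ modelSet K) (hθ : θ < 0)
    (hJ : (θ • (!![0, 1; -1, 0] * modelMetric K x)) * (θ • (!![0, 1; -1, 0] * modelMetric K x))
      = -1) : θ = -√(modelDisc K x) := by
  have hD : 0 < modelDisc K x := hx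
  have h1 := det_modelMetric hx
  rw [Matrix.det_fin_two] at h1
  have h2 := congrFun (congrFun hJ 0) 0
  simp [Matrix.mul_apply, Fin.sum_univ_two, Matrix.vecMul, dotProduct] at h2
  have h3 : θ ^ 2 * (modelDisc K x)⁻¹ = 1 := by
    rw [← h1, modelMetric_symm K x 1 0]
    rw [modelMetric_symm K x 1 0] at h2
    linear_combination -h2
  have h4 : modelDisc K x = (-θ) ^ 2 := by
    field_simp at h3
    linarith
  rw [h4, Real.sqrt_sq (by linarith), neg_neg]

end BlockDiag

section ProductMap

variable {U : Set (Coord 4)} {G J : MatField 4} {T : Fin 2 → MatField 4} {κ : Fin 2 → ℝ}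

/-- The map `H` to the product of the two model surfaces whose components are the four functions
whose gradients are the columns of `V`; the first two are tangent to the first factor and the
last two to the second factor. -/
lemma IsSplittingOn.exists_product_map (h : IsSplittingOn U G T κ)
    (hH : IsAlmostHermitianOn U G J) (hc : ∀ y ∈ U, ∀ s, T s y * J y = J y * T s y)
    {y₀ : Coord 4} (hy₀ : y₀ ∈ U) {v w : Fin 4 → ℝ} (hv : v ⬝ᵥ (G y₀).mulVec v = 1)
    (hw : w ⬝ᵥ (G y₀).mulVec w = 1) (hTv : (T 0 y₀).mulVec v = v) (hTw : (T 1 y₀).mulVec w = w) :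
    ∃ (W : Set (Coord 4)) (H : Coord 4 → Coord 4) (V : MatField 4) (θ : Fin 2 → Coord 4 → ℝ),
      IsOpen W ∧ y₀ ∈ W ∧ W ⊆ U ∧ ContDiffOn ℝ ∞ H W ∧ H y₀ = 0 ∧ ∀ y ∈ W,
        jac H y = (V y).transpose * G y ∧
        (V y).transpose * G y * V y
          = blockDiag (modelGram (κ 0) (fstPair (H y))) (modelGram (κ 1) (sndPair (H y))) ∧
        (V y).transpose * (G y * J y) * V y
          = blockDiag (θ 0 y • !![0, 1; -1, 0]) (θ 1 y • !![0, 1; -1, 0]) ∧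
        fstPair (H y) ∈ modelSet (κ 0) ∧ sndPair (H y) ∈ modelSet (κ 1) ∧ θ 0 y < 0 ∧ θ 1 y < 0 := by
  have hm := h.metric
  set e₀ : Fin 4 → Fin 4 → ℝ := ![v, (J y₀).mulVec v, w, (J y₀).mulVec w] with he₀
  let σ : Fin 4 → Fin 2 := ![0, 0, 1, 1]
  -- the factors are complex lines
  have hTJ : ∀ y ∈ U, ∀ s v, (T s y).mulVec v = v →
      (T s y).mulVec ((J y).mulVec v) = (J y).mulVec v := by
    intro y hy s v hv
    rw [Matrix.mulVec_mulVec, hc y hy, ← Matrix.mulVec_mulVec, hv]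
  have hTe : ∀ a, (T (σ a) y₀).mulVec (e₀ a) = e₀ a := by
    intro a
    fin_cases a
    · exact hTv
    · exact hTJ y₀ hy₀ 0 v hTv
    · exact hTw
    · exact hTJ y₀ hy₀ 1 w hTw
  have h01 : (0 : Fin 2) ≠ 1 := by decide
  have hgram₀ : ∀ a b, e₀ a ⬝ᵥ (G y₀).mulVec (e₀ b) = if a = b then 1 else 0 := by
    have hE := (exists_frame (hm.transpose hy₀) (hH.sq_eq y₀ hy₀) (hH.orthogonal y₀ hy₀) hv hw
      (h.gram_eq_zero hy₀ h01 hTv hTw) (h.gram_eq_zero hy₀ h01 (hTJ y₀ hy₀ 0 v hTv) hTw) rfl).1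
    intro a b
    have := congrFun (congrFun hE a) b
    rw [Matrix.one_apply] at this
    rw [← this, Matrix.mul_assoc]
    rfl
  -- the coordinate functions, with gradients that extend the frame `e₀`
  choose W f u hWo hyW hWU hf hu hf0 hu0 hTu hpf hpu using fun a ↦ h.exists_coord hy₀ (hTe a)
  have hWi : IsOpen (⋂ a, W a) := isOpen_iInter_of_finite hWo
  obtain ⟨r, hr, hrW⟩ := Metric.isOpen_iff.1 hWi y₀ (Set.mem_iInter.2 hyW)
  set B := Metric.ball y₀ r
  have hB : IsOpen B := Metric.isOpen_ball
  have hy₀B : y₀ ∈ B := Metric.mem_ball_self hr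
  have hBW : ∀ a, B ⊆ W a := fun a ↦ hrW.trans (Set.iInter_subset W a)
  have hBU : B ⊆ U := (hBW 0).trans (hWU 0)
  -- the Gram matrix of the gradients, from its value at `y₀`
  have hgram : ∀ y ∈ B, ∀ a b, u a y ⬝ᵥ (G y).mulVec (u b y)
      = if σ a = σ b then (if a = b then 1 else 0) - κ (σ a) * (f a y * f b y) else 0 := by
    intro y hy a b
    by_cases hab : σ a = σ b
    · have hTb : ∀ y ∈ B, (T (σ a) y).mulVec (u b y) = u b y := fun y hy ↦ by
        rw [hab]; exact hTu b y (hBW b hy)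
      have hpb : ∀ y ∈ B, ∀ i c, pd i (fun z ↦ u b z c) y
          = -(gam G i y).mulVec (u b y) c - κ (σ a) * f b y * T (σ a) y c i := fun y hy i c ↦ by
        rw [hab]; exact hpu b y (hBW b hy) i c
      have e := h.gram_eq hB hBU (convex_ball y₀ r).isPreconnected ((hf a).mono (hBW a))
        ((hf b).mono (hBW b)) (fun c ↦ (hu a c).mono (hBW a)) (fun c ↦ (hu b c).mono (hBW b))
        (fun y hy ↦ hTu a y (hBW a hy)) hTb (fun y hy ↦ hpf a y (hBW a hy))
        (fun y hy ↦ hpf b y (hBW b hy)) (fun y hy ↦ hpu a y (hBW a hy)) hpb hy₀B hy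
      rw [hu0, hu0, hgram₀, hf0, hf0] at e
      rw [if_pos hab]
      linarith
    · rw [if_neg hab]
      exact h.gram_eq_zero (hBU hy) hab (hTu a y (hBW a hy)) (hTu b y (hBW b hy))
  set V : MatField 4 := fun y ↦ Matrix.of fun i a ↦ u a y i with hV
  set H : Coord 4 → Coord 4 := fun y ↦ WithLp.toLp 2 fun a ↦ f a y with hHdef
  set θ : Fin 2 → Coord 4 → ℝ := ![fun y ↦ u 0 y ⬝ᵥ (G y * J y).mulVec (u 1 y),
    fun y ↦ u 2 y ⬝ᵥ (G y * J y).mulVec (u 3 y)] with hθ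
  have hform : ∀ (A : MatField 4) y a b, ((V y).transpose * A y * V y) a b
      = u a y ⬝ᵥ (A y).mulVec (u b y) := by
    intro A y a b
    rw [Matrix.mul_assoc]
    rfl
  have hθs : ∀ a b, ContDiffOn ℝ ∞ (fun y ↦ u a y ⬝ᵥ (G y * J y).mulVec (u b y)) B := by
    intro a b
    have hu' : ∀ a i, ContDiffOn ℝ ∞ (fun y ↦ u a y i) B := fun a i ↦ (hu a i).mono (hBW a)
    have hGJ : SmoothOn B fun y ↦ G y * J y :=
      (SmoothOn.mul hH.contDiffOn_metric hH.contDiffOn_complex).mono hBU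
    simp only [Matrix.mulVec, dotProduct]
    exact ContDiffOn.sum fun i _ ↦ (hu' a i).mul (ContDiffOn.sum fun j _ ↦ (hGJ i j).mul (hu' b j))
  have hHs : ContDiffOn ℝ ∞ H B := contDiffOn_euclidean.2 fun a ↦ (hf a).mono (hBW a)
  have hH0 : H y₀ = 0 := by
    ext a
    exact hf0 a
  -- the neighbourhood is chosen so that the orientations of the two factors do not change
  set F : Coord 4 → ℝ := fun y ↦ min (min (modelDisc (κ 0) (fstPair (H y)))
    (modelDisc (κ 1) (sndPair (H y)))) (min (-θ 0 y) (-θ 1 y)) with hF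
  have hFc : ContinuousOn F B := by
    have hc' : ∀ a, ContinuousOn (fun y ↦ f a y) B := fun a ↦ ((hf a).mono (hBW a)).continuousOn
    refine ContinuousOn.inf (ContinuousOn.inf ?_ ?_) (ContinuousOn.inf ?_ ?_)
    · simp only [modelDisc, fstPair, hHdef]
      exact continuousOn_const.sub (continuousOn_const.mul (((hc' 0).pow 2).add ((hc' 1).pow 2)))
    · simp only [modelDisc, sndPair, hHdef]
      exact continuousOn_const.sub (continuousOn_const.mul (((hc' 2).pow 2).add ((hc' 3).pow 2)))
    · exact (hθs 0 1).continuousOn.neg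
    · exact (hθs 2 3).continuousOn.neg
  have hθ0 : ∀ a b, e₀ b = (J y₀).mulVec (e₀ a) →
      u a y₀ ⬝ᵥ (G y₀ * J y₀).mulVec (u b y₀) = -1 := by
    intro a b hab
    rw [hu0, hu0, hab, ← Matrix.mulVec_mulVec, Matrix.mulVec_mulVec _ (J y₀), hH.sq_eq y₀ hy₀,
      Matrix.neg_mulVec, Matrix.one_mulVec, Matrix.mulVec_neg, dotProduct_neg, hgram₀, if_pos rfl]
  have hF0 : 0 < F y₀ := by
    have t0 : θ 0 y₀ = -1 := hθ0 0 1 rfl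
    have t1 : θ 1 y₀ = -1 := hθ0 2 3 rfl
    simp only [hF, hH0, t0, t1]
    simp [modelDisc, fstPair, sndPair]
  refine ⟨B ∩ F ⁻¹' Set.Ioi 0, H, V, θ, hFc.isOpen_inter_preimage hB isOpen_Ioi, ⟨hy₀B, hF0⟩,
    fun y hy ↦ hBU hy.1, hHs.mono Set.inter_subset_left, hH0, fun y hy ↦ ?_⟩
  obtain ⟨hyB, hyF⟩ := hy
  have hyU := hBU hyB
  simp only [Set.mem_preimage, Set.mem_Ioi, hF, lt_min_iff, neg_pos] at hyF
  refine ⟨?_, ?_, ?_, hyF.1.1, hyF.1.2, hyF.2.1, hyF.2.2⟩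
  · ext a i
    have h1 : ((V y).transpose * G y) a i = (G y).mulVec (u a y) i := by
      rw [← hm.transpose hyU, Matrix.mulVec_transpose, hm.transpose hyU]
      rfl
    rw [h1, ← hpf a y (hBW a hyB)]
    rfl
  · ext a b
    rw [hform G, hgram y hyB]
    fin_cases a <;> fin_cases b <;> simp [σ, blockDiag, modelGram, fstPair, sndPair, hHdef]
  · have hJt := hH.transpose_complex_mul hyU
    have hanti : ∀ a b, u a y ⬝ᵥ (G y * J y).mulVec (u b y)
        = -(u b y ⬝ᵥ (G y * J y).mulVec (u a y)) := by
      intro a b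
      rw [Matrix.dotProduct_mulVec, ← Matrix.mulVec_transpose, Matrix.transpose_mul,
        hm.transpose hyU, hJt, Matrix.neg_mulVec, neg_dotProduct, dotProduct_comm]
    have hself : ∀ a, u a y ⬝ᵥ (G y * J y).mulVec (u a y) = 0 := fun a ↦ by
      linarith [hanti a a]
    have hzero : ∀ a b, σ a ≠ σ b → u a y ⬝ᵥ (G y * J y).mulVec (u b y) = 0 := by
      intro a b hab
      rw [← Matrix.mulVec_mulVec]
      exact h.gram_eq_zero hyU hab (hTu a y (hBW a hyB)) (hTJ y hyU _ _ (hTu b y (hBW b hyB)))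
    ext a b
    rw [hform fun y ↦ G y * J y]
    have e01 : u 0 y ⬝ᵥ (G y * J y).mulVec (u 1 y) = θ 0 y := rfl
    have e23 : u 2 y ⬝ᵥ (G y * J y).mulVec (u 3 y) = θ 1 y := rfl
    have e10 : u 1 y ⬝ᵥ (G y * J y).mulVec (u 0 y) = -θ 0 y := hanti 1 0
    have e32 : u 3 y ⬝ᵥ (G y * J y).mulVec (u 2 y) = -θ 1 y := hanti 3 2
    fin_cases a <;> fin_cases b <;> simp [blockDiag, hself, e01, e23, e10, e32,
      hzero 0 2 h01, hzero 0 3 h01, hzero 1 2 h01, hzero 1 3 h01, hzero 2 0 h01.symm,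
      hzero 2 1 h01.symm, hzero 3 0 h01.symm, hzero 3 1 h01.symm]

end ProductMap

section Product

variable {M : Type*} [TopologicalSpace M] [ChartedSpace (Coord 4) M] [IsManifold (𝓡 4) ∞ M]
  {g : Metric M} {J : EndField M} {φ : OpenPartialHomeomorph M (Coord 4)}

lemma isAlmostHermitianOn_mono {n : ℕ} {U V : Set (Coord n)} {G J : MatField n}
    (h : IsAlmostHermitianOn U G J) (hV : IsOpen V) (hVU : V ⊆ U) : IsAlmostHermitianOn V G J :=
  ⟨hV, fun i j ↦ (h.contDiffOn_metric i j).mono hVU, fun i j ↦ (h.contDiffOn_complex i j).mono hVU,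
    fun x hx ↦ h.posDef x (hVU hx), fun x hx ↦ h.sq_eq x (hVU hx),
    fun x hx ↦ h.orthogonal x (hVU hx)⟩

lemma blockDiag_injective {A D A' D' : Matrix (Fin 2) (Fin 2) ℝ}
    (h : blockDiag A D = blockDiag A' D') : A = A' ∧ D = D' := by
  constructor
  · ext i j
    fin_cases i <;> fin_cases j
    · exact congrFun (congrFun h 0) 0
    · exact congrFun (congrFun h 0) 1
    · exact congrFun (congrFun h 1) 0
    · exact congrFun (congrFun h 1) 1
  · ext i j
    fin_cases i <;> fin_cases j
    · exact congrFun (congrFun h 2) 2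
    · exact congrFun (congrFun h 2) 3
    · exact congrFun (congrFun h 3) 2
    · exact congrFun (congrFun h 3) 3

lemma modelGram_transpose (K : ℝ) (x : Coord 2) : (modelGram K x).transpose = modelGram K x := by
  ext i j
  simp only [modelGram, Matrix.transpose_apply, Matrix.of_apply, eq_comm (a := j),
    mul_comm (x j)]

lemma blockDiag_transpose (A D : Matrix (Fin 2) (Fin 2) ℝ) :
    (blockDiag A D).transpose = blockDiag A.transpose D.transpose := by
  ext i j
  fin_cases i <;> fin_cases j <;> simp [blockDiag]

lemma continuous_fstPair : Continuous fstPair := by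
  unfold fstPair
  refine (PiLp.continuous_toLp 2 _).comp (continuous_pi fun i ↦ ?_)
  fin_cases i <;> simp <;> fun_prop

lemma continuous_sndPair : Continuous sndPair := by
  unfold sndPair
  refine (PiLp.continuous_toLp 2 _).comp (continuous_pi fun i ↦ ?_)
  fin_cases i <;> simp <;> fun_prop

/-- A splitting of the tangent bundle into complex lines makes the surface a local product. -/
lemma IsSplittingOn.isProductOfSurfacesNear (hK : IsKahler g J)
    (hφ : φ ∈ IsManifold.maximalAtlas (𝓡 4) ∞ M) {T : Fin 2 → MatField 4} {κ : Fin 2 → ℝ}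
    (h : IsSplittingOn φ.target (g.inChart φ) T κ)
    (hc : ∀ y ∈ φ.target, ∀ s, T s y * J.inChart φ y = J.inChart φ y * T s y)
    {y₀ : Coord 4} (hy₀ : y₀ ∈ φ.target) {v w : Fin 4 → ℝ}
    (hv : v ⬝ᵥ (g.inChart φ y₀).mulVec v = 1) (hw : w ⬝ᵥ (g.inChart φ y₀).mulVec w = 1)
    (hTv : (T 0 y₀).mulVec v = v) (hTw : (T 1 y₀).mulVec w = w) :
    IsProductOfSurfacesNear g J (κ 0) (κ 1) (φ.symm y₀) := by
  obtain ⟨W, H, V, θ, hW, hyW, hWU, hHs, hH0, hall⟩ :=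
    h.exists_product_map (isAlmostHermitianOn_inChart hK hφ) hc hy₀ hv hw hTv hTw
  set N : Coord 4 → Matrix (Fin 4) (Fin 4) ℝ := fun z ↦
    blockDiag (modelGram (κ 0) (fstPair z)) (modelGram (κ 1) (sndPair z)) with hN
  set Z : Coord 4 → Matrix (Fin 4) (Fin 4) ℝ := fun z ↦
    blockDiag (modelMetric (κ 0) (fstPair z)) (modelMetric (κ 1) (sndPair z)) with hZ
  have hNZ : ∀ y ∈ W, N (H y) * Z (H y) = 1 := by
    intro y hy
    obtain ⟨-, -, -, h1, h2, -⟩ := hall y hy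
    rw [hN, hZ, blockDiag_mul, modelGram_mul_modelMetric h1, modelGram_mul_modelMetric h2,
      blockDiag_one]
  have hdet : ∀ y ∈ W, (jac H y).det ≠ 0 := by
    intro y hy h0
    obtain ⟨h1, h2, -⟩ := hall y hy
    have h3 := congrArg Matrix.det (hNZ y hy)
    rw [hN] at h3
    simp only at h3
    rw [← h2, ← h1, Matrix.det_mul, Matrix.det_mul, h0] at h3
    simp at h3
  obtain ⟨ψ, hψ, W', hW'W, hyW', hpψ, hψ0, I, IJ, hsurj⟩ :=
    exists_isometric_chart g J hφ hW hWU hHs hdet hyW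
  -- the gradients of the new coordinates have the Gram matrix `N`, the inverse of `Z`
  have hgψ : ∀ z ∈ ψ.target, g.inChart ψ z = Z z ∧
      fstPair z ∈ modelSet (κ 0) ∧ sndPair z ∈ modelSet (κ 1) ∧
      J.inChart ψ z = blockDiag (modelComplex (κ 0) (fstPair z))
        (modelComplex (κ 1) (sndPair z)) := by
    intro z hz
    obtain ⟨y, hy, rfl⟩ := hsurj z hz
    obtain ⟨h1, h2, h3, m1, m2, n1, n2⟩ := hall y (hW'W hy)
    have e1 := hNZ y (hW'W hy)
    have e2 : Z (H y) * N (H y) = 1 := mul_eq_one_comm.1 e1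
    have e3 : jac H y * V y = N (H y) := by rw [h1, h2]
    have e4 : (N (H y)).transpose = N (H y) := by
      rw [hN]
      simp only [blockDiag_transpose, modelGram_transpose]
    have e5 : N (H y) * g.inChart ψ (H y) * N (H y) = N (H y) := by
      calc N (H y) * g.inChart ψ (H y) * N (H y)
          = (jac H y * V y).transpose * g.inChart ψ (H y) * (jac H y * V y) := by rw [e3, e4]
        _ = (V y).transpose * ((jac H y).transpose * g.inChart ψ (H y) * jac H y) * V y := by
            rw [Matrix.transpose_mul]; simp only [Matrix.mul_assoc]
        _ = N (H y) := by rw [← I.metric_eq y hy, h2]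
    have e6 : g.inChart ψ (H y) = Z (H y) := by
      calc g.inChart ψ (H y)
          = (Z (H y) * N (H y)) * g.inChart ψ (H y) * (N (H y) * Z (H y)) := by rw [e1, e2]; simp
        _ = Z (H y) * (N (H y) * g.inChart ψ (H y) * N (H y)) * Z (H y) := by
            simp only [Matrix.mul_assoc]
        _ = Z (H y) := by rw [e5, e2, Matrix.one_mul]
    have e7 : J.inChart ψ (H y) = blockDiag
        (θ 0 y • (!![0, 1; -1, 0] * modelMetric (κ 0) (fstPair (H y))))
        (θ 1 y • (!![0, 1; -1, 0] * modelMetric (κ 1) (sndPair (H y)))) := by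
      calc J.inChart ψ (H y) = J.inChart ψ (H y) * (N (H y) * Z (H y)) := by rw [e1]; simp
        _ = (jac H y * J.inChart φ y * V y) * Z (H y) := by
            rw [IJ y hy, ← e3]; simp only [Matrix.mul_assoc]
        _ = _ := by
            rw [h1, Matrix.mul_assoc (V y).transpose, h3, hZ, blockDiag_mul, Matrix.smul_mul,
              Matrix.smul_mul]
    have e8 := complex_inChart_sq hK hψ (I.mapsTo y hy)
    rw [e7, blockDiag_mul, ← blockDiag_one,
      show -blockDiag 1 1 = blockDiag (-1) (-1) by
        ext i j; fin_cases i <;> fin_cases j <;> simp [blockDiag]] at e8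
    obtain ⟨e9, e10⟩ := blockDiag_injective e8
    refine ⟨e6, m1, m2, ?_⟩
    rw [e7, eq_neg_sqrt_modelDisc m1 n1 e9, eq_neg_sqrt_modelDisc m2 n2 e10]
    rfl
  -- the coordinate domain is shrunk to a product of two discs
  have h0ψ : (0 : Coord 4) ∈ ψ.target := by
    rw [← hH0, ← hψ0]
    exact ψ.map_source hpψ
  obtain ⟨r, hr, hrψ⟩ := Metric.isOpen_iff.1 ψ.open_target 0 h0ψ
  set D : Set (Coord 2) := Metric.ball 0 (r / 2) with hD
  have hDo : IsOpen D := Metric.isOpen_ball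
  set V₁ := D ∩ modelSet (κ 0)
  set V₂ := D ∩ modelSet (κ 1)
  have hV₁ : IsOpen V₁ := hDo.inter (isOpen_modelSet _)
  have hV₂ : IsOpen V₂ := hDo.inter (isOpen_modelSet _)
  set Ω : Set (Coord 4) := {y | fstPair y ∈ V₁ ∧ sndPair y ∈ V₂} with hΩ
  have hΩo : IsOpen Ω := (hV₁.preimage continuous_fstPair).inter (hV₂.preimage continuous_sndPair)
  have hΩψ : Ω ⊆ ψ.target := by
    intro z hz
    refine hrψ ?_
    have n1 : ‖fstPair z‖ < r / 2 := mem_ball_zero_iff.1 hz.1.1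
    have n2 : ‖sndPair z‖ < r / 2 := mem_ball_zero_iff.1 hz.2.1
    rw [mem_ball_zero_iff]
    have n3 : ‖z‖ ^ 2 = ‖fstPair z‖ ^ 2 + ‖sndPair z‖ ^ 2 := by
      simp [EuclideanSpace.norm_sq_eq, fstPair, sndPair, Fin.sum_univ_four]
      ring
    nlinarith [norm_nonneg z, norm_nonneg (fstPair z), norm_nonneg (sndPair z)]
  have h0Ω : (0 : Coord 4) ∈ Ω := by
    have f0 : fstPair 0 = 0 := by
      ext i; fin_cases i <;> simp [fstPair]
    have s0 : sndPair 0 = 0 := by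
      ext i; fin_cases i <;> simp [sndPair]
    refine ⟨?_, ?_⟩
    · rw [f0]
      exact ⟨Metric.mem_ball_self (by linarith), by simp [modelSet, modelDisc]⟩
    · rw [s0]
      exact ⟨Metric.mem_ball_self (by linarith), by simp [modelSet, modelDisc]⟩
  obtain ⟨χ, hχ, hχt, -, hχs, hχe⟩ := exists_chart_restr (g := g) (J := J) hψ hΩo hΩψ
  refine ⟨χ, hχ, hχs _ hpψ (by rw [hψ0, hH0]; exact h0Ω), V₁, V₂, modelMetric (κ 0),
    modelComplex (κ 0), modelMetric (κ 1), modelComplex (κ 1),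
    isAlmostHermitianOn_mono (isAlmostHermitianOn_model _) hV₁ Set.inter_subset_right,
    isAlmostHermitianOn_mono (isAlmostHermitianOn_model _) hV₂ Set.inter_subset_right, hχt,
    fun y hy ↦ ?_, fun y hy ↦ ?_, fun x hx ↦ gaussCurv_modelMetric hx.2,
    fun x hx ↦ gaussCurv_modelMetric hx.2⟩
  · rw [hχt] at hy
    rw [(hχe y hy).1, (hgψ y (hΩψ hy)).1]
  · rw [hχt] at hy
    rw [(hχe y hy).2, (hgψ y (hΩψ hy)).2.2.2]

end Product

/-! ### The eigenspaces of the Ricci operator -/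

section Eigen

variable {M : Type*} [TopologicalSpace M] [ChartedSpace (Coord 4) M] [IsManifold (𝓡 4) ∞ M]
  {g : Metric M} {J : EndField M} {φ : OpenPartialHomeomorph M (Coord 4)}
  {U : Set (Coord 4)} {G : MatField 4} {x : Coord 4}

lemma IsMetricOn.mul_ricciEnd (h : IsMetricOn U G) (hx : x ∈ U) :
    G x * ricciEnd G x = ricci G x := by
  rw [ricciEnd, ← Matrix.mul_assoc, h.mul_inv hx, Matrix.one_mul]

lemma IsMetricOn.ricciEnd_transpose_mul (h : IsMetricOn U G) (hx : x ∈ U) :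
    (ricciEnd G x).transpose * G x = ricci G x := by
  conv_lhs => rw [← h.transpose hx]
  rw [← Matrix.transpose_mul, h.mul_ricciEnd hx, h.ricci_symm hx]

lemma IsBochnerFlatOn.ricciEnd_mul_complex {J : MatField 4} {τ : ℝ}
    (h : IsBochnerFlatOn U G J τ) (hx : x ∈ U) :
    ricciEnd G x * J x = J x * ricciEnd G x := by
  have hm := h.hermitian.isMetricOn
  have h1 := h.hermitian.twist_ricci h.parallel hx
  rw [← hm.mul_ricciEnd hx, ← Matrix.mul_assoc, h.hermitian.transpose_complex_mul hx] at h1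
  calc ricciEnd G x * J x = (G x)⁻¹ * (G x * ricciEnd G x) * J x := by
        rw [← Matrix.mul_assoc, hm.inv_mul hx, Matrix.one_mul]
    _ = -((G x)⁻¹ * G x * (J x * ricciEnd G x) * (J x * J x)) := by
        rw [← h1]; simp only [Matrix.neg_mul, Matrix.mul_neg, Matrix.mul_assoc]
    _ = _ := by rw [hm.inv_mul hx, h.hermitian.sq_eq x hx]; simp

/-- The projection `1/2 + S/(2κₛ)` to the eigenspace of `S` of the eigenvalue `κₛ`, for an operator
`S` with `S² = κₛ²` and the eigenvalues `κ 0 = -κ 1`. -/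
def eigenProj (κ : Fin 2 → ℝ) (S : MatField 4) (s : Fin 2) : MatField 4 := fun y ↦
  (1 / 2 : ℝ) • 1 + (1 / (2 * κ s)) • S y

/-- If the Ricci operator is trace-free with constant square `K²`, then the curvature tensor is
`-(1/2) g ∧ ρ`. With `ρ = K g₀ - K g₁` and `g = g₀ + g₁`, where `gₛ` is the restriction of `g` to an
eigenspace, the mixed terms cancel, and it splits into curvature tensors of constant curvature. -/
lemma isSplittingOn_eigenProj (hK : IsKahler g J) (hB : IsBochnerFlat g J)
    (hτ : ∀ φ ∈ IsManifold.maximalAtlas (𝓡 4) ∞ M, ∀ y ∈ φ.target, scal (g.inChart φ) y = 0)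
    (hφ : φ ∈ IsManifold.maximalAtlas (𝓡 4) ∞ M) {K : ℝ} (hK0 : K ≠ 0)
    (hS : ∀ y ∈ φ.target, ricciEnd (g.inChart φ) y * ricciEnd (g.inChart φ) y = (K ^ 2) • 1) :
    IsSplittingOn φ.target (g.inChart φ) (eigenProj ![K, -K] (ricciEnd (g.inChart φ)))
      ![K, -K] := by
  have hF := isBochnerFlatOn_inChart hK hB hτ hφ
  have hm := hF.hermitian.isMetricOn
  set κ : Fin 2 → ℝ := ![K, -K] with hκ
  have hκ0 : ∀ s, κ s ≠ 0 := fun s ↦ by fin_cases s <;> simpa [hκ]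
  have hκ2 : ∀ s, κ s * κ s = K ^ 2 := fun s ↦ by fin_cases s <;> simp [hκ] <;> ring
  have hκn : ∀ s t, s ≠ t → κ t = -κ s := fun s t hst ↦ by
    fin_cases s <;> fin_cases t <;> simp [hκ] at hst ⊢
  have hmul : ∀ y ∈ φ.target, ∀ s t, eigenProj κ (ricciEnd (g.inChart φ)) s y
      * eigenProj κ (ricciEnd (g.inChart φ)) t y
      = (1 / 4 + K ^ 2 / (4 * (κ s * κ t))) • 1
        + (1 / (4 * κ s) + 1 / (4 * κ t)) • ricciEnd (g.inChart φ) y := by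
    intro y hy s t
    simp only [eigenProj, Matrix.add_mul, Matrix.mul_add, Matrix.smul_mul, Matrix.mul_smul,
      Matrix.one_mul, Matrix.mul_one, hS y hy, smul_smul]
    module
  refine ⟨hm, fun s ↦ ?_, fun y hy s ↦ ?_, fun y hy s t hst ↦ ?_, fun y hy s ↦ ?_,
    fun y hy s m ↦ ?_, fun y hy i j a b ↦ ?_⟩
  · exact (SmoothOn.const _).add (SmoothOn.smul contDiffOn_const hm.smooth_ricciEnd)
  · rw [hmul y hy, hκ2, eigenProj]
    have hs := hκ0 s
    congr 2
    · field_simp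
      norm_num
    · field_simp
      norm_num
  · rw [hmul y hy, hκn s t hst, mul_neg, hκ2]
    have hs := hκ0 s
    have e1 : 1 / 4 + K ^ 2 / (4 * -K ^ 2) = 0 := by
      field_simp
      norm_num
    have e2 : 1 / (4 * κ s) + 1 / (4 * -κ s) = 0 := by
      field_simp
      norm_num
    rw [e1, e2]
    simp
  · simp only [eigenProj, Matrix.transpose_add, Matrix.transpose_smul, Matrix.transpose_one,
      Matrix.add_mul, Matrix.mul_add, Matrix.smul_mul, Matrix.mul_smul, Matrix.one_mul,
      Matrix.mul_one, hm.ricciEnd_transpose_mul hy, hm.mul_ricciEnd hy]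
  · have hU := hm.isOpen
    have e : pdM m (eigenProj κ (ricciEnd (g.inChart φ)) s) y
        = (1 / (2 * κ s)) • pdM m (ricciEnd (g.inChart φ)) y := by
      unfold eigenProj
      rw [pdM_add hU hy (SmoothOn.const _) (SmoothOn.smul contDiffOn_const hm.smooth_ricciEnd),
        pdM_const, pdM_smul hU hy contDiffOn_const hm.smooth_ricciEnd, pd_const]
      simp
    rw [e, pdM_ricciEnd_inChart hK hB hτ hφ hy]
    simp only [eigenProj, Matrix.add_mul, Matrix.mul_add, Matrix.smul_mul, Matrix.mul_smul,
      Matrix.one_mul, Matrix.mul_one]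
    module
  · set R : Matrix (Fin 4) (Fin 4) ℝ := Matrix.of fun a b ↦
      ∑ s, κ s * (eigenProj κ (ricciEnd (g.inChart φ)) s y a i
          * (g.inChart φ y * eigenProj κ (ricciEnd (g.inChart φ)) s y) j b
        - eigenProj κ (ricciEnd (g.inChart φ)) s y a j
          * (g.inChart φ y * eigenProj κ (ricciEnd (g.inChart φ)) s y) i b) with hR
    have hgT : ∀ s, g.inChart φ y * eigenProj κ (ricciEnd (g.inChart φ)) s y
        = (1 / 2 : ℝ) • g.inChart φ y + (1 / (2 * κ s)) • ricci (g.inChart φ) y := fun s ↦ by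
      rw [eigenProj, Matrix.mul_add, Matrix.mul_smul, Matrix.mul_smul, Matrix.mul_one,
        hm.mul_ricciEnd hy]
    have hρ : ∀ i j, ricci (g.inChart φ) y i j = ricci (g.inChart φ) y j i := fun i j ↦ by
      rw [← Matrix.transpose_apply (ricci (g.inChart φ) y), hm.ricci_symm hy]
    have e1 : g.inChart φ y * crv (g.inChart φ) i j y = g.inChart φ y * R := by
      ext l k
      have e2 : (g.inChart φ y * R) l k = ∑ s, κ s
          * ((g.inChart φ y * eigenProj κ (ricciEnd (g.inChart φ)) s y) l i
          * (g.inChart φ y * eigenProj κ (ricciEnd (g.inChart φ)) s y) j k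
        - (g.inChart φ y * eigenProj κ (ricciEnd (g.inChart φ)) s y) l j
          * (g.inChart φ y * eigenProj κ (ricciEnd (g.inChart φ)) s y) i k) := by
        rw [Matrix.mul_apply]
        simp only [hR, Matrix.of_apply, Finset.mul_sum]
        rw [Finset.sum_comm]
        refine Finset.sum_congr rfl fun s _ ↦ ?_
        rw [Matrix.mul_apply (i := l) (k := i), Matrix.mul_apply (i := l) (k := j),
          Finset.sum_mul, Finset.sum_mul, ← Finset.sum_sub_distrib, Finset.mul_sum]
        exact Finset.sum_congr rfl fun c _ ↦ by ring
      rw [← KahlerSurface.curv_eq hm hy, hF.curv_eq hy, e2]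
      have k0 : κ 0 = K := rfl
      have k1 : κ 1 = -K := rfl
      simp only [hgT, Fin.sum_univ_two, k0, k1, Matrix.add_apply, Matrix.smul_apply, smul_eq_mul,
        kn, hm.symm hy l i, hm.symm hy l j,
        hρ l i, hρ l j]
      field_simp
      ring
    have e3 : crv (g.inChart φ) i j y = R := by
      calc _ = (g.inChart φ y)⁻¹ * (g.inChart φ y * crv (g.inChart φ) i j y) := by
            rw [← Matrix.mul_assoc, hm.inv_mul hy, Matrix.one_mul]
        _ = R := by rw [e1, ← Matrix.mul_assoc, hm.inv_mul hy, Matrix.one_mul]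
    rw [e3, hR, Matrix.of_apply]

/-- If the Ricci operator is trace-free with constant square `K²`, then `M` is locally a product of
surfaces of curvatures `K` and `-K`. -/
lemma isProductOfSurfacesNear_of_sq (hK : IsKahler g J) (hB : IsBochnerFlat g J)
    (hτ : ∀ φ ∈ IsManifold.maximalAtlas (𝓡 4) ∞ M, ∀ y ∈ φ.target, scal (g.inChart φ) y = 0)
    {K : ℝ} (hK0 : K ≠ 0) (hS : ∀ φ ∈ IsManifold.maximalAtlas (𝓡 4) ∞ M, ∀ y ∈ φ.target,
      ricciEnd (g.inChart φ) y * ricciEnd (g.inChart φ) y = (K ^ 2) • 1) (p : M) :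
    IsProductOfSurfacesNear g J K (-K) p := by
  set φ := chartAt (Coord 4) p with hφdef
  have hφ : φ ∈ IsManifold.maximalAtlas (𝓡 4) ∞ M := IsManifold.chart_mem_maximalAtlas p
  have hp : p ∈ φ.source := mem_chart_source (Coord 4) p
  have hy := φ.map_source hp
  have hF := isBochnerFlatOn_inChart hK hB hτ hφ
  have h := isSplittingOn_eigenProj hK hB hτ hφ hK0 (hS φ hφ)
  have hex : ∀ s, ∃ v : Fin 4 → ℝ, v ⬝ᵥ (g.inChart φ (φ p)).mulVec v = 1 ∧
      (eigenProj ![K, -K] (ricciEnd (g.inChart φ)) s (φ p)).mulVec v = v := by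
    intro s
    have hκ0 : (![K, -K] : Fin 2 → ℝ) s ≠ 0 := by fin_cases s <;> simpa
    -- the eigenspace is not zero, since the trace of the projection is 2
    obtain ⟨x, hx⟩ : ∃ x, (eigenProj ![K, -K] (ricciEnd (g.inChart φ)) s (φ p)).mulVec x ≠ 0 := by
      by_contra! hall
      have h0 : eigenProj ![K, -K] (ricciEnd (g.inChart φ)) s (φ p) = 0 := by
        ext a b
        have := congrFun (hall (Pi.single b 1)) a
        simpa using this
      have h1 := congrArg Matrix.trace h0
      have h2 : (ricciEnd (g.inChart φ) (φ p)).trace = 0 := hF.trace_eq hy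
      simp [eigenProj, Matrix.trace_add, Matrix.trace_smul, h2] at h1
    obtain ⟨c, hc⟩ := exists_unit (hF.hermitian.posDef _ hy) hx
    refine ⟨_, hc, ?_⟩
    rw [Matrix.mulVec_smul, Matrix.mulVec_mulVec, h.mul_self _ hy]
  obtain ⟨v, hv, hTv⟩ := hex 0
  obtain ⟨w, hw, hTw⟩ := hex 1
  have := h.isProductOfSurfacesNear hK hφ (fun y hy s ↦ by
    simp only [eigenProj, Matrix.add_mul, Matrix.mul_add, Matrix.smul_mul, Matrix.mul_smul,
      Matrix.one_mul, Matrix.mul_one, hF.ricciEnd_mul_complex hy]) hy hv hw hTv hTw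
  rwa [φ.left_inv hp] at this

end Eigen

end KahlerSurface

end

theorem mainTheorem2 {M : Type*} [TopologicalSpace M] [T2Space M] [SecondCountableTopology M]
    [ConnectedSpace M] [ChartedSpace (EuclideanSpace ℝ (Fin 4)) M] [IsManifold (𝓡 4) ∞ M]
    (g : KahlerSurface.Metric M) (J : KahlerSurface.EndField M)
    (hK : KahlerSurface.IsKahler g J)
    (hB : KahlerSurface.IsBochnerFlat g J)
    (hτ : KahlerSurface.HasConstantScalarCurvature g) :
    (∃ c : ℝ, KahlerSurface.HasConstantHolSectCurv g J c) ∨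
      (∃ K : ℝ, K ≠ 0 ∧ ∀ p : M, KahlerSurface.IsProductOfSurfacesNear g J K (-K) p) := by
  obtain ⟨τ, hτ⟩ := hτ
  obtain ⟨c, hc, h⟩ := KahlerSurface.exists_sq_traceFree_ricciEnd hK hB hτ
  rcases hc.eq_or_lt with rfl | hc0
  · left
    exact ⟨τ / 6, fun φ hφ y hy v hv ↦
      (KahlerSurface.isBochnerFlatOn_inChart hK hB hτ hφ).holSectCurv_eq hy
        ((h φ hφ y hy).1 rfl) hv⟩
  · right
    -- the trace-free Ricci operator does not vanish, hence the scalar curvature does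
    have hτ0 : τ = 0 := by
      obtain ⟨p⟩ : Nonempty M := inferInstance
      have hφ := IsManifold.chart_mem_maximalAtlas (I := 𝓡 4) (n := ∞) p
      have hy := mem_chart_target (EuclideanSpace ℝ (Fin 4)) p
      have h1 := (KahlerSurface.sq_traceFree_ricciEnd_inChart hK hB hτ hφ hy).2
      refine (smul_eq_zero.1 h1).resolve_right fun h0 ↦ ?_
      have h2 := (h _ hφ _ hy).2
      rw [h0, Matrix.zero_mul] at h2
      have h3 := congrFun (congrFun h2 0) 0
      simp at h3
      exact hc0.ne h3
    subst hτ0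
    have hs : √c ^ 2 = c := Real.sq_sqrt hc
    refine ⟨√c, (Real.sqrt_pos.2 hc0).ne', fun p ↦
      KahlerSurface.isProductOfSurfacesNear_of_sq hK hB hτ (Real.sqrt_pos.2 hc0).ne'
        (fun φ hφ y hy ↦ ?_) p⟩
    have := (h φ hφ y hy).2
    rwa [zero_div, zero_smul, sub_zero, ← hs] at this
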